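/- Let $\mathbb F\in\{\mathbb R,\mathbb C,\mathbb H\}$ and $G=\mathrm{SL}(3,\mathbb F)$ (for $\mathbb F=\mathbb H$: the quaternionic matrices of reduced norm $1$). Let $\theta(g)=(g^{-1})^\dagger$, let $\sigma(g)=D\,\theta(g)\,D$ with $D=\mathrm{diag}(1,-1,-1)$, let $K=G^\theta$, and let $H$ be the identity component of $G^\sigma=\{g\in G:\sigma(g)=g\}$. Let $\mathfrak a$ be the Lie algebra of real diagonal matrices of trace zero, with roots $e_j-e_k$ $(j\neq k)$ and root spaces $\mathfrak g_{j,k}$ in $\mathfrak g=\mathrm{Lie}(G)$, where $e_j(\mathrm{diag}(x_1,x_2,x_3))=x_j$. A minimal parabolic subgroup of $G$ is a $G$-conjugate of $Z_K(\mathfrak a)\exp(\mathfrak a)\exp(\mathfrak g_{1,2}\oplus\mathfrak g_{1,3}\oplus\mathfrak g_{2,3})$; a parabolic subgroup is a subgroup of $G$ containing a minimal parabolic subgroup; a maximal parabolic subgroup is a maximal element, with respect to inclusion, of the set of parabolic subgroups different from $G$. Two parabolic subgroups are opposite if their intersection is a Levi subgroup of both, i.e. a complement in each of its unipotent radical. A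 parabolic subgroup $P$ is called a $\sigma$-parabolic subgroup if $\sigma(P)$ is opposite to $P$. Let $\mathcal P_\sigma$ be the set of minimal elements, with respect to inclusion, of the set of $\sigma$-parabolic subgroups, and $\mathcal Q_\sigma$ the set of maximal elements of the set of $\sigma$-parabolic subgroups different from $G$. The group $H$ acts on both by conjugation. For $i\in\{1,2,3\}$ let $P_i$ be the unique minimal parabolic subgroup such that $\mathfrak a\subset\mathrm{Lie}(P_i)$ and the set of roots of $\mathfrak a$ in $\mathrm{Lie}(P_i)$ is $\Sigma_i$, where $$\Sigma_1=\{e_1-e_2,e_1-e_3,e_2-e_3\},\quad \Sigma_2=\{e_2-e_1,e_1-e_3,e_2-e_3\},\quad \Sigma_3=\{e_2-e_1,e_3-e_1,e_2-e_3\}.$$ For $i\in\{1,2,3,4\}$ let $Q_i$ be the unique maximal parabolic subgroup such that $\mathfrak a\subset\mathrm{Lie}(Q_i)$ and the nilradical (largest nilpotent ideal) of $\mathrm{Lie}(Q_i)$ is $\mathfrak n_i$, where $$\mathfrak n_1=\mathfrak g_{1,3}\oplus\mathfrak g_{2,3},\quad \mathfrak n_2=\mathfrak g_{2,1}\oplus\mathfrak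 g_{3,1},\quad \mathfrak n_3=\mathfrak g_{1,2}\oplus\mathfrak g_{1,3},\quad \mathfrak n_4=\mathfrak g_{2,1}\oplus\mathfrak g_{2,3}.$$ Then the action of $H$ on $\mathcal P_\sigma$ has exactly three orbits, and $H\backslash\mathcal P_\sigma=\{[P_1],[P_2],[P_3]\}$. The action of $H$ on $\mathcal Q_\sigma$ has exactly four orbits, and $H\backslash\mathcal Q_\sigma=\{[Q_1],[Q_2],[Q_3],[Q_4]\}$. Here $[P]$ denotes the $H$-conjugacy class of $P$; in particular the listed classes are pairwise distinct. The existence and uniqueness of the groups $P_i$ and $Q_i$ is part of the claim. -/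

import Mathlib

namespace SL3

noncomputable section

/-! ### The groups `SL(3, F)` for `F = ℝ, ℂ, ℍ` -/

/-- Square matrices of size `3` over `F`. -/
abbrev Mat (F : Type) : Type := Matrix (Fin 3) (Fin 3) F

/-- The group `GL(3, F)` of invertible `3 × 3` matrices over a (possibly noncommutative) `F`. -/
abbrev GL3 (F : Type) [Ring F] : Type := (Mat F)ˣ

/-- `SL(3, F)` for commutative `F`: the matrices with determinant one. -/
def slComm (F : Type) [CommRing F] : Subgroup (GL3 F) :=
  ((Matrix.detMonoidHom : Mat F →* F).comp (Units.coeHom (Mat F))).ker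

/-- The embedding `ℍ → M₂(ℂ)`, `α + β j ↦ (α, β; -β̄, ᾱ)` for `α, β ∈ ℂ`. -/
def quaternionToComplex : Quaternion ℝ →+* Matrix (Fin 2) (Fin 2) ℂ where
  toFun q := !![⟨q.re, q.imI⟩, ⟨q.imJ, q.imK⟩; ⟨-q.imJ, q.imK⟩, ⟨q.re, -q.imI⟩]
  map_one' := by
    have h : (1 : Quaternion ℝ) = ⟨1, 0, 0, 0⟩ := rfl
    ext i j
    rw [h]
    fin_cases i <;> fin_cases j <;> simp [Complex.ext_iff]
  map_mul' p q := by
    ext i j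
    fin_cases i <;> fin_cases j <;>
      simp [Matrix.mul_apply, Fin.sum_univ_two, Complex.ext_iff] <;> constructor <;> ring
  map_zero' := by
    have h : (0 : Quaternion ℝ) = ⟨0, 0, 0, 0⟩ := rfl
    ext i j
    rw [h]
    fin_cases i <;> fin_cases j <;> simp [Complex.ext_iff]
  map_add' p q := by
    ext i j
    fin_cases i <;> fin_cases j <;> simp [Complex.ext_iff] <;> ring

/-- The embedding `M₃(ℍ) → M₆(ℂ)` obtained by replacing every quaternion entry by the
corresponding complex `2 × 2` block. -/
def quaternionMatrixToComplex :
    Mat (Quaternion ℝ) →+* Matrix (Fin 3 × Fin 2) (Fin 3 × Fin 2) ℂ :=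
  (Matrix.compRingEquiv (Fin 3) (Fin 2) ℂ).toRingHom.comp quaternionToComplex.mapMatrix

/-- `SL(3, ℍ)`: the quaternionic matrices with reduced norm one, i.e. whose associated complex
`6 × 6` matrix has determinant one. -/
def slQuaternion : Subgroup (GL3 (Quaternion ℝ)) :=
  (((Matrix.detMonoidHom : Matrix (Fin 3 × Fin 2) (Fin 3 × Fin 2) ℂ →* ℂ).comp
    (quaternionMatrixToComplex : Mat (Quaternion ℝ) →* _)).comp (Units.coeHom _)).ker

/-- `IsSL3 F G` says that `F` is one of `ℝ, ℂ, ℍ`, with its standard norm, real algebra structure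
and conjugation, and that `G` is the subgroup `SL(3, F)` of `GL(3, F)`. -/
inductive IsSL3 : ∀ (F : Type) [NormedDivisionRing F] [NormedAlgebra ℝ F] [StarRing F],
    Subgroup (GL3 F) → Prop
  | real : IsSL3 ℝ (slComm ℝ)
  | complex : IsSL3 ℂ (slComm ℂ)
  | quaternion : IsSL3 (Quaternion ℝ) slQuaternion

section

variable {F : Type} [NormedDivisionRing F] [NormedAlgebra ℝ F] [StarRing F]

/-! ### The involutions and the groups `K` and `H` -/

/-- The matrix `diag(1, -1, -1)`. -/
def signature (F : Type) [Ring F] : GL3 F where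
  val := Matrix.diagonal ![1, -1, -1]
  inv := Matrix.diagonal ![1, -1, -1]
  val_inv := by
    ext i j
    fin_cases i <;> fin_cases j <;> simp [Matrix.diagonal, Matrix.mul_apply]
  inv_val := by
    ext i j
    fin_cases i <;> fin_cases j <;> simp [Matrix.diagonal, Matrix.mul_apply]

/-- The Cartan involution `θ(g) = (g⁻¹)†`, where `†` is the conjugate transpose. -/
def theta (F : Type) [NormedDivisionRing F] [StarRing F] : GL3 F →* GL3 F where
  toFun g := star g⁻¹
  map_one' := by simp
  map_mul' g h := by simp

/-- The involution `σ(g) = D θ(g) D` with `D = diag(1, -1, -1)`. -/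
def sigma (F : Type) [NormedDivisionRing F] [StarRing F] : GL3 F →* GL3 F where
  toFun g := signature F * theta F g * signature F
  map_one' := by
    rw [map_one, mul_one]
    exact Units.ext (signature F).val_inv
  map_mul' g h := by
    have hD : signature F * signature F = 1 := Units.ext (signature F).val_inv
    rw [map_mul]
    calc signature F * (theta F g * theta F h) * signature F
        = signature F * theta F g * 1 * theta F h * signature F := by group
      _ = signature F * theta F g * (signature F * signature F) * theta F h * signature F := by
          rw [hD]
      _ = _ := by group

/-- The subgroup of the elements of `G` that are fixed by the endomorphism `τ`. -/
def fixedBy (G : Subgroup (GL3 F)) (τ : GL3 F →* GL3 F) : Subgroup (GL3 F) :=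
  G ⊓ τ.eqLocus (MonoidHom.id _)

/-- The maximal compact subgroup `K = G^θ`. -/
def K (G : Subgroup (GL3 F)) : Subgroup (GL3 F) := fixedBy G (theta F)

/-- The identity component `H` of the symmetric subgroup `G^σ`. -/
def H (G : Subgroup (GL3 F)) : Subgroup (GL3 F) :=
  (Subgroup.connectedComponentOfOne (fixedBy G (sigma F))).map (fixedBy G (sigma F)).subtype

/-- The conjugate `g P g⁻¹`. -/
def conj (g : GL3 F) (P : Subgroup (GL3 F)) : Subgroup (GL3 F) :=
  P.map (MulAut.conj g).toMonoidHom

/-! ### Lie algebras -/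

/- Matrices form a Lie ring with the commutator `X Y - Y X` as bracket. -/
attribute [local instance 100] LieRing.ofAssociativeRing

/-- The subgroup generated by the exponentials of the elements of `S`. -/
def expGroup (S : Set (Mat F)) : Subgroup (GL3 F) :=
  Subgroup.closure {u | ∃ X ∈ S, (u : Mat F) = NormedSpace.exp X}

/-- The Lie algebra of a closed subgroup `P` of `GL(3, F)`: the matrices `X` with `exp(tX) ∈ P`
for all real `t`. For a closed subgroup these form a real Lie subalgebra, so that taking the
Lie span does not add anything. -/
def lie (P : Subgroup (GL3 F)) : LieSubalgebra ℝ (Mat F) :=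
  LieSubalgebra.lieSpan ℝ (Mat F)
    {X | ∀ t : ℝ, ∃ u ∈ P, (u : Mat F) = NormedSpace.exp (t • X)}

/-- The nilradical of a Lie subalgebra `q` of `M₃(F)`, i.e. its largest nilpotent ideal, as a
space of matrices. -/
def nilradical (q : LieSubalgebra ℝ (Mat F)) : Submodule ℝ (Mat F) :=
  (sSup {I : LieIdeal ℝ q | LieRing.IsNilpotent I}).toSubmodule.map q.toSubmodule.subtype

/-- The matrix `diag(x₁, x₂, x₃)` for real `x₁, x₂, x₃`. -/
def realDiag (F : Type) [NormedDivisionRing F] [NormedAlgebra ℝ F] (x : Fin 3 → ℝ) : Mat F :=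
  Matrix.diagonal fun i => algebraMap ℝ F (x i)

/-- The maximal split abelian subalgebra `𝔞`: the real diagonal matrices of trace zero. -/
def 𝔞 (F : Type) [NormedDivisionRing F] [NormedAlgebra ℝ F] : Set (Mat F) :=
  {X | ∃ x : Fin 3 → ℝ, ∑ i, x i = 0 ∧ X = realDiag F x}

/-- The root space of the root `e_j - e_k` of `𝔞` in the Lie algebra of `G`. A root `e_j - e_k` is
represented by the pair `(j, k)`; the indices `1, 2, 3` are `0, 1, 2` here. -/
def rootSpace (G : Subgroup (GL3 F)) (r : Fin 3 × Fin 3) : Submodule ℝ (Mat F) where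
  carrier := {X | X ∈ lie G ∧ ∀ x : Fin 3 → ℝ, ∑ i, x i = 0 →
    ⁅realDiag F x, X⁆ = (x r.1 - x r.2) • X}
  add_mem' := by
    rintro X Y ⟨hX, hX'⟩ ⟨hY, hY'⟩
    exact ⟨add_mem hX hY, fun x hx => by rw [lie_add, hX' x hx, hY' x hx, smul_add]⟩
  zero_mem' := ⟨zero_mem _, fun x _ => by rw [lie_zero, smul_zero]⟩
  smul_mem' := by
    rintro c X ⟨hX, hX'⟩
    exact ⟨(lie G).smul_mem c hX, fun x hx => by rw [lie_smul, hX' x hx, smul_comm]⟩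

/-- The direct sum of the root spaces of the roots in `S`. -/
def rootSpaceSum (G : Subgroup (GL3 F)) (S : Set (Fin 3 × Fin 3)) : Submodule ℝ (Mat F) :=
  ⨆ r ∈ S, rootSpace G r

/-- The set of roots of `𝔞` in `Lie(P)`. -/
def roots (G P : Subgroup (GL3 F)) : Set (Fin 3 × Fin 3) :=
  {r | r.1 ≠ r.2 ∧ (lie P).toSubmodule ⊓ rootSpace G r ≠ ⊥}

/-- The positive systems `Σ₁, Σ₂, Σ₃`. -/
def posSystem : Fin 3 → Set (Fin 3 × Fin 3) :=
  ![{(0, 1), (0, 2), (1, 2)}, {(1, 0), (0, 2), (1, 2)}, {(1, 0), (2, 0), (1, 2)}]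

/-- The sets of roots of the nilradicals `𝔫₁, 𝔫₂, 𝔫₃, 𝔫₄`. -/
def nilRoots : Fin 4 → Set (Fin 3 × Fin 3) :=
  ![{(0, 2), (1, 2)}, {(1, 0), (2, 0)}, {(0, 1), (0, 2)}, {(1, 0), (1, 2)}]

/-! ### Parabolic subgroups -/

/-- `M = Z_K(𝔞)`, the centralizer of `𝔞` in `K`. -/
def M (G : Subgroup (GL3 F)) : Subgroup (GL3 F) where
  carrier := {k | k ∈ K G ∧ ∀ X ∈ 𝔞 F, (k : Mat F) * X = X * k}
  one_mem' := ⟨one_mem _, fun X _ => by simp⟩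
  mul_mem' := by
    rintro a b ⟨ha, ha'⟩ ⟨hb, hb'⟩
    refine ⟨mul_mem ha hb, fun X hX => ?_⟩
    rw [Units.val_mul, mul_assoc, hb' X hX, ← mul_assoc, ha' X hX, mul_assoc]
  inv_mem' := by
    rintro a ⟨ha, ha'⟩
    refine ⟨inv_mem ha, fun X hX => ?_⟩
    rw [Units.inv_mul_eq_iff_eq_mul, ← mul_assoc, ha' X hX, mul_assoc, Units.mul_inv, mul_one]

/-- The standard minimal parabolic subgroup `M A N`, with `M = Z_K(𝔞)`, `A = exp 𝔞` and
`N = exp 𝔫`, where `𝔫` is the sum of the root spaces for the roots in `Σ₁`. -/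
def stdMinimalParabolic (G : Subgroup (GL3 F)) : Subgroup (GL3 F) :=
  M G ⊔ expGroup (𝔞 F) ⊔ expGroup (rootSpaceSum G (posSystem 0) : Set (Mat F))

/-- A minimal parabolic subgroup of `G` is a `G`-conjugate of `M A N`. -/
def IsMinimalParabolic (G P : Subgroup (GL3 F)) : Prop :=
  ∃ g ∈ G, P = conj g (stdMinimalParabolic G)

/-- A parabolic subgroup of `G` is a subgroup that contains a minimal parabolic subgroup. -/
def IsParabolic (G P : Subgroup (GL3 F)) : Prop :=
  P ≤ G ∧ ∃ B ≤ P, IsMinimalParabolic G B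

/-- A maximal parabolic subgroup is a maximal proper parabolic subgroup. -/
def IsMaximalParabolic (G P : Subgroup (GL3 F)) : Prop :=
  Maximal (fun Q => IsParabolic G Q ∧ Q ≠ G) P

/-- The unipotent radical of a parabolic subgroup: the analytic subgroup whose Lie algebra is the
nilradical of `Lie(P)`. -/
def unipotentRadical (P : Subgroup (GL3 F)) : Subgroup (GL3 F) :=
  expGroup (nilradical (lie P) : Set (Mat F))

/-- `L` is a Levi subgroup of the parabolic subgroup `P`, i.e. `P = L ⋉ N_P` with `N_P` the
unipotent radical. -/
def IsLevi (P L : Subgroup (GL3 F)) : Prop :=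
  L ⊔ unipotentRadical P = P ∧ L ⊓ unipotentRadical P = ⊥

/-- Two parabolic subgroups are opposite if their intersection is a Levi subgroup of both. -/
def AreOpposite (P P' : Subgroup (GL3 F)) : Prop :=
  IsLevi P (P ⊓ P') ∧ IsLevi P' (P ⊓ P')

/-- A `σ`-parabolic subgroup is a parabolic subgroup `P` such that `σ(P)` is opposite to `P`. -/
def IsSigmaParabolic (G P : Subgroup (GL3 F)) : Prop :=
  IsParabolic G P ∧ AreOpposite (P.map (sigma F)) P

/-- The set `𝒫_σ` of all minimal `σ`-parabolic subgroups, i.e. of the minimal elements of the set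
of all `σ`-parabolic subgroups. -/
def minimalSigmaParabolics (G : Subgroup (GL3 F)) : Set (Subgroup (GL3 F)) :=
  {P | Minimal (IsSigmaParabolic G) P}

/-- The set `𝒬_σ` of all maximal `σ`-parabolic subgroups, i.e. of the maximal elements of the set
of all `σ`-parabolic subgroups different from `G`. -/
def maximalSigmaParabolics (G : Subgroup (GL3 F)) : Set (Subgroup (GL3 F)) :=
  {P | Maximal (fun Q => IsSigmaParabolic G Q ∧ Q ≠ G) P}

/-- The property that determines `P_i`: it is a minimal parabolic subgroup, its Lie algebra
contains `𝔞`, and the set of roots of `𝔞` in its Lie algebra is `Σ_i`. -/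
def IsStdP (G : Subgroup (GL3 F)) (i : Fin 3) (P : Subgroup (GL3 F)) : Prop :=
  IsMinimalParabolic G P ∧ 𝔞 F ⊆ lie P ∧ roots G P = posSystem i

/-- The property that determines `Q_i`: it is a maximal parabolic subgroup, its Lie algebra
contains `𝔞`, and the nilradical of its Lie algebra is `𝔫_i`. -/
def IsStdQ (G : Subgroup (GL3 F)) (i : Fin 4) (Q : Subgroup (GL3 F)) : Prop :=
  IsMaximalParabolic G Q ∧ 𝔞 F ⊆ lie Q ∧
    nilradical (lie Q) = rootSpaceSum G (nilRoots i)

end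

end

end SL3

/-!
Parabolic subgroups of `SL(3, F)` are stabilizers of flags in `F³`, and `σ` is the involution that
is attached to the hermitian form `x† D y` of signature `(1, 2)`. A parabolic subgroup turns out to
be `σ`-parabolic if and only if the form is nondegenerate on the subspaces of its flag. By
Gram–Schmidt such a flag is spanned by an orthogonal basis, and the `H`-orbit of the flag only
depends on the position of the unique positive vector in this basis. This gives three orbits of full
flags. For a plane or a line there are two orbits each, according to whether the positive vector
belongs to the subspace or not.

The three fields are treated simultaneously: `Determinant` collects what is needed about the
determinant, respectively the reduced norm, and `IsSL3.exists_determinant` provides it.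

The Lie theoretic definitions are translated into matrices as follows. For `b : Fin 3 → Fin 3` let
`par G b` be the group of block triangular matrices whose shape is given by `b`.
* `Determinant.stdMinimalParabolic_eq` identifies `M A N` with the upper triangular matrices, and
  `Determinant.isParabolic_iff` shows, by means of the Bruhat decomposition, that all the parabolic
  subgroups are conjugate to one of the four groups that contain it.
* `Determinant.nilradical_lie_par` computes nilradicals and thereby unipotent radicals.
* `Determinant.isSigmaParabolic_conj_par` shows that `h (par G b) h⁻¹` is `σ`-parabolic for `h` in
  `G^σ`. Conversely, if the flag of `P = g (par G b) g⁻¹` is degenerate with respect to the form,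
  then the unipotent radical of `P` meets `σ(P)` nontrivially, see
  `Determinant.eq_zero_of_isSigmaParabolic` and the consequences for entries of the Gram matrix
  `gram g = g† D g` and its inverse.

For the orbits, `Determinant.exists_eq_mul_weyl_mul` is the Gram–Schmidt argument: it factors `g` as
`h w b` with `h` in `H`, one of three Weyl group elements `w` and `b` upper triangular. It depends on
`Determinant.exists_mem_H_mul_diagonal`, which clears the entries of an element of `G^σ` by rotations
and boosts in `H`, so that only diagonal matrices represent components of `G^σ`. A nondegenerate
line or plane is first completed to a nondegenerate flag. Consequently every `σ`-parabolic subgroup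
contains an `H`-conjugate of some `P_i`, and is contained in an `H`-conjugate of some `Q_i` if it is
proper.

The listed classes are distinct because the stabilizers of flags, lines and planes are their own
normalizers, so that a conjugacy under `H` preserves the signs of the form on the line and of the
dual form on the plane (`eq_zero_iff_of_gram_eq`, `eq_two_iff_of_gram_eq`).
-/

namespace SL3

noncomputable section

attribute [local instance] LieRing.ofAssociativeRing

open Matrix (BlockTriangular)

/-! ### The matrix exponential -/

section Exp

variable {F : Type} [NormedDivisionRing F] [NormedAlgebra ℝ F]

theorem exp_of_cube_eq_zero {X : Mat F} (hX : X * X * X = 0) :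
    NormedSpace.exp X = 1 + X + (2⁻¹ : ℝ) • (X * X) := by
  rw [NormedSpace.exp_eq_tsum ℝ]
  have h : ∀ n ∉ Finset.range 3, ((n.factorial : ℝ)⁻¹) • X ^ n = 0 := by
    intro n hn
    obtain ⟨m, rfl⟩ : ∃ m, n = m + 3 := ⟨n - 3, by simp at hn; omega⟩
    rw [pow_add, pow_succ X 2, pow_two, hX, mul_zero, smul_zero]
  change ∑' n : ℕ, ((n.factorial : ℝ)⁻¹) • X ^ n = _
  rw [tsum_eq_sum h]
  simp [Finset.sum_range_succ, pow_two, Nat.factorial]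

variable [CompleteSpace F]

/-- A curve `exp(tX)` of matrices has derivative `X` at `t = 0`, entrywise. -/
theorem hasDerivAt_exp_smul_apply {n : Type} [Fintype n] [DecidableEq n] (X : Matrix n n F)
    (i j : n) : HasDerivAt (fun t : ℝ => (NormedSpace.exp (t • X)) i j) (X i j) 0 := by
  let : NormedRing (Matrix n n F) := Matrix.linftyOpNormedRing
  let : NormedAlgebra ℝ (Matrix n n F) := Matrix.linftyOpNormedAlgebra
  have : @CompleteSpace (Matrix n n F) PseudoMetricSpace.toUniformSpace :=
    inferInstanceAs (CompleteSpace (n → n → F))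
  have h := hasDerivAt_exp_smul_const (𝕂 := ℝ) X 0
  rw [zero_smul, NormedSpace.exp_zero, one_mul] at h
  let e : Matrix n n F →L[ℝ] F :=
    ⟨Matrix.entryLinearMap ℝ F i j, by
      change Continuous fun M : Matrix n n F => M i j
      fun_prop⟩
  exact e.hasFDerivAt.comp_hasDerivAt (0 : ℝ) h

theorem exp_realDiag (x : Fin 3 → ℝ) :
    NormedSpace.exp (realDiag F x) = realDiag F fun i => Real.exp (x i) := by
  let : NormedAlgebra ℚ F := NormedAlgebra.restrictScalars ℚ ℝ F
  unfold realDiag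
  rw [Matrix.exp_diagonal]
  congr 1
  funext i
  rw [Pi.coe_exp, ← NormedSpace.algebraMap_exp_comm, Real.exp_eq_exp_ℝ]

theorem exp_conj (g : GL3 F) (X : Mat F) :
    NormedSpace.exp (g * X * (g⁻¹ : GL3 F) : Mat F) = g * NormedSpace.exp X * (g⁻¹ : GL3 F) := by
  let : NormedAlgebra ℚ F := NormedAlgebra.restrictScalars ℚ ℝ F
  exact Matrix.exp_units_conj g X

/-- The exponential of a matrix as an invertible matrix. -/
def expUnit (X : Mat F) : GL3 F where
  val := NormedSpace.exp X
  inv := NormedSpace.exp (-X)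
  val_inv := by
    let : NormedAlgebra ℚ F := NormedAlgebra.restrictScalars ℚ ℝ F
    rw [← Matrix.exp_add_of_commute _ _ (Commute.neg_right (Commute.refl X)), add_neg_cancel,
      NormedSpace.exp_zero]
  inv_val := by
    let : NormedAlgebra ℚ F := NormedAlgebra.restrictScalars ℚ ℝ F
    rw [← Matrix.exp_add_of_commute _ _ (Commute.neg_left (Commute.refl X)), neg_add_cancel,
      NormedSpace.exp_zero]

end Exp

/-! ### The common properties of `ℝ`, `ℂ` and `ℍ` -/

/-- The properties of the conjugation of `ℝ`, `ℂ` and `ℍ` that are used. -/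
class IsRCH (F : Type) [NormedDivisionRing F] [NormedAlgebra ℝ F] [StarRing F] : Prop where
  finite : FiniteDimensional ℝ F
  star_mul_self' : ∀ a : F, star a * a = algebraMap ℝ F (‖a‖ ^ 2)
  star_algebraMap' : ∀ r : ℝ, star (algebraMap ℝ F r) = algebraMap ℝ F r

/-- A determinant for `G ≤ GL(3, F)`: a multiplicative map `δ` on matrices that cuts out `G`,
together with its differential `τ` at the identity. For `ℝ` and `ℂ` these are the determinant
and the trace, and for `ℍ` the reduced norm and the reduced trace. The natural number `k`
is the square root of the dimension of `F` over its centre: `1` for `ℝ` and `ℂ`, and `2` for `ℍ`. -/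
structure Determinant {F : Type} [NormedDivisionRing F] [NormedAlgebra ℝ F] [StarRing F]
    (G : Subgroup (GL3 F)) where
  δ : Mat F →* ℂ
  continuous_δ : Continuous δ
  mem_iff : ∀ g : GL3 F, g ∈ G ↔ δ g = 1
  map_star : ∀ X, δ (star X) = star (δ X)
  k : ℕ
  k_ne_zero : k ≠ 0
  map_realDiag : ∀ x : Fin 3 → ℝ, δ (realDiag F x) = (((∏ i, x i) ^ k : ℝ) : ℂ)
  τ : Mat F →ₗ[ℝ] ℂ
  τ_mul_comm : ∀ X Y, τ (X * Y) = τ (Y * X)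
  τ_eq_zero : ∀ X : Mat F, (∀ t : ℝ, δ (NormedSpace.exp (t • X)) = 1) → τ X = 0
  τ_central : ∀ z : F, (∀ y, z * y = y * z) → τ (Matrix.diagonal fun _ => z) = 0 → z = 0

/-- The derivative of the determinant at the identity matrix is the trace. -/
theorem hasDerivAt_det {n : Type} [Fintype n] [DecidableEq n] {M : ℝ → Matrix n n ℂ}
    {Y : Matrix n n ℂ} (h0 : M 0 = 1) (h : ∀ i j, HasDerivAt (fun t => M t i j) (Y i j) 0) :
    HasDerivAt (fun t => (M t).det) Y.trace 0 := by
  have key : HasDerivAt (fun t => (M t).det)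
      (∑ s : Equiv.Perm n, (Equiv.Perm.sign s : ℤ) •
        ∑ i, (∏ j ∈ Finset.univ.erase i, M 0 (s j) j) • Y (s i) i) 0 := by
    simp only [Matrix.det_apply]
    refine HasDerivAt.fun_sum fun s _ => ?_
    exact HasDerivAt.fun_const_smul ((Equiv.Perm.sign s : ℤ)) (HasDerivAt.fun_finsetProd fun i _ => h (s i) i)
  convert key using 1
  rw [Finset.sum_eq_single 1]
  · simp only [Equiv.Perm.sign_one, Equiv.Perm.one_apply, h0, Matrix.one_apply_eq,
      Finset.prod_const_one, Matrix.trace, Matrix.diag, one_smul, Units.val_one]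
  · intro s _ hs
    convert smul_zero _
    refine Finset.sum_eq_zero fun i _ => ?_
    obtain ⟨j, hj, hji⟩ : ∃ j, s j ≠ j ∧ j ≠ i := by
      by_contra! hc
      apply hs
      ext j
      by_cases hji : j = i
      · by_contra hne
        have h1 : s j ≠ j := fun h => hne (by simpa using h)
        have h2 : s (s j) = s j := by
          by_contra h3
          exact h1 ((hc _ h3).trans hji.symm)
        exact h1 (s.injective h2)
      · simpa using by_contra fun h => hji (hc j h)
    rw [Finset.prod_eq_zero (Finset.mem_erase.2 ⟨hji, Finset.mem_univ j⟩), zero_smul]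
    rw [h0, Matrix.one_apply_ne hj]
  · simp

/-! ### The determinants of `SL(3, F)` for `F = ℝ, ℂ, ℍ` -/

instance : IsRCH ℝ where
  finite := inferInstance
  star_mul_self' a := by simp [pow_two]
  star_algebraMap' r := by simp

instance : IsRCH ℂ where
  finite := inferInstance
  star_mul_self' a := by
    simpa using Complex.conj_mul' a
  star_algebraMap' r := by simp

instance : IsRCH (Quaternion ℝ) where
  finite := inferInstance
  star_mul_self' a := by
    rw [Quaternion.star_mul_self, Quaternion.normSq_eq_norm_mul_self, pow_two]
    rfl
  star_algebraMap' r := Quaternion.star_coe r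

/-- A determinant built from a representation of `M₃(F)` by complex matrices. -/
def Determinant.ofRep {F : Type} [NormedDivisionRing F] [NormedAlgebra ℝ F] [StarRing F]
    {G : Subgroup (GL3 F)} {n : Type} [Fintype n] [DecidableEq n]
    (ρ : Mat F →ₐ[ℝ] Matrix n n ℂ) [CompleteSpace F]
    [FiniteDimensional ℝ F]
    (mem_iff : ∀ g : GL3 F, g ∈ G ↔ (ρ g).det = 1)
    (map_star : ∀ X, ρ (star X) = star (ρ X)) (k : ℕ) (hk : k ≠ 0)
    (map_realDiag : ∀ x : Fin 3 → ℝ, (ρ (realDiag F x)).det = (((∏ i, x i) ^ k : ℝ) : ℂ))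
    (central : ∀ z : F, (∀ y, z * y = y * z) →
      (ρ (Matrix.diagonal fun _ => z)).trace = 0 → z = 0) :
    Determinant G where
  δ := Matrix.detMonoidHom.comp (ρ : Mat F →* Matrix n n ℂ)
  continuous_δ := by
    have h : Continuous ρ.toLinearMap := LinearMap.continuous_of_finiteDimensional _
    exact h.matrix_det
  mem_iff := mem_iff
  map_star X := by
    change (ρ (star X)).det = star (ρ X).det
    rw [map_star, Matrix.star_eq_conjTranspose, Matrix.det_conjTranspose]
  k := k
  k_ne_zero := hk
  map_realDiag := map_realDiag
  τ := (Matrix.traceLinearMap n ℝ ℂ).comp ρ.toLinearMap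
  τ_mul_comm X Y := by
    change (ρ (X * Y)).trace = (ρ (Y * X)).trace
    rw [map_mul, map_mul, Matrix.trace_mul_comm]
  τ_eq_zero X h := by
    have h1 : HasDerivAt (fun t : ℝ => (ρ (NormedSpace.exp (t • X))).det) (ρ X).trace 0 := by
      refine hasDerivAt_det (by simp) fun i j => ?_
      let e : Mat F →ₗ[ℝ] ℂ := (Matrix.entryLinearMap ℝ ℂ i j).comp ρ.toLinearMap
      have he : ∀ Z : Mat F, ρ Z i j =
          ∑ p : Fin 3, ∑ q : Fin 3, e.comp (Matrix.singleLinearMap ℝ p q) (Z p q) := by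
        intro Z
        conv_lhs => rw [Matrix.matrix_eq_sum_single Z]
        simp only [map_sum, Matrix.sum_apply]
        rfl
      simp only [he]
      refine HasDerivAt.fun_sum fun p _ => HasDerivAt.fun_sum fun q _ => ?_
      exact (LinearMap.toContinuousLinearMap
        (e.comp (Matrix.singleLinearMap ℝ p q))).hasFDerivAt.comp_hasDerivAt (0 : ℝ)
          (hasDerivAt_exp_smul_apply X p q)
    have h2 : (fun t : ℝ => (ρ (NormedSpace.exp (t • X))).det) = fun _ => 1 := funext h
    rw [h2] at h1
    exact h1.unique (hasDerivAt_const _ _)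
  τ_central := central

/-- The determinant of real matrices, with values in `ℂ`. -/
def determinantReal : Determinant (slComm ℝ) :=
  Determinant.ofRep (n := Fin 3) (Complex.ofRealAm.mapMatrix)
    (fun g => by
      rw [show Complex.ofRealAm.mapMatrix (g : Mat ℝ) = Complex.ofRealHom.mapMatrix (g : Mat ℝ)
        from rfl, ← RingHom.map_det]
      simp [slComm, MonoidHom.mem_ker])
    (fun X => by ext i j; simp [Matrix.star_apply])
    1 one_ne_zero
    (fun x => by
      rw [show Complex.ofRealAm.mapMatrix (realDiag ℝ x) = Complex.ofRealHom.mapMatrix (realDiag ℝ x)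
        from rfl, ← RingHom.map_det]
      simp [realDiag])
    (fun z _ h => by simpa [Matrix.trace, Fin.sum_univ_three, ← two_mul] using h)

/-- The determinant of complex matrices. -/
def determinantComplex : Determinant (slComm ℂ) :=
  Determinant.ofRep (n := Fin 3) (AlgHom.id ℝ _)
    (fun g => by simp [slComm, MonoidHom.mem_ker])
    (fun X => rfl) 1 one_ne_zero
    (fun x => by simp [realDiag])
    (fun z _ h => by simpa [Matrix.trace, Fin.sum_univ_three] using h)

theorem quaternionMatrixToComplex_apply (X : Mat (Quaternion ℝ)) (i j : Fin 3) (a b : Fin 2) :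
    quaternionMatrixToComplex X (i, a) (j, b) = quaternionToComplex (X i j) a b := rfl

theorem quaternionMatrixToComplex_realDiag (x : Fin 3 → ℝ) :
    quaternionMatrixToComplex (realDiag (Quaternion ℝ) x) =
      Matrix.diagonal fun p : Fin 3 × Fin 2 => (x p.1 : ℂ) := by
  ext ⟨i, a⟩ ⟨j, b⟩
  rw [quaternionMatrixToComplex_apply]
  by_cases hij : i = j
  · subst hij
    fin_cases a <;> fin_cases b <;>
      simp [realDiag, quaternionToComplex, Matrix.diagonal, Complex.ext_iff]
  · simp [realDiag, Matrix.diagonal, hij]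

/-- The representation of `M₃(ℍ)` on `ℂ⁶`, as a homomorphism of real algebras. -/
def quaternionRep : Mat (Quaternion ℝ) →ₐ[ℝ] Matrix (Fin 3 × Fin 2) (Fin 3 × Fin 2) ℂ :=
  { quaternionMatrixToComplex with
    commutes' := fun r => by
      have h := quaternionMatrixToComplex_realDiag fun _ => r
      rw [Matrix.algebraMap_eq_diagonal, Matrix.algebraMap_eq_diagonal]
      exact h }

theorem quaternionRep_apply (X : Mat (Quaternion ℝ)) :
    quaternionRep X = quaternionMatrixToComplex X := rfl

/-- The reduced norm of quaternionic matrices. -/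
def determinantQuaternion : Determinant slQuaternion :=
  Determinant.ofRep quaternionRep
    (fun g => by
      rw [quaternionRep_apply, slQuaternion, MonoidHom.mem_ker]
      simp only [MonoidHom.comp_apply, Units.coeHom_apply, Matrix.coe_detMonoidHom,
        MonoidHom.coe_coe])
    (fun X => by
      ext ⟨i, a⟩ ⟨j, b⟩
      change quaternionToComplex (star (X j i)) a b = star (quaternionToComplex (X j i) b a)
      fin_cases a <;> fin_cases b <;> simp [quaternionToComplex, Complex.ext_iff])
    2 two_ne_zero
    (fun x => by
      change (quaternionMatrixToComplex _).det = _
      rw [quaternionMatrixToComplex_realDiag, Matrix.det_diagonal, Fintype.prod_prod_type]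
      simp [Fin.prod_univ_three]
      ring)
    (fun z hz h => by
      have hI : z.imI = 0 ∧ z.imJ = 0 ∧ z.imK = 0 := by
        have key : ∀ y : Quaternion ℝ,
            z.imJ * y.imK - z.imK * y.imJ = 0 ∧ z.imI * y.imJ - z.imJ * y.imI = 0 := by
          intro y
          have h1 := congrArg (·.imI) (hz y)
          have h2 := congrArg (·.imK) (hz y)
          simp only [Quaternion.imI_mul, Quaternion.imK_mul] at h1 h2
          constructor <;> linarith
        have h1 := key ⟨0, 1, 0, 0⟩
        have h2 := key ⟨0, 0, 1, 0⟩
        simp only [mul_zero, mul_one, sub_zero, zero_sub, neg_eq_zero] at h1 h2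
        exact ⟨h2.2, h1.2, h2.1⟩
      have hr : (quaternionMatrixToComplex (Matrix.diagonal fun _ => z)).trace = 0 := h
      simp only [Matrix.trace, Matrix.diag, Fintype.sum_prod_type,
        quaternionMatrixToComplex_apply, Matrix.diagonal_apply_eq, Fin.sum_univ_two] at hr
      simp [quaternionToComplex, Complex.ext_iff] at hr
      ext <;> simp only [hI, hr] <;> rfl)

/-- `F` is one of `ℝ, ℂ, ℍ` and `G = SL(3, F)` is cut out by a determinant. -/
theorem IsSL3.exists_determinant {F : Type} [NormedDivisionRing F] [NormedAlgebra ℝ F]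
    [StarRing F] {G : Subgroup (GL3 F)} (hG : IsSL3 F G) :
    IsRCH F ∧ Nonempty (Determinant G) := by
  cases hG with
  | real => exact ⟨inferInstance, ⟨determinantReal⟩⟩
  | complex => exact ⟨inferInstance, ⟨determinantComplex⟩⟩
  | quaternion => exact ⟨inferInstance, ⟨determinantQuaternion⟩⟩

theorem signature_mul_self (F : Type) [Ring F] : signature F * signature F = 1 :=
  Units.ext (signature F).val_inv

section

variable {F : Type} [NormedDivisionRing F] [NormedAlgebra ℝ F]

instance : CharZero F := charZero_of_injective_algebraMap (algebraMap ℝ F).injective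

/-! ### Block triangular matrices -/

/-- The strictly block triangular matrices with respect to `b`: the nilradical of the Lie algebra
of `par G b`. -/
def nil (F : Type) [NormedDivisionRing F] [NormedAlgebra ℝ F] (b : Fin 3 → Fin 3) :
    Submodule ℝ (Mat F) where
  carrier := {X | ∀ i j, b j ≤ b i → X i j = 0}
  add_mem' := fun hX hY i j hij => by simp [hX i j hij, hY i j hij]
  zero_mem' := fun i j _ => rfl
  smul_mem' := fun c X hX i j hij => by simp [hX i j hij]

theorem blockTriangular_of_mem_nil {b : Fin 3 → Fin 3} {X : Mat F} (hX : X ∈ nil F b) :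
    BlockTriangular X b := fun i j hij => hX i j hij.le

theorem mul_mem_nil_left {b : Fin 3 → Fin 3} {X Y : Mat F} (hX : BlockTriangular X b)
    (hY : Y ∈ nil F b) : X * Y ∈ nil F b := by
  intro i j hij
  rw [Matrix.mul_apply]
  refine Finset.sum_eq_zero fun k _ => ?_
  rcases lt_or_ge (b k) (b i) with h | h
  · rw [hX h, zero_mul]
  · rw [hY k j (hij.trans h), mul_zero]

theorem mul_mem_nil_right {b : Fin 3 → Fin 3} {X Y : Mat F} (hX : X ∈ nil F b)
    (hY : BlockTriangular Y b) : X * Y ∈ nil F b := by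
  intro i j hij
  rw [Matrix.mul_apply]
  refine Finset.sum_eq_zero fun k _ => ?_
  rcases lt_or_ge (b j) (b k) with h | h
  · rw [hY h, mul_zero]
  · rw [hX i k (h.trans hij), zero_mul]

/-- A product of three strictly block triangular matrices vanishes, since there are at most
three blocks. -/
theorem mul_mul_eq_zero_of_mem_nil {b : Fin 3 → Fin 3} {X Y Z : Mat F} (hX : X ∈ nil F b)
    (hY : Y ∈ nil F b) (hZ : Z ∈ nil F b) : X * Y * Z = 0 := by
  ext i j
  rw [Matrix.mul_apply]
  refine Finset.sum_eq_zero fun k _ => ?_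
  rw [Matrix.mul_apply, Finset.sum_mul]
  refine Finset.sum_eq_zero fun l _ => ?_
  by_cases h1 : b l ≤ b i
  · rw [hX i l h1, zero_mul, zero_mul]
  by_cases h2 : b k ≤ b l
  · rw [hY l k h2, mul_zero, zero_mul]
  by_cases h3 : b j ≤ b k
  · rw [hZ k j h3, mul_zero]
  omega

/-- `1 + X` for a strictly block triangular matrix `X`. -/
def oneAddNil {b : Fin 3 → Fin 3} {X : Mat F} (hX : X ∈ nil F b) : GL3 F where
  val := 1 + X
  inv := 1 - X + X * X
  val_inv := by
    have h := mul_mul_eq_zero_of_mem_nil hX hX hX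
    have : (1 + X) * (1 - X + X * X) = 1 + X * X * X := by noncomm_ring
    rw [this, h, add_zero]
  inv_val := by
    have h := mul_mul_eq_zero_of_mem_nil hX hX hX
    have : (1 - X + X * X) * (1 + X) = 1 + X * X * X := by noncomm_ring
    rw [this, h, add_zero]

theorem exp_mem_nil {b : Fin 3 → Fin 3} {X : Mat F} (hX : X ∈ nil F b) :
    ∃ Y ∈ nil F b, NormedSpace.exp X = 1 + Y := by
  refine ⟨X + (2⁻¹ : ℝ) • (X * X), ?_, ?_⟩
  · exact add_mem hX (Submodule.smul_mem _ _
      (mul_mem_nil_left (blockTriangular_of_mem_nil hX) hX))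
  · rw [exp_of_cube_eq_zero (mul_mul_eq_zero_of_mem_nil hX hX hX), add_assoc]

theorem exists_exp_eq_one_add {b : Fin 3 → Fin 3} {X : Mat F} (hX : X ∈ nil F b) :
    ∃ Y ∈ nil F b, NormedSpace.exp Y = 1 + X := by
  have h := mul_mul_eq_zero_of_mem_nil hX hX hX
  have hXX : X * X ∈ nil F b := mul_mem_nil_left (blockTriangular_of_mem_nil hX) hX
  -- the logarithm of `1 + X`
  have hY : X - (2⁻¹ : ℝ) • (X * X) ∈ nil F b := sub_mem hX (Submodule.smul_mem _ _ hXX)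
  refine ⟨_, hY, ?_⟩
  rw [exp_of_cube_eq_zero (mul_mul_eq_zero_of_mem_nil hY hY hY)]
  have h4 : X * (X * X) = 0 := by rw [← mul_assoc, h]
  have h5 : (X - (2⁻¹ : ℝ) • (X * X)) * (X - (2⁻¹ : ℝ) • (X * X)) = X * X := by
    simp [sub_mul, mul_sub, h, h4, mul_assoc]
  rw [h5]
  abel

theorem single_mem_nil {b : Fin 3 → Fin 3} {i j : Fin 3} (hij : b i < b j) (c : F) :
    Matrix.single i j c ∈ nil F b := by
  intro k l hkl
  rw [Matrix.single_apply, if_neg]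
  rintro ⟨rfl, rfl⟩
  exact absurd hij (not_lt.2 hkl)

/-- The transvection `1 + c E_ij`. -/
def transvectionUnit {i j : Fin 3} (hij : i ≠ j) (c : F) : GL3 F where
  val := 1 + Matrix.single i j c
  inv := 1 - Matrix.single i j c
  val_inv := by
    have : Matrix.single i j c * Matrix.single i j c = 0 := by simp [hij.symm]
    noncomm_ring
    simp [this]
  inv_val := by
    have : Matrix.single i j c * Matrix.single i j c = 0 := by simp [hij.symm]
    noncomm_ring
    simp [this]

/-- An invertible diagonal matrix. -/
def diagUnit (d : Fin 3 → Fˣ) : GL3 F where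
  val := Matrix.diagonal fun i => (d i : F)
  inv := Matrix.diagonal fun i => ((d i)⁻¹ : Fˣ)
  val_inv := by simp
  inv_val := by simp

end

section

variable {F : Type} [NormedDivisionRing F] [NormedAlgebra ℝ F] [StarRing F]

/-! ### Consequences of the axioms for `F` -/

section IsRCH

variable [IsRCH F]

instance : FiniteDimensional ℝ F := IsRCH.finite

instance : CompleteSpace F := FiniteDimensional.complete ℝ F

theorem star_mul_self_eq (a : F) : star a * a = algebraMap ℝ F (‖a‖ ^ 2) := IsRCH.star_mul_self' a

theorem star_algebraMap_real (r : ℝ) : star (algebraMap ℝ F r) = algebraMap ℝ F r :=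
  IsRCH.star_algebraMap' r

theorem norm_star_eq (a : F) : ‖star a‖ = ‖a‖ := by
  by_cases ha : a = 0
  · simp [ha]
  have h := congrArg norm (star_mul_self_eq a)
  rw [norm_mul, norm_algebraMap', Real.norm_eq_abs, abs_of_nonneg (by positivity), pow_two] at h
  exact mul_right_cancel₀ (norm_ne_zero_iff.2 ha) h

theorem mul_star_self_eq (a : F) : a * star a = algebraMap ℝ F (‖a‖ ^ 2) := by
  have h := star_mul_self_eq (star a)
  rwa [star_star, norm_star_eq] at h

end IsRCH

/-! ### Elements of `G` -/

namespace Determinant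

variable {G : Subgroup (GL3 F)} (D : Determinant G)
include D

theorem conj_mem {g : GL3 F} (h : GL3 F) (hg : g ∈ G) : h * g * h⁻¹ ∈ G := by
  rw [D.mem_iff] at hg ⊢
  rw [Units.val_mul, Units.val_mul, map_mul, map_mul, hg, mul_one, ← map_mul, Units.mul_inv,
    map_one]

theorem δ_conj (h : GL3 F) (X : Mat F) : D.δ (h * X * (h⁻¹ : GL3 F)) = D.δ X := by
  rw [map_mul, map_mul, mul_right_comm, ← map_mul, Units.mul_inv, map_one, one_mul]

theorem star_mem {g : GL3 F} (hg : g ∈ G) : star g ∈ G := by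
  rw [D.mem_iff] at hg ⊢
  rw [Units.coe_star, D.map_star, hg, star_one]

theorem theta_mem {g : GL3 F} (hg : g ∈ G) : theta F g ∈ G := D.star_mem (inv_mem hg)

theorem sigma_mem {g : GL3 F} (hg : g ∈ G) : sigma F g ∈ G := by
  have h := D.conj_mem (signature F) (D.theta_mem hg)
  have h2 : (signature F)⁻¹ = signature F := inv_eq_of_mul_eq_one_right (signature_mul_self F)
  rwa [h2] at h

theorem norm_δ_diagUnit [IsRCH F] (d : Fin 3 → Fˣ) :
    ‖D.δ (diagUnit d : GL3 F)‖ = (∏ i, ‖(d i : F)‖) ^ D.k := by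
  have h1 : (star (diagUnit d) * diagUnit d : Mat F) = realDiag F fun i => ‖(d i : F)‖ ^ 2 := by
    rw [Units.coe_star, Matrix.star_eq_conjTranspose]
    simp only [diagUnit, realDiag, Matrix.diagonal_conjTranspose, Matrix.diagonal_mul_diagonal]
    congr 1
    funext i
    exact star_mul_self_eq _
  have h2 := congrArg (fun X => ‖D.δ X‖) h1
  simp only [map_mul, D.map_realDiag, norm_mul, Units.coe_star, D.map_star, norm_star,
    Complex.norm_real, Finset.prod_pow] at h2
  rw [Real.norm_eq_abs, abs_of_nonneg (by positivity), ← pow_mul, mul_comm 2, pow_mul, ← pow_two]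
    at h2
  exact (pow_left_inj₀ (by positivity) (by positivity) two_ne_zero).1 h2

theorem realDiag_expUnit_mem [IsRCH F] {x : Fin 3 → ℝ} (hx : ∑ i, x i = 0) :
    expUnit (realDiag F x) ∈ G := by
  rw [D.mem_iff]
  change D.δ (NormedSpace.exp _) = 1
  rw [exp_realDiag, D.map_realDiag, ← Real.exp_sum, hx]
  simp

end Determinant

/-! ### Block triangular subgroups -/

theorem blockTriangular_inv [IsRCH F] {b : Fin 3 → Fin 3} {g : GL3 F}
    (hg : BlockTriangular (g : Mat F) b) : BlockTriangular ((g⁻¹ : GL3 F) : Mat F) b := by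
  let A : Submodule ℝ (Mat F) :=
    { carrier := {X | BlockTriangular X b}
      add_mem' := fun hX hY => hX.add hY
      zero_mem' := Matrix.blockTriangular_zero
      smul_mem' := fun c X hX i j hij => by simp [hX hij] }
  let f : A →ₗ[ℝ] A := ((LinearMap.mulLeft ℝ (g : Mat F)).domRestrict A).codRestrict A
    fun X => BlockTriangular.mul hg X.2
  have hf : Function.Injective f := by
    intro X Y h
    have h1 : (g : Mat F) * X = g * Y := congrArg Subtype.val h
    exact Subtype.ext ((Units.mul_right_inj g).1 h1)
  obtain ⟨Y, hY⟩ := (LinearMap.injective_iff_surjective.1 hf)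
    ⟨1, Matrix.blockTriangular_one⟩
  have h1 : (g : Mat F) * Y = 1 := congrArg Subtype.val hY
  have h2 : (Y : Mat F) = (g⁻¹ : GL3 F) := (Units.inv_eq_of_mul_eq_one_right h1).symm
  rw [← h2]
  exact Y.2

/-- The subgroup of the elements of `G` that are block triangular with respect to
`b : Fin 3 → Fin 3`, i.e. of those `g` with `g i j = 0` whenever `b j < b i`. For varying `b` these
are all the parabolic subgroups that contain the diagonal matrices of `G`. -/
def par [IsRCH F] (G : Subgroup (GL3 F)) (b : Fin 3 → Fin 3) : Subgroup (GL3 F) where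
  carrier := {g | g ∈ G ∧ BlockTriangular (g : Mat F) b}
  one_mem' := ⟨one_mem _, Matrix.blockTriangular_one⟩
  mul_mem' := fun ha hb => ⟨mul_mem ha.1 hb.1, BlockTriangular.mul ha.2 hb.2⟩
  inv_mem' := fun ha => ⟨inv_mem ha.1, blockTriangular_inv ha.2⟩

theorem mem_par [IsRCH F] {G : Subgroup (GL3 F)} {b : Fin 3 → Fin 3} {g : GL3 F} :
    g ∈ par G b ↔ g ∈ G ∧ BlockTriangular (g : Mat F) b := Iff.rfl

namespace Determinant

variable {G : Subgroup (GL3 F)} (D : Determinant G)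
include D

/-- Unipotent matrices have determinant one: conjugation by diagonal matrices contracts `1 + X`
to `1`. -/
theorem δ_one_add_nil {b : Fin 3 → Fin 3} {X : Mat F} (hX : X ∈ nil F b) : D.δ (1 + X) = 1 := by
  let M : ℝ → Mat F := fun t => 1 + Matrix.of fun i j => (t ^ ((b j : ℕ) - (b i : ℕ))) • X i j
  have hM : Continuous fun t => D.δ (M t) := by
    refine D.continuous_δ.comp ?_
    refine continuous_const.add (continuous_matrix fun i j => ?_)
    simp only [Matrix.of_apply]
    fun_prop
  have hM0 : M 0 = 1 := by
    ext i j
    by_cases hij : b j ≤ b i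
    · simp [M, hX i j hij]
    · have : (b j : ℕ) - (b i : ℕ) ≠ 0 := by omega
      simp [M, this]
  have hMt : ∀ t : ℝ, t ≠ 0 → D.δ (M t) = D.δ (1 + X) := by
    intro t ht
    let u : Fˣ := Units.map (algebraMap ℝ F : ℝ →* F) (Units.mk0 t ht)
    let d : GL3 F := diagUnit fun i => u ^ (b i : ℕ)
    have h1 : (M t : Mat F) = (d⁻¹ : GL3 F) * (1 + X) * ((d⁻¹)⁻¹ : GL3 F) := by
      have h2 : (d : Mat F) * M t = (1 + X) * d := by
        ext i j
        simp only [d, diagUnit, M, Matrix.diagonal_mul, Matrix.mul_diagonal, Matrix.add_apply,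
          Matrix.of_apply, mul_add, add_mul]
        congr 1
        · by_cases hij : i = j
          · subst hij; simp
          · simp [hij, Matrix.one_apply_ne]
        · by_cases hij : b j ≤ b i
          · simp [hX i j hij]
          · have h3 : (b j : ℕ) = b i + ((b j : ℕ) - (b i : ℕ)) := by omega
            conv_rhs => rw [h3]
            simp only [u, Units.val_pow_eq_pow_val, Units.coe_map, Units.val_mk0,
              MonoidHom.coe_coe, ← map_pow]
            rw [← Algebra.commutes, ← Algebra.smul_def, ← Algebra.smul_def, smul_smul, pow_add]
      rw [inv_inv, mul_assoc, ← h2, Units.inv_mul_cancel_left]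
    rw [h1, D.δ_conj]
  have h := Continuous.ext_on (dense_compl_singleton (0 : ℝ)) hM continuous_const
    (fun t ht => hMt t ht)
  rw [← congrFun h 0, hM0, map_one]

theorem oneAddNil_mem {b : Fin 3 → Fin 3} {X : Mat F} (hX : X ∈ nil F b) : oneAddNil hX ∈ G :=
  (D.mem_iff _).2 (D.δ_one_add_nil hX)

end Determinant

theorem Determinant.transvectionUnit_mem {G : Subgroup (GL3 F)} (D : Determinant G) {i j : Fin 3}
    (hij : i ≠ j) (c : F) : transvectionUnit hij c ∈ G := by
  have h : Matrix.single i j c ∈ nil F (Pi.single j 1) :=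
    single_mem_nil (by simp [hij]) c
  exact (D.mem_iff _).2 (D.δ_one_add_nil h)

end

/-! ### The Lie algebras of block triangular subgroups -/

section

variable {F : Type} [NormedDivisionRing F] [NormedAlgebra ℝ F]

theorem mem_lie_of_exp {P : Subgroup (GL3 F)} {X : Mat F}
    (h : ∀ t : ℝ, ∃ u ∈ P, (u : Mat F) = NormedSpace.exp (t • X)) : X ∈ lie P :=
  LieSubalgebra.subset_lieSpan h

end

section

variable {F : Type} [NormedDivisionRing F] [NormedAlgebra ℝ F] [StarRing F] [IsRCH F]
  {G : Subgroup (GL3 F)}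

/-- `G` itself is the block triangular subgroup with a single block. -/
theorem par_const (G : Subgroup (GL3 F)) (c : Fin 3) : par G (fun _ => c) = G := by
  ext g
  exact ⟨fun h => h.1, fun h => ⟨h, fun i j hij => absurd hij (lt_irrefl _)⟩⟩

namespace Determinant

variable (D : Determinant G)

/-- The block triangular matrices whose (reduced) trace vanishes. -/
def parLie (b : Fin 3 → Fin 3) : LieSubalgebra ℝ (Mat F) where
  carrier := {X | BlockTriangular X b ∧ D.τ X = 0}
  add_mem' := fun hX hY => ⟨hX.1.add hY.1, by rw [map_add, hX.2, hY.2, add_zero]⟩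
  zero_mem' := ⟨Matrix.blockTriangular_zero, map_zero _⟩
  smul_mem' := fun c X hX => ⟨fun i j hij => by simp [hX.1 hij], by rw [map_smul, hX.2, smul_zero]⟩
  lie_mem' := fun {X Y} hX hY => by
    refine ⟨?_, ?_⟩
    · rw [LieRing.of_associative_ring_bracket]
      exact (hX.1.mul hY.1).sub (hY.1.mul hX.1)
    · rw [LieRing.of_associative_ring_bracket, map_sub, D.τ_mul_comm, sub_self]

theorem lie_par_le (b : Fin 3 → Fin 3) : lie (par G b) ≤ D.parLie b := by
  refine LieSubalgebra.lieSpan_le.2 fun X hX => ⟨fun i j hij => ?_, D.τ_eq_zero X fun t => ?_⟩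
  · have h := hasDerivAt_exp_smul_apply X i j
    have h0 : (fun t : ℝ => (NormedSpace.exp (t • X)) i j) = fun _ => 0 := by
      funext t
      obtain ⟨u, hu, hut⟩ := hX t
      rw [← hut]
      exact hu.2 hij
    rw [h0] at h
    exact h.unique (hasDerivAt_const _ _)
  · obtain ⟨u, hu, hut⟩ := hX t
    rw [← hut]
    exact (D.mem_iff u).1 hu.1

include D

omit D in
theorem mem_lie_par {b : Fin 3 → Fin 3} {X : Mat F} (hb : BlockTriangular X b)
    (hX : ∀ t : ℝ, expUnit (t • X) ∈ G) : X ∈ lie (par G b) := by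
  refine mem_lie_of_exp fun t => ⟨expUnit (t • X), ⟨hX t, ?_⟩, rfl⟩
  let : Algebra ℚ F := DivisionRing.toRatAlgebra
  exact BlockTriangular.exp fun i j hij => by simp [hb hij]

theorem mem_lie_par_of_mem_nil {b b' : Fin 3 → Fin 3} {X : Mat F} (hb : BlockTriangular X b)
    (hX : X ∈ nil F b') : X ∈ lie (par G b) := by
  refine mem_lie_par hb fun t => (D.mem_iff _).2 ?_
  obtain ⟨Y, hY, hYt⟩ := exp_mem_nil (Submodule.smul_mem _ t hX)
  change D.δ (NormedSpace.exp (t • X)) = 1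
  rw [hYt, D.δ_one_add_nil hY]

theorem single_mem_lie_par {b : Fin 3 → Fin 3} {i j : Fin 3} (hij : i ≠ j) (hb : b i ≤ b j)
    (c : F) : Matrix.single i j c ∈ lie (par G b) := by
  refine D.mem_lie_par_of_mem_nil (b' := Pi.single j 1) (fun k l hkl => ?_)
    (single_mem_nil (by simp [hij]) c)
  rw [Matrix.single_apply, if_neg]
  rintro ⟨rfl, rfl⟩
  exact absurd hb (not_le.2 hkl)

theorem 𝔞_subset_lie_par (b : Fin 3 → Fin 3) : 𝔞 F ⊆ lie (par G b) := by
  rintro _ ⟨x, hx, rfl⟩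
  refine mem_lie_par (Matrix.blockTriangular_diagonal _) fun t => ?_
  have h : t • realDiag F x = realDiag F fun i => t * x i := by
    rw [realDiag, realDiag, ← Matrix.diagonal_smul]
    congr 1
    funext i
    simp [Algebra.smul_def]
  rw [h]
  exact D.realDiag_expUnit_mem (by rw [← Finset.mul_sum, hx, mul_zero])

theorem single_mem_lie {i j : Fin 3} (hij : i ≠ j) (c : F) : Matrix.single i j c ∈ lie G := by
  have h := D.single_mem_lie_par (b := fun _ => 0) hij le_rfl c
  rwa [par_const] at h

/-! ### Root spaces -/

/-- The root spaces consist of all the matrices with a single entry at the given place. -/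
theorem mem_rootSpace {r : Fin 3 × Fin 3} (hr : r.1 ≠ r.2) {X : Mat F} :
    X ∈ rootSpace G r ↔ ∃ c, X = Matrix.single r.1 r.2 c := by
  obtain ⟨j, k⟩ := r
  constructor
  · rintro ⟨-, hX⟩
    refine ⟨X j k, ?_⟩
    ext a b
    by_cases hab : j = a ∧ k = b
    · obtain ⟨rfl, rfl⟩ := hab
      simp
    · rw [Matrix.single_apply, if_neg hab]
      -- all roots take distinct values at `diag(1, 3, -4)`
      have h := congrFun (congrFun (hX ![1, 3, -4]
        (by rw [Fin.sum_univ_three]; change (1 : ℝ) + 3 + -4 = 0; norm_num)) a) b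
      rw [LieRing.of_associative_ring_bracket, realDiag, Matrix.sub_apply, Matrix.diagonal_mul,
        Matrix.mul_diagonal, ← Algebra.commutes, ← sub_mul, ← map_sub, Matrix.smul_apply,
        Algebra.smul_def, ← sub_eq_zero, ← sub_mul, ← map_sub, mul_eq_zero] at h
      refine h.resolve_left fun h0 => ?_
      rw [map_eq_zero_iff _ (algebraMap ℝ F).injective] at h0
      fin_cases a <;> fin_cases b <;> fin_cases j <;> fin_cases k <;>
        first
          | exact hab ⟨rfl, rfl⟩
          | exact hr rfl
          | norm_num at h0
  · rintro ⟨c, rfl⟩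
    refine ⟨D.single_mem_lie hr c, fun x _ => ?_⟩
    rw [LieRing.of_associative_ring_bracket, realDiag]
    ext a b
    rw [Matrix.sub_apply, Matrix.diagonal_mul, Matrix.mul_diagonal, ← Algebra.commutes, ← sub_mul,
      ← map_sub, Matrix.smul_apply, Algebra.smul_def, Matrix.single_apply]
    split_ifs with h
    · rw [h.1, h.2]
    · simp

theorem rootSpaceSum_eq_nil {S : Set (Fin 3 × Fin 3)} {b : Fin 3 → Fin 3}
    (hS : ∀ r : Fin 3 × Fin 3, r ∈ S ↔ b r.1 < b r.2) : rootSpaceSum G S = nil F b := by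
  apply le_antisymm
  · refine iSup₂_le fun r hr X hX => ?_
    have hlt := (hS r).1 hr
    obtain ⟨c, rfl⟩ := (D.mem_rootSpace fun h => by rw [h] at hlt; exact lt_irrefl _ hlt).1 hX
    exact single_mem_nil hlt c
  · intro X hX
    rw [Matrix.matrix_eq_sum_single X]
    refine Submodule.sum_mem _ fun i _ => Submodule.sum_mem _ fun j _ => ?_
    by_cases hij : b i < b j
    · have hne : i ≠ j := fun h => by rw [h] at hij; exact lt_irrefl _ hij
      refine (le_iSup₂ (f := fun r _ => rootSpace G r) (i, j) ((hS (i, j)).2 hij)) ?_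
      exact (D.mem_rootSpace hne).2 ⟨_, rfl⟩
    · rw [hX i j (not_lt.1 hij), Matrix.single_zero]
      exact zero_mem _

theorem roots_par (b : Fin 3 → Fin 3) :
    roots G (par G b) = {r | r.1 ≠ r.2 ∧ b r.1 ≤ b r.2} := by
  ext r
  refine and_congr_right fun hr => ?_
  rw [Submodule.ne_bot_iff]
  constructor
  · rintro ⟨X, ⟨hX1, hX2⟩, hX0⟩
    obtain ⟨c, rfl⟩ := (D.mem_rootSpace hr).1 hX2
    by_contra hlt
    have h := (D.lie_par_le b hX1).1 (not_le.1 hlt)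
    rw [Matrix.single_apply_same] at h
    exact hX0 (by rw [h, Matrix.single_zero])
  · intro h
    refine ⟨Matrix.single r.1 r.2 1, ⟨D.single_mem_lie_par hr h 1, ?_⟩, ?_⟩
    · exact (D.mem_rootSpace hr).2 ⟨1, rfl⟩
    · intro h0
      have := congrFun (congrFun h0 r.1) r.2
      simp at this

end Determinant

/-! ### The nilradicals of the block triangular subalgebras -/

omit [StarRing F] [IsRCH F] in
theorem exists_iterate_lie_eq_zero {q : LieSubalgebra ℝ (Mat F)} {I : LieIdeal ℝ q}
    (hI : LieRing.IsNilpotent I) {x y : q} (hx : x ∈ I) (hy : y ∈ I) :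
    ∃ n, (fun Z : Mat F => ⁅(x : Mat F), Z⁆)^[n] y = 0 := by
  obtain ⟨k, hk⟩ := LieModule.exists_forall_pow_toEnd_eq_zero ℝ I I
  refine ⟨k, ?_⟩
  have h : ∀ n, (fun Z : Mat F => ⁅(x : Mat F), Z⁆)^[n] y =
      (((LieModule.toEnd ℝ I I ⟨x, hx⟩ ^ n) ⟨y, hy⟩ : I) : q) := by
    intro n
    induction n with
    | zero => simp
    | succ n ih =>
      rw [Function.iterate_succ_apply', ih, pow_succ', Module.End.mul_apply]
      rfl
  rw [h, hk]
  rfl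

/-- If `y ↦ a y - y c` is locally nilpotent on a finite dimensional division algebra over `ℝ`, then
it is zero. Otherwise there would be an element `w` with `a w - w a = 1`, which is impossible for
traces. -/
theorem mul_eq_mul_of_nilpotent {a c : F}
    (h : ∀ y, ∃ n, (fun y : F => a * y - y * c)^[n] y = 0) (y : F) : a * y = y * c := by
  classical
  set T : F → F := fun y => a * y - y * c with hT
  have hT0 : T 0 = 0 := by simp [hT]
  have hn := Nat.find_spec (h y)
  have hmin := fun m => Nat.find_min (h y) (m := m)
  generalize Nat.find (h y) = n at hn hmin
  match n, hn, hmin with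
  | 0, hn, _ => simp at hn; simp [hn]
  | 1, hn, _ => exact sub_eq_zero.1 hn
  | m + 2, hn, hmin =>
    exfalso
    set v := T^[m] y
    have hz : T v ≠ 0 := by
      have := hmin (m + 1) (by omega)
      rwa [Function.iterate_succ_apply'] at this
    have hz2 : T (T v) = 0 := by
      rwa [Function.iterate_succ_apply', Function.iterate_succ_apply'] at hn
    set z := T v with hzdef
    have hc : a * z = z * c := sub_eq_zero.1 hz2
    have hw : a * (v * z⁻¹) - v * z⁻¹ * a = 1 := by
      have h1 : v * z⁻¹ * a = v * c * z⁻¹ := by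
        have h2 : z⁻¹ * a = c * z⁻¹ := by
          rw [inv_mul_eq_iff_eq_mul₀ hz, ← mul_assoc, ← hc, mul_assoc, mul_inv_cancel₀ hz, mul_one]
        rw [mul_assoc, h2, mul_assoc]
      rw [h1, ← mul_assoc, ← sub_mul]
      exact mul_inv_cancel₀ hz
    have htr := congrArg (fun x : F => LinearMap.trace ℝ F (LinearMap.mulLeft ℝ x)) hw
    simp only [LinearMap.mulLeft_one] at htr
    have hsub : LinearMap.mulLeft ℝ (a * (v * z⁻¹) - v * z⁻¹ * a) =
        LinearMap.mulLeft ℝ a * LinearMap.mulLeft ℝ (v * z⁻¹) -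
          LinearMap.mulLeft ℝ (v * z⁻¹) * LinearMap.mulLeft ℝ a := by
      ext x
      simp [sub_mul, mul_assoc]
    rw [hsub, map_sub, LinearMap.trace_mul_comm, sub_self, LinearMap.trace_id] at htr
    have : Module.finrank ℝ F ≠ 0 := Module.finrank_pos.ne'
    exact this (by exact_mod_cast htr.symm)

namespace Determinant

variable (D : Determinant G)

/-- The strictly block triangular matrices, as an ideal of the Lie algebra of `par G b`. -/
def nilIdeal (b : Fin 3 → Fin 3) : LieIdeal ℝ (lie (par G b)) where
  carrier := {X | (X : Mat F) ∈ nil F b}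
  add_mem' := fun hX hY => (nil F b).add_mem hX hY
  zero_mem' := zero_mem (nil F b)
  smul_mem' := fun c X hX => (nil F b).smul_mem c hX
  lie_mem := fun {X Y} hY => by
    have hX := (D.lie_par_le b X.2).1
    change ⁅(X : Mat F), (Y : Mat F)⁆ ∈ nil F b
    rw [LieRing.of_associative_ring_bracket]
    exact sub_mem (mul_mem_nil_left hX hY) (mul_mem_nil_right hY hX)

/-- The strictly block triangular matrices form a nilpotent Lie algebra, by Engel's theorem. -/
theorem isNilpotent_nilIdeal (b : Fin 3 → Fin 3) : LieRing.IsNilpotent (D.nilIdeal b) := by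
  rw [LieAlgebra.isNilpotent_iff_forall (R := ℝ)]
  intro x
  refine ⟨2, ?_⟩
  ext y : 1
  apply Subtype.ext
  apply Subtype.ext
  have hx : ((x : lie (par G b)) : Mat F) ∈ nil F b := x.2
  have hy : ((y : lie (par G b)) : Mat F) ∈ nil F b := y.2
  generalize hX : ((x : lie (par G b)) : Mat F) = X at hx
  generalize hY : ((y : lie (par G b)) : Mat F) = Y at hy
  have h1 : (((LieAlgebra.ad ℝ (D.nilIdeal b) x ^ 2) y : lie (par G b)) : Mat F) =
      ⁅((x : lie (par G b)) : Mat F), ⁅((x : lie (par G b)) : Mat F),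
        ((y : lie (par G b)) : Mat F)⁆⁆ := by
    rw [pow_two, Module.End.mul_apply]
    rfl
  rw [h1, hX, hY]
  simp only [LieRing.of_associative_ring_bracket, mul_sub, sub_mul, ← mul_assoc,
    mul_mul_eq_zero_of_mem_nil hx hx hy, mul_mul_eq_zero_of_mem_nil hx hy hx,
    mul_mul_eq_zero_of_mem_nil hy hx hx]
  simp

include D

theorem single_mem_ideal_of_apply {b : Fin 3 → Fin 3} {I : LieIdeal ℝ (lie (par G b))}
    {A : lie (par G b)} (hA : A ∈ I) {i j : Fin 3} (hij : i ≠ j) (hb : b j ≤ b i) :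
    ∃ Y ∈ I, (Y : Mat F) = Matrix.single j i ((A : Mat F) i j) := by
  let X : lie (par G b) := ⟨Matrix.single j i 1, D.single_mem_lie_par hij.symm hb 1⟩
  have h1 : ⁅X, ⁅X, A⁆⁆ ∈ I := I.lie_mem (I.lie_mem hA)
  refine ⟨(-2⁻¹ : ℝ) • ⁅X, ⁅X, A⁆⁆, I.smul_mem _ h1, ?_⟩
  have hXX : Matrix.single j i (1 : F) * Matrix.single j i 1 = 0 := by simp [hij]
  have hXAX : Matrix.single j i (1 : F) * (A : Mat F) * Matrix.single j i 1 =
      Matrix.single j i ((A : Mat F) i j) := by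
    rw [Matrix.single_mul_mul_single, one_mul, mul_one]
  change (-2⁻¹ : ℝ) • ⁅Matrix.single j i (1 : F), ⁅Matrix.single j i (1 : F), (A : Mat F)⁆⁆ = _
  simp only [LieRing.of_associative_ring_bracket, mul_sub, sub_mul, ← mul_assoc, hXX]
  rw [hXAX, mul_assoc (A : Mat F), hXX, zero_mul, mul_zero, zero_sub, sub_zero, ← neg_add',
    smul_neg, neg_smul, neg_neg, ← two_smul ℝ, smul_smul]
  norm_num

/-- The elements of a nilpotent ideal vanish off the diagonal within each block: otherwise the ideal
would contain `a E_ji` and `h = a E_ii - a E_jj` with `[h, x E_ji] = -(a x + x a) E_ji`. -/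
theorem apply_eq_zero_of_mem_nilpotent {b : Fin 3 → Fin 3} {I : LieIdeal ℝ (lie (par G b))}
    (hI : LieRing.IsNilpotent I) {A : lie (par G b)} (hA : A ∈ I) {i j : Fin 3} (hij : i ≠ j)
    (hb : b i = b j) : (A : Mat F) i j = 0 := by
  by_contra ha
  obtain ⟨Y, hY, hYA⟩ := D.single_mem_ideal_of_apply hA hij hb.ge
  set a := (A : Mat F) i j
  let X : lie (par G b) := ⟨Matrix.single i j 1, D.single_mem_lie_par hij hb.le 1⟩
  have hH : ⁅X, Y⁆ ∈ I := I.lie_mem hY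
  obtain ⟨n, hn⟩ := exists_iterate_lie_eq_zero hI hH hY
  have hHe : ((⁅X, Y⁆ : lie (par G b)) : Mat F) = Matrix.single i i a - Matrix.single j j a := by
    change ⁅Matrix.single i j (1 : F), (Y : Mat F)⁆ = _
    rw [LieRing.of_associative_ring_bracket, hYA, Matrix.single_mul_single_same,
      Matrix.single_mul_single_same, one_mul, mul_one]
  have hit : ∀ m, (fun Z : Mat F => ⁅((⁅X, Y⁆ : lie (par G b)) : Mat F), Z⁆)^[m] Y =
      Matrix.single j i ((-2) ^ m * a ^ (m + 1)) := by
    intro m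
    induction m with
    | zero => simp [hYA]
    | succ m ih =>
      rw [Function.iterate_succ_apply', ih, hHe, LieRing.of_associative_ring_bracket]
      have h2 : a * ((-2) ^ m * a ^ (m + 1)) = (-2) ^ m * a ^ (m + 2) := by
        have h3 : Commute a ((-2 : F) ^ m) := by
          have : Commute a (-2 : F) := (Commute.ofNat_right a 2).neg_right
          exact this.pow_right m
        rw [← mul_assoc, h3.eq, mul_assoc, ← pow_succ']
      have h4 : (-2 : F) ^ m * a ^ (m + 1) * a = (-2) ^ m * a ^ (m + 2) := by
        rw [mul_assoc, ← pow_succ]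
      rw [sub_mul, mul_sub, Matrix.single_mul_single_of_ne _ _ _ _ hij,
        Matrix.single_mul_single_same, Matrix.single_mul_single_same,
        Matrix.single_mul_single_of_ne _ _ _ _ hij, h2, h4, zero_sub, sub_zero, ← neg_add',
        ← Matrix.single_add, ← two_mul, pow_succ' (-2 : F) m, mul_assoc (-2 : F), neg_mul]
      ext k l
      simp only [Matrix.neg_apply, Matrix.single_apply]
      split_ifs <;> simp
  rw [hit] at hn
  have h0 := congrFun (congrFun hn j) i
  rw [Matrix.single_apply_same] at h0
  exact mul_ne_zero (pow_ne_zero _ (by simp)) (pow_ne_zero _ ha) h0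

/-- Diagonal entries of an element of a nilpotent ideal that belong to consecutive blocks agree and
are central. -/
theorem diag_eq_of_mem_nilpotent {b : Fin 3 → Fin 3} {I : LieIdeal ℝ (lie (par G b))}
    (hI : LieRing.IsNilpotent I) {A : lie (par G b)} (hA : A ∈ I) {i j : Fin 3} (hij : b i < b j)
    (hb : ∀ k, ¬ (b i < b k ∧ b k < b j)) (y : F) :
    (A : Mat F) i i * y = y * (A : Mat F) j j := by
  have hne : i ≠ j := fun h => by rw [h] at hij; exact lt_irrefl _ hij
  have hA1 : ∀ k l, k ≠ l → b l ≤ b k → (A : Mat F) k l = 0 := by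
    intro k l hkl h
    rcases h.eq_or_lt with h | h
    · exact D.apply_eq_zero_of_mem_nilpotent hI hA hkl h.symm
    · exact (D.lie_par_le b A.2).1 h
  have hbr : ∀ Y ∈ nil F b, ⁅(A : Mat F), Y⁆ ∈ nil F b := fun Y hY => by
    have hX := (D.lie_par_le b A.2).1
    rw [LieRing.of_associative_ring_bracket]
    exact sub_mem (mul_mem_nil_left hX hY) (mul_mem_nil_right hY hX)
  have hentry : ∀ Y ∈ nil F b, (⁅(A : Mat F), Y⁆) i j =
      (A : Mat F) i i * Y i j - Y i j * (A : Mat F) j j := by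
    intro Y hY
    rw [LieRing.of_associative_ring_bracket, Matrix.sub_apply, Matrix.mul_apply, Matrix.mul_apply]
    congr 1
    · refine Finset.sum_eq_single i (fun k _ hk => ?_) (by simp)
      by_cases h1 : b k ≤ b i
      · rw [hA1 i k hk.symm h1, zero_mul]
      · rw [hY k j (not_lt.1 fun h => hb k ⟨not_le.1 h1, h⟩), mul_zero]
    · refine Finset.sum_eq_single j (fun k _ hk => ?_) (by simp)
      by_cases h1 : b j ≤ b k
      · rw [hA1 k j hk h1, mul_zero]
      · rw [hY i k (not_lt.1 fun h => hb k ⟨h, not_le.1 h1⟩), zero_mul]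
  refine mul_eq_mul_of_nilpotent (fun y => ?_) y
  have hYn : Matrix.single i j y ∈ nil F b := single_mem_nil hij y
  let Y : lie (par G b) := ⟨Matrix.single i j y, D.single_mem_lie_par hne hij.le y⟩
  have hAY : ⁅A, Y⁆ ∈ I := lie_mem_left ℝ (lie (par G b)) I A Y hA
  obtain ⟨n, hn⟩ := exists_iterate_lie_eq_zero hI hA hAY
  refine ⟨n + 1, ?_⟩
  have hit : ∀ m, (fun Z : Mat F => ⁅(A : Mat F), Z⁆)^[m] (Matrix.single i j y) ∈ nil F b ∧
      ((fun Z : Mat F => ⁅(A : Mat F), Z⁆)^[m] (Matrix.single i j y)) i j =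
        (fun y : F => (A : Mat F) i i * y - y * (A : Mat F) j j)^[m] y := by
    intro m
    induction m with
    | zero => simpa using hYn
    | succ m ih =>
      rw [Function.iterate_succ_apply', Function.iterate_succ_apply']
      exact ⟨hbr _ ih.1, by rw [hentry _ ih.1, ih.2]⟩
  rw [← (hit (n + 1)).2, Function.iterate_succ_apply]
  change ((fun Z : Mat F => ⁅(A : Mat F), Z⁆)^[n] ((⁅A, Y⁆ : lie (par G b)) : Mat F)) i j = 0
  rw [hn]
  rfl

omit [IsRCH F] in
theorem τ_single {i j : Fin 3} (hij : i ≠ j) (c : F) : D.τ (Matrix.single i j c) = 0 := by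
  have h : D.τ (Matrix.single i i 1 * Matrix.single i j c) =
      D.τ (Matrix.single i j c * Matrix.single i i 1) := D.τ_mul_comm _ _
  rwa [Matrix.single_mul_single_same, one_mul, Matrix.single_mul_single_of_ne _ _ _ _ hij.symm,
    map_zero] at h

/-- The nilradical of a block triangular subalgebra consists of the strictly block triangular
matrices: an element of a nilpotent ideal is scalar and central modulo these, and its reduced trace
vanishes. -/
theorem nilradical_lie_par {b : Fin 3 → Fin 3} (hb : ∃ i j, b i ≠ b j) :
    nilradical (lie (par G b)) = nil F b := by
  apply le_antisymm
  · refine Submodule.map_le_iff_le_comap.2 ?_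
    have hle : sSup {I : LieIdeal ℝ (lie (par G b)) | LieRing.IsNilpotent I} ≤ D.nilIdeal b := by
      refine sSup_le fun I hI A hA => ?_
      -- every index has a neighbour in an adjacent block
      have hconn : ∀ b : Fin 3 → Fin 3, (∃ i j, b i ≠ b j) → ∀ i,
          (∃ j, b i < b j ∧ ∀ k, ¬ (b i < b k ∧ b k < b j)) ∨
          (∃ j, b j < b i ∧ ∀ k, ¬ (b j < b k ∧ b k < b i)) := by
        decide
      have hadj : ∀ i j, b i < b j → (∀ k, ¬ (b i < b k ∧ b k < b j)) →
          (A : Mat F) i i = (A : Mat F) j j := fun i j h1 h2 => by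
        simpa using D.diag_eq_of_mem_nilpotent hI hA h1 h2 1
      have hcen : ∀ i y, (A : Mat F) i i * y = y * (A : Mat F) i i := by
        intro i y
        rcases hconn b hb i with ⟨j, h1, h2⟩ | ⟨j, h1, h2⟩
        · have h := D.diag_eq_of_mem_nilpotent hI hA h1 h2 y
          rwa [← hadj i j h1 h2] at h
        · have h := D.diag_eq_of_mem_nilpotent hI hA h1 h2 y
          rwa [hadj j i h1 h2] at h
      -- every index is joined to `0` by at most two steps between adjacent blocks
      have hpath : ∀ b : Fin 3 → Fin 3, (∃ i j, b i ≠ b j) → ∀ i, i = 0 ∨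
          (b i < b 0 ∧ ∀ k, ¬ (b i < b k ∧ b k < b 0)) ∨
          (b 0 < b i ∧ ∀ k, ¬ (b 0 < b k ∧ b k < b i)) ∨
          ∃ j, ((b j < b 0 ∧ ∀ k, ¬ (b j < b k ∧ b k < b 0)) ∨
            (b 0 < b j ∧ ∀ k, ¬ (b 0 < b k ∧ b k < b j))) ∧
            ((b i < b j ∧ ∀ k, ¬ (b i < b k ∧ b k < b j)) ∨
            (b j < b i ∧ ∀ k, ¬ (b j < b k ∧ b k < b i))) := by
        decide
      have hall : ∀ i, (A : Mat F) i i = (A : Mat F) 0 0 := by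
        intro i
        rcases hpath b hb i with rfl | ⟨h1, h2⟩ | ⟨h1, h2⟩ | ⟨j, h3, h4⟩
        · rfl
        · exact hadj _ _ h1 h2
        · exact (hadj _ _ h1 h2).symm
        · have h5 : (A : Mat F) j j = (A : Mat F) 0 0 := by
            rcases h3 with ⟨h1, h2⟩ | ⟨h1, h2⟩
            · exact hadj _ _ h1 h2
            · exact (hadj _ _ h1 h2).symm
          rw [← h5]
          rcases h4 with ⟨h1, h2⟩ | ⟨h1, h2⟩
          · exact hadj _ _ h1 h2
          · exact (hadj _ _ h1 h2).symm
      have hz : (A : Mat F) 0 0 = 0 := by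
        refine D.τ_central _ (hcen 0) ?_
        have h := (D.lie_par_le b A.2).2
        rw [Matrix.matrix_eq_sum_single (A : Mat F)] at h
        rw [← h, ← Matrix.sum_single_eq_diagonal, map_sum, map_sum]
        refine Finset.sum_congr rfl fun i _ => ?_
        rw [map_sum, Finset.sum_eq_single i (fun j _ hj => D.τ_single hj.symm _) (by simp), hall i]
      change (A : Mat F) ∈ nil F b
      intro i j hij
      by_cases h : i = j
      · rw [← h, hall i, hz]
      · rcases hij.eq_or_lt with h1 | h1
        · exact D.apply_eq_zero_of_mem_nilpotent hI hA h h1.symm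
        · exact (D.lie_par_le b A.2).1 h1
    exact fun A hA => hle hA
  · intro X hX
    have hXl : X ∈ lie (par G b) :=
      D.mem_lie_par_of_mem_nil (blockTriangular_of_mem_nil hX) hX
    have hle : D.nilIdeal b ≤ sSup {I : LieIdeal ℝ (lie (par G b)) | LieRing.IsNilpotent I} :=
      le_sSup (D.isNilpotent_nilIdeal b)
    exact ⟨⟨X, hXl⟩, hle (show X ∈ nil F b from hX), rfl⟩

omit D in
theorem mem_expGroup_nil {b : Fin 3 → Fin 3} {u : GL3 F} :
    u ∈ expGroup (nil F b : Set (Mat F)) ↔ (u : Mat F) - 1 ∈ nil F b := by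
  constructor
  · intro hu
    induction hu using Subgroup.closure_induction with
    | mem u hu =>
      obtain ⟨X, hX, hu⟩ := hu
      obtain ⟨Y, hY, hXY⟩ := exp_mem_nil hX
      rw [hu, hXY, add_sub_cancel_left]
      exact hY
    | one => simp
    | mul u v _ _ hu hv =>
      have h : ((u * v : GL3 F) : Mat F) - 1 = (u - 1) * (v - 1) + (u - 1) + (v - 1) := by
        push_cast
        noncomm_ring
      rw [h]
      exact add_mem (add_mem (mul_mem_nil_left (blockTriangular_of_mem_nil hu) hv) hu) hv
    | inv u _ hu =>
      have h1 : BlockTriangular (u : Mat F) b := by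
        have := (blockTriangular_of_mem_nil hu).add (Matrix.blockTriangular_one (b := b))
        rwa [sub_add_cancel] at this
      have h2 : ((u⁻¹ : GL3 F) : Mat F) - 1 = -((u⁻¹ : GL3 F) * ((u : Mat F) - 1)) := by
        rw [mul_sub, Units.inv_mul, mul_one, neg_sub]
      rw [h2]
      exact neg_mem (mul_mem_nil_left (blockTriangular_inv h1) hu)
  · intro hu
    obtain ⟨Y, hY, hYu⟩ := exists_exp_eq_one_add hu
    exact Subgroup.subset_closure ⟨Y, hY, by rw [hYu, add_sub_cancel]⟩

theorem mem_unipotentRadical_par {b : Fin 3 → Fin 3} (hb : ∃ i j, b i ≠ b j) {u : GL3 F} :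
    u ∈ unipotentRadical (par G b) ↔ (u : Mat F) - 1 ∈ nil F b := by
  rw [unipotentRadical, D.nilradical_lie_par hb, mem_expGroup_nil]

end Determinant

end

/-! ### Transport along automorphisms -/

section

variable {F : Type} [NormedDivisionRing F]

theorem mem_conj {g x : GL3 F} {P : Subgroup (GL3 F)} : x ∈ conj g P ↔ g⁻¹ * x * g ∈ P := by
  constructor
  · rintro ⟨y, hy, rfl⟩
    change g⁻¹ * (g * y * g⁻¹) * g ∈ P
    rwa [show g⁻¹ * (g * y * g⁻¹) * g = y by group]
  · intro h
    exact ⟨_, h, by change g * (g⁻¹ * x * g) * g⁻¹ = x; group⟩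

theorem conj_conj (g h : GL3 F) (P : Subgroup (GL3 F)) : conj g (conj h P) = conj (g * h) P := by
  ext x
  simp only [mem_conj, mul_inv_rev, mul_assoc]

theorem conj_one (P : Subgroup (GL3 F)) : conj 1 P = P := by
  ext x
  simp [mem_conj]

theorem conj_mono {g : GL3 F} {P Q : Subgroup (GL3 F)} (h : P ≤ Q) : conj g P ≤ conj g Q :=
  Subgroup.map_mono h

theorem conj_le_iff {g : GL3 F} {P Q : Subgroup (GL3 F)} : conj g P ≤ Q ↔ P ≤ conj g⁻¹ Q := by
  constructor
  · intro h
    have := conj_mono (g := g⁻¹) h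
    rwa [conj_conj, inv_mul_cancel, conj_one] at this
  · intro h
    have := conj_mono (g := g) h
    rwa [conj_conj, mul_inv_cancel, conj_one] at this

theorem conj_eq_self {g : GL3 F} {P : Subgroup (GL3 F)} (hg : g ∈ P) : conj g P = P := by
  ext x
  rw [mem_conj]
  constructor
  · intro h
    have := mul_mem (mul_mem hg h) (inv_mem hg)
    rwa [show g * (g⁻¹ * x * g) * g⁻¹ = x by group] at this
  · exact fun h => mul_mem (mul_mem (inv_mem hg) h) hg

theorem coe_signature : ((signature F : GL3 F) : Mat F) = Matrix.diagonal ![1, -1, -1] := rfl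

theorem inv_signature : (signature F)⁻¹ = signature F :=
  inv_eq_of_mul_eq_one_right (signature_mul_self F)

theorem sigma_apply [StarRing F] (g : GL3 F) :
    sigma F g = signature F * star g⁻¹ * signature F := rfl

theorem star_signature [StarRing F] : star (signature F) = signature F := by
  ext1
  rw [Units.coe_star, coe_signature, Matrix.star_eq_conjTranspose, Matrix.diagonal_conjTranspose]
  congr 1
  funext i
  fin_cases i <;> simp

theorem sigma_sigma [StarRing F] (g : GL3 F) : sigma F (sigma F g) = g := by
  simp only [sigma_apply, mul_inv_rev, inv_signature, star_mul, star_signature, star_inv, inv_inv,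
    star_star]
  calc signature F * (signature F * g * signature F) * signature F
      = (signature F * signature F) * g * (signature F * signature F) := by group
    _ = g := by rw [signature_mul_self, one_mul, mul_one]

theorem sigma_eq_self_iff [StarRing F] {g : GL3 F} :
    sigma F g = g ↔ star g * signature F * g = signature F := by
  rw [sigma_apply, star_inv]
  constructor
  · intro h
    calc star g * signature F * g
        = star g * signature F * (signature F * (star g)⁻¹ * signature F) := by rw [h]
      _ = star g * (signature F * signature F) * (star g)⁻¹ * signature F := by group
      _ = signature F := by rw [signature_mul_self]; group
  · intro h
    calc signature F * (star g)⁻¹ * signature F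
        = signature F * (star g)⁻¹ * (star g * signature F * g) := by rw [h]
      _ = (signature F * signature F) * g := by group
      _ = g := by rw [signature_mul_self, one_mul]

end

section

variable {F : Type} [NormedDivisionRing F] [NormedAlgebra ℝ F]

theorem map_nilradical_le (φ : Mat F ≃ₗ⁅ℝ⁆ Mat F) (q : LieSubalgebra ℝ (Mat F)) :
    (nilradical q).map (φ : Mat F →ₗ[ℝ] Mat F) ≤ nilradical (q.map (φ : Mat F →ₗ⁅ℝ⁆ Mat F)) := by
  let e := φ.lieSubalgebraMap q
  have he : ∀ x : q, ((e x : q.map (φ : Mat F →ₗ⁅ℝ⁆ Mat F)) : Mat F) = φ x := fun x => rfl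
  have hle : sSup {I : LieIdeal ℝ q | LieRing.IsNilpotent I} ≤
      LieIdeal.comap (e : q →ₗ⁅ℝ⁆ _)
        (sSup {I : LieIdeal ℝ (q.map (φ : Mat F →ₗ⁅ℝ⁆ Mat F)) | LieRing.IsNilpotent I}) := by
    refine sSup_le fun I hI x hx => ?_
    let J : LieIdeal ℝ (q.map (φ : Mat F →ₗ⁅ℝ⁆ Mat F)) :=
      LieIdeal.comap (e.symm : _ →ₗ⁅ℝ⁆ q) I
    have hJ : LieRing.IsNilpotent J := by
      have hI' : LieRing.IsNilpotent I := hI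
      let f : J →ₗ⁅ℝ⁆ I :=
        { toFun := fun y => ⟨e.symm y, y.2⟩
          map_add' := fun y z => by ext1; exact map_add e.symm _ _
          map_smul' := fun c y => by ext1; exact map_smul e.symm _ _
          map_lie' := fun {y z} => by ext1; exact e.symm.map_lie _ _ }
      have hf : Function.Injective f := by
        intro y z h
        exact Subtype.ext (e.symm.injective (congrArg Subtype.val h))
      exact hf.lieAlgebra_isNilpotent
    have hxJ : e x ∈ J := by
      change e.symm (e x) ∈ I
      rwa [LieEquiv.symm_apply_apply]
    exact (le_sSup (α := LieIdeal ℝ _) hJ) hxJ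
  rintro _ ⟨_, ⟨x, hx, rfl⟩, rfl⟩
  exact ⟨e x, hle hx, he x⟩

theorem nilradical_map (φ : Mat F ≃ₗ⁅ℝ⁆ Mat F) (q : LieSubalgebra ℝ (Mat F)) :
    nilradical (q.map (φ : Mat F →ₗ⁅ℝ⁆ Mat F)) =
      (nilradical q).map (φ : Mat F →ₗ[ℝ] Mat F) := by
  refine le_antisymm (fun X hX => ?_) (map_nilradical_le φ q)
  have h := map_nilradical_le φ.symm (q.map (φ : Mat F →ₗ⁅ℝ⁆ Mat F))
    (Submodule.mem_map_of_mem hX)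
  have hq : (q.map (φ : Mat F →ₗ⁅ℝ⁆ Mat F)).map (φ.symm : Mat F →ₗ⁅ℝ⁆ Mat F) = q := by
    ext Y
    constructor
    · rintro ⟨_, ⟨Z, hZ, rfl⟩, rfl⟩
      change φ.symm (φ Z) ∈ q
      rwa [LieEquiv.symm_apply_apply]
    · intro hY
      exact ⟨φ Y, ⟨Y, hY, rfl⟩, φ.symm_apply_apply Y⟩
  rw [hq] at h
  exact ⟨_, h, φ.apply_symm_apply X⟩

/-- The automorphism `φ` of `M₃(F)` is the differential of the automorphism `Φ` of `GL(3, F)`. -/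
def IsDifferential (Φ : GL3 F ≃* GL3 F) (φ : Mat F ≃ₗ⁅ℝ⁆ Mat F) : Prop :=
  ∀ (u : GL3 F) (X : Mat F), (u : Mat F) = NormedSpace.exp X →
    (Φ u : Mat F) = NormedSpace.exp (φ X)

namespace IsDifferential

variable {Φ : GL3 F ≃* GL3 F} {φ : Mat F ≃ₗ⁅ℝ⁆ Mat F} (h : IsDifferential Φ φ)
include h

theorem symm [CompleteSpace F] : IsDifferential Φ.symm φ.symm := by
  intro u X hu
  have h1 := h (expUnit (φ.symm X)) (φ.symm X) rfl
  rw [LieEquiv.apply_symm_apply, ← hu] at h1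
  rw [← Units.ext h1, MulEquiv.symm_apply_apply]
  rfl

theorem map_lie_le (P : Subgroup (GL3 F)) :
    (lie P).map (φ : Mat F →ₗ⁅ℝ⁆ Mat F) ≤ lie (P.map Φ.toMonoidHom) := by
  rw [LieSubalgebra.map_le_iff_le_comap]
  refine LieSubalgebra.lieSpan_le.2 fun X hX => ?_
  refine mem_lie_of_exp fun t => ?_
  obtain ⟨u, hu, hut⟩ := hX t
  refine ⟨Φ u, ⟨u, hu, rfl⟩, ?_⟩
  rw [h _ _ hut, map_smul]
  rfl

theorem lie_map [CompleteSpace F] (P : Subgroup (GL3 F)) :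
    lie (P.map Φ.toMonoidHom) = (lie P).map (φ : Mat F →ₗ⁅ℝ⁆ Mat F) := by
  refine le_antisymm (fun X hX => ?_) (h.map_lie_le P)
  have h1 := h.symm.map_lie_le (P.map Φ.toMonoidHom) ⟨X, hX, rfl⟩
  have h2 : (P.map Φ.toMonoidHom).map Φ.symm.toMonoidHom = P := by
    rw [Subgroup.map_map]
    convert Subgroup.map_id P
    ext1 x
    exact Φ.symm_apply_apply x
  rw [h2] at h1
  exact ⟨_, h1, φ.apply_symm_apply X⟩

theorem expGroup_map [CompleteSpace F] (S : Set (Mat F)) :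
    expGroup (φ '' S) = (expGroup S).map Φ.toMonoidHom := by
  rw [expGroup, expGroup, MonoidHom.map_closure]
  congr 1
  ext u
  constructor
  · rintro ⟨_, ⟨X, hX, rfl⟩, hu⟩
    refine ⟨Φ.symm u, ⟨X, hX, ?_⟩, Φ.apply_symm_apply u⟩
    have := h.symm u _ hu
    rwa [LieEquiv.symm_apply_apply] at this
  · rintro ⟨v, ⟨X, hX, hv⟩, rfl⟩
    exact ⟨φ X, ⟨X, hX, rfl⟩, h _ _ hv⟩

theorem nilradical_lie_map [CompleteSpace F] (P : Subgroup (GL3 F)) :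
    nilradical (lie (P.map Φ.toMonoidHom)) =
      (nilradical (lie P)).map (φ : Mat F →ₗ[ℝ] Mat F) := by
  rw [h.lie_map, nilradical_map]

theorem unipotentRadical_map [CompleteSpace F] (P : Subgroup (GL3 F)) :
    unipotentRadical (P.map Φ.toMonoidHom) = (unipotentRadical P).map Φ.toMonoidHom := by
  rw [unipotentRadical, h.nilradical_lie_map, unipotentRadical, ← h.expGroup_map]
  rfl

theorem isLevi_map [CompleteSpace F] {P L : Subgroup (GL3 F)} (hL : IsLevi P L) :
    IsLevi (P.map Φ.toMonoidHom) (L.map Φ.toMonoidHom) := by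
  obtain ⟨h1, h2⟩ := hL
  refine ⟨?_, ?_⟩
  · rw [h.unipotentRadical_map, ← Subgroup.map_sup, h1]
  · rw [h.unipotentRadical_map, ← Subgroup.map_inf _ _ _ Φ.injective, h2, Subgroup.map_bot]

end IsDifferential

/-- Conjugation by `g`, as an automorphism of the Lie algebra of matrices. -/
def adEquiv (g : GL3 F) : Mat F ≃ₗ⁅ℝ⁆ Mat F where
  toFun X := g * X * (g⁻¹ : GL3 F)
  invFun X := (g⁻¹ : GL3 F) * X * g
  map_add' X Y := by simp [mul_add, add_mul]
  map_smul' c X := by simp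
  map_lie' {X Y} := by
    simp only [LieRing.of_associative_ring_bracket, mul_sub, sub_mul, mul_assoc,
      Units.inv_mul_cancel_left]
  left_inv X := by simp [mul_assoc]
  right_inv X := by simp [mul_assoc]

theorem isDifferential_conj [CompleteSpace F] (g : GL3 F) :
    IsDifferential (MulAut.conj g) (adEquiv g) := by
  intro u X hu
  change ((g * u * g⁻¹ : GL3 F) : Mat F) = _
  rw [Units.val_mul, Units.val_mul, hu, ← exp_conj]
  rfl

end

/-! ### Parabolic subgroups that contain the upper triangular matrices -/

/-- The shape of the upper triangular matrices, the stabilizer of the standard flag. -/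
abbrev flagShape : Fin 3 → Fin 3 := ![0, 1, 2]

/-- The shape of the stabilizer of the line spanned by the first basis vector. -/
abbrev lineShape : Fin 3 → Fin 3 := ![0, 1, 1]

/-- The shape of the stabilizer of the plane spanned by the first two basis vectors. -/
abbrev planeShape : Fin 3 → Fin 3 := ![0, 0, 1]

section

variable {F : Type} [NormedDivisionRing F]

theorem blockTriangular_line_iff {X : Mat F} :
    BlockTriangular X lineShape ↔ X 1 0 = 0 ∧ X 2 0 = 0 := by
  constructor
  · exact fun h => ⟨h (by decide), h (by decide)⟩
  · rintro ⟨h1, h2⟩ i j hij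
    fin_cases i <;> fin_cases j <;> first | exact h1 | exact h2 | exact absurd hij (by decide)

theorem blockTriangular_plane_iff {X : Mat F} :
    BlockTriangular X planeShape ↔ X 2 0 = 0 ∧ X 2 1 = 0 := by
  constructor
  · exact fun h => ⟨h (by decide), h (by decide)⟩
  · rintro ⟨h1, h2⟩ i j hij
    fin_cases i <;> fin_cases j <;> first | exact h1 | exact h2 | exact absurd hij (by decide)

theorem blockTriangular_flag_iff {X : Mat F} :
    BlockTriangular X flagShape ↔ BlockTriangular X lineShape ∧ BlockTriangular X planeShape := by
  rw [blockTriangular_line_iff, blockTriangular_plane_iff]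
  constructor
  · exact fun h => ⟨⟨h (by decide), h (by decide)⟩, ⟨h (by decide), h (by decide)⟩⟩
  · rintro ⟨⟨h1, h2⟩, -, h3⟩ i j hij
    fin_cases i <;> fin_cases j <;>
      first | exact h1 | exact h2 | exact h3 | exact absurd hij (by decide)

theorem coe_transvectionUnit {i j : Fin 3} (hij : i ≠ j) (c : F) :
    (transvectionUnit hij c : Mat F) = 1 + Matrix.single i j c := rfl

end

section

variable {F : Type} [NormedDivisionRing F] [NormedAlgebra ℝ F] [StarRing F] [IsRCH F]
  {G : Subgroup (GL3 F)}

theorem par_flag_eq : par G flagShape = par G lineShape ⊓ par G planeShape := by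
  ext g
  simp only [Subgroup.mem_inf, mem_par, blockTriangular_flag_iff]
  tauto

theorem par_flag_le_line : par G flagShape ≤ par G lineShape := par_flag_eq.trans_le inf_le_left

theorem par_flag_le_plane : par G flagShape ≤ par G planeShape := par_flag_eq.trans_le inf_le_right

theorem par_le (b : Fin 3 → Fin 3) : par G b ≤ G := fun _ h => h.1

namespace Determinant

variable (D : Determinant G)
include D

theorem transvectionUnit_mem_par {b : Fin 3 → Fin 3} {i j : Fin 3} (hij : i ≠ j)
    (hb : b i ≤ b j) (c : F) : transvectionUnit hij c ∈ par G b := by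
  refine ⟨D.transvectionUnit_mem hij c, Matrix.blockTriangular_one.add fun k l hkl => ?_⟩
  rw [Matrix.single_apply, if_neg]
  rintro ⟨rfl, rfl⟩
  exact absurd hb (not_le.2 hkl)

variable {R : Subgroup (GL3 F)}

/-- A subgroup that contains the upper triangular matrices, and an element of the line stabilizer
that is not upper triangular, contains the line stabilizer: the Bruhat decomposition of the
Levi factor has only two cells. -/
theorem par_line_le (hB : par G flagShape ≤ R) {r : GL3 F} (hr : r ∈ R)
    (hrl : r ∈ par G lineShape) (h21 : (r : Mat F) 2 1 ≠ 0) : par G lineShape ≤ R := by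
  intro q hq
  obtain ⟨q10, q20⟩ := blockTriangular_line_iff.1 hq.2
  by_cases hq21 : (q : Mat F) 2 1 = 0
  · exact hB ⟨hq.1, blockTriangular_flag_iff.2 ⟨hq.2, blockTriangular_plane_iff.2 ⟨q20, hq21⟩⟩⟩
  -- `c` is chosen such that `q (1 + c E₁₂) r` is upper triangular
  let c : F := -(((q : Mat F) 2 1)⁻¹ * (q : Mat F) 2 2 * (r : Mat F) 2 1 + (r : Mat F) 1 1) *
    ((r : Mat F) 2 1)⁻¹
  let t : GL3 F := transvectionUnit (show (1 : Fin 3) ≠ 2 by decide) c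
  have ht : t ∈ par G flagShape := D.transvectionUnit_mem_par _ (by decide) c
  have hqtr : q * t * r ∈ par G flagShape := by
    have h1 : q * t * r ∈ par G lineShape := mul_mem (mul_mem hq (par_flag_le_line ht)) hrl
    refine ⟨h1.1, blockTriangular_flag_iff.2 ⟨h1.2, blockTriangular_plane_iff.2
      ⟨(blockTriangular_line_iff.1 h1.2).2, ?_⟩⟩⟩
    have hcr : c * (r : Mat F) 2 1 =
        -(((q : Mat F) 2 1)⁻¹ * (q : Mat F) 2 2 * (r : Mat F) 2 1 + (r : Mat F) 1 1) := by
      rw [mul_assoc, inv_mul_cancel₀ h21, mul_one]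
    simp only [Units.val_mul, t, coe_transvectionUnit, Matrix.mul_apply, Fin.sum_univ_three, q20]
    simp [add_mul, mul_assoc]
    rw [hcr]
    simp only [mul_neg, mul_add, ← mul_assoc, mul_inv_cancel₀ hq21]
    simp
  have h2 : q = (q * t * r) * r⁻¹ * t⁻¹ := by group
  rw [h2]
  exact mul_mem (mul_mem (hB hqtr) (inv_mem hr)) (inv_mem (hB ht))

/-- A subgroup that contains the upper triangular matrices, and an element of the plane stabilizer
that is not upper triangular, contains the plane stabilizer. -/
theorem par_plane_le (hB : par G flagShape ≤ R) {r : GL3 F} (hr : r ∈ R)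
    (hrl : r ∈ par G planeShape) (h10 : (r : Mat F) 1 0 ≠ 0) : par G planeShape ≤ R := by
  intro q hq
  obtain ⟨q20, q21⟩ := blockTriangular_plane_iff.1 hq.2
  obtain ⟨r20, r21⟩ := blockTriangular_plane_iff.1 hrl.2
  by_cases hq10 : (q : Mat F) 1 0 = 0
  · exact hB ⟨hq.1, blockTriangular_flag_iff.2 ⟨blockTriangular_line_iff.2 ⟨hq10, q20⟩, hq.2⟩⟩
  -- `c` is chosen such that `q (1 + c E₀₁) r` is upper triangular
  let c : F := -(((q : Mat F) 1 0)⁻¹ * (q : Mat F) 1 1 * (r : Mat F) 1 0 + (r : Mat F) 0 0) *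
    ((r : Mat F) 1 0)⁻¹
  let t : GL3 F := transvectionUnit (show (0 : Fin 3) ≠ 1 by decide) c
  have ht : t ∈ par G flagShape := D.transvectionUnit_mem_par _ (by decide) c
  have hqtr : q * t * r ∈ par G flagShape := by
    have h1 : q * t * r ∈ par G planeShape := mul_mem (mul_mem hq (par_flag_le_plane ht)) hrl
    refine ⟨h1.1, blockTriangular_flag_iff.2 ⟨blockTriangular_line_iff.2
      ⟨?_, (blockTriangular_plane_iff.1 h1.2).1⟩, h1.2⟩⟩
    have hcr : c * (r : Mat F) 1 0 =
        -(((q : Mat F) 1 0)⁻¹ * (q : Mat F) 1 1 * (r : Mat F) 1 0 + (r : Mat F) 0 0) := by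
      rw [mul_assoc, inv_mul_cancel₀ h10, mul_one]
    simp only [Units.val_mul, t, coe_transvectionUnit, Matrix.mul_apply, Fin.sum_univ_three, r20]
    simp [add_mul, mul_assoc]
    rw [hcr]
    simp only [mul_neg, mul_add, ← mul_assoc, mul_inv_cancel₀ hq10]
    simp
  have h2 : q = (q * t * r) * r⁻¹ * t⁻¹ := by group
  rw [h2]
  exact mul_mem (mul_mem (hB hqtr) (inv_mem hr)) (inv_mem (hB ht))

/-- A subgroup that contains the upper triangular matrices, and an element with nonzero lower left
entry, contains `G`. -/
theorem le_of_apply_ne_zero (hB : par G flagShape ≤ R) (hRG : R ≤ G) {r : GL3 F} (hr : r ∈ R)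
    (h20 : (r : Mat F) 2 0 ≠ 0) : G ≤ R := by
  have n02 : (0 : Fin 3) ≠ 2 := by decide
  have n12 : (1 : Fin 3) ≠ 2 := by decide
  have n20 : (2 : Fin 3) ≠ 0 := by decide
  have n21 : (2 : Fin 3) ≠ 1 := by decide
  have n10 : (1 : Fin 3) ≠ 0 := by decide
  have n01 : (0 : Fin 3) ≠ 1 := by decide
  -- clear the first column of `r` above the lower left entry
  obtain ⟨s, hs, s00, s10, s20⟩ : ∃ s ∈ R, (s : Mat F) 0 0 = 0 ∧ (s : Mat F) 1 0 = 0 ∧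
      (s : Mat F) 2 0 ≠ 0 := by
    let t1 : GL3 F := transvectionUnit n02 (-(r : Mat F) 0 0 * ((r : Mat F) 2 0)⁻¹)
    let t2 : GL3 F := transvectionUnit n12 (-(r : Mat F) 1 0 * ((r : Mat F) 2 0)⁻¹)
    refine ⟨t1 * t2 * r, mul_mem (mul_mem (hB (D.transvectionUnit_mem_par _ (by decide) _))
      (hB (D.transvectionUnit_mem_par _ (by decide) _))) hr, ?_, ?_, ?_⟩ <;>
    · simp only [Units.val_mul, t1, t2, coe_transvectionUnit, Matrix.mul_apply, Fin.sum_univ_three]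
      simp [h20]
  have si : ∀ i, ((s⁻¹ : GL3 F) : Mat F) i 2 = if i = 0 then ((s : Mat F) 2 0)⁻¹ else 0 := by
    intro i
    have h := congrFun (congrFun (Units.inv_mul s) i) 0
    rw [Matrix.mul_apply, Fin.sum_univ_three, s00, s10, mul_zero, mul_zero, zero_add, zero_add,
      Matrix.one_apply] at h
    split_ifs at h ⊢ with h0
    · exact eq_inv_of_mul_eq_one_left h
    · exact (mul_eq_zero.1 h).resolve_right s20
  -- conjugation by `s` maps the first row to the last row
  have hlow : ∀ x y : F, ∃ u ∈ R, (u : Mat F) = 1 + (Matrix.single 2 0 x + Matrix.single 2 1 y) := by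
    intro x y
    set N : Mat F := Matrix.single 2 0 x + Matrix.single 2 1 y with hN
    have hX : (s⁻¹ : GL3 F) * N * s ∈ nil F flagShape := by
      intro i j hij
      have hij' : i ≠ 0 ∨ j = 0 := by
        revert hij
        fin_cases i <;> fin_cases j <;> simp
      rw [mul_assoc, Matrix.mul_apply, Fin.sum_univ_three]
      have hNs : ∀ k, (N * (s : Mat F)) k j =
          if k = 2 then x * (s : Mat F) 0 j + y * (s : Mat F) 1 j else 0 := by
        intro k
        rw [hN, Matrix.mul_apply, Fin.sum_univ_three]
        fin_cases k <;> simp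
      rw [hNs, hNs, hNs, si]
      rcases hij' with h | rfl
      · simp [h]
      · simp [s00, s10]
    have hu : oneAddNil hX ∈ par G flagShape :=
      ⟨D.oneAddNil_mem hX, Matrix.blockTriangular_one.add (blockTriangular_of_mem_nil hX)⟩
    refine ⟨s * oneAddNil hX * s⁻¹, mul_mem (mul_mem hs (hB hu)) (inv_mem hs), ?_⟩
    rw [Units.val_mul, Units.val_mul]
    change (s : Mat F) * (1 + (s⁻¹ : GL3 F) * N * s) * (s⁻¹ : GL3 F) = 1 + N
    simp only [mul_add, add_mul, mul_one, Units.mul_inv, mul_assoc, Units.mul_inv_cancel_left]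
  have hline : par G lineShape ≤ R := by
    obtain ⟨u, hu, hue⟩ := hlow 0 1
    refine D.par_line_le hB hu ⟨hRG hu, blockTriangular_line_iff.2 ?_⟩ ?_ <;>
      simp [hue]
  have hplane : par G planeShape ≤ R := by
    obtain ⟨u, hu, hue⟩ := hlow 1 0
    have hu' : u = transvectionUnit n20 1 := by
      ext1
      rw [hue, coe_transvectionUnit, Matrix.single_zero, add_zero]
    have h12 : transvectionUnit n12 (1 : F) ∈ R :=
      hB (D.transvectionUnit_mem_par _ (by decide) _)
    have h3 : (transvectionUnit n12 (1 : F) * u * (transvectionUnit n12 (1 : F))⁻¹ * u⁻¹ : GL3 F) =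
        transvectionUnit n10 1 := by
      rw [mul_inv_eq_iff_eq_mul, mul_inv_eq_iff_eq_mul, hu']
      ext1
      simp only [Units.val_mul, coe_transvectionUnit]
      simp [mul_add, add_mul]
      abel
    have h4 : transvectionUnit n10 (1 : F) ∈ R := by
      rw [← h3]
      exact mul_mem (mul_mem (mul_mem h12 hu) (inv_mem h12)) (inv_mem hu)
    refine D.par_plane_le hB h4 ⟨hRG h4, blockTriangular_plane_iff.2 ?_⟩ ?_ <;>
      simp [coe_transvectionUnit]
  -- elements with vanishing lower left entry
  have hzero : ∀ q ∈ G, (q : Mat F) 2 0 = 0 → q ∈ R := by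
    have hne : ∀ q ∈ G, (q : Mat F) 2 0 = 0 → (q : Mat F) 0 0 ≠ 0 → q ∈ R := by
      intro q hq q20 q00
      let t : GL3 F := transvectionUnit n10 (-(q : Mat F) 1 0 * ((q : Mat F) 0 0)⁻¹)
      have ht : t ∈ R := hplane (D.transvectionUnit_mem_par _ (by decide) _)
      have h1 : t * q ∈ par G lineShape := by
        refine ⟨mul_mem (hRG ht) hq, blockTriangular_line_iff.2 ⟨?_, ?_⟩⟩ <;>
        · simp only [Units.val_mul, t, coe_transvectionUnit, Matrix.mul_apply, Fin.sum_univ_three]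
          simp [q20, q00]
      have h2 := mul_mem (inv_mem ht) (hline h1)
      rwa [inv_mul_cancel_left] at h2
    intro q hq q20
    by_cases q00 : (q : Mat F) 0 0 = 0
    · let t : GL3 F := transvectionUnit n01 1
      have ht : t ∈ R := hplane (D.transvectionUnit_mem_par _ (by decide) _)
      have q10 : (q : Mat F) 1 0 ≠ 0 := by
        intro q10
        have h := congrFun (congrFun (Units.inv_mul q) 0) 0
        rw [Matrix.mul_apply, Fin.sum_univ_three, q00, q10, q20] at h
        simp at h
      have h1 : t * q ∈ R := by
        refine hne _ (mul_mem (hRG ht) hq) ?_ ?_ <;>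
        · simp only [Units.val_mul, t, coe_transvectionUnit, Matrix.mul_apply, Fin.sum_univ_three]
          simp [q20, q00, q10]
      have h2 := mul_mem (inv_mem ht) h1
      rwa [inv_mul_cancel_left] at h2
    · exact hne q hq q20 q00
  intro q hq
  by_cases q20 : (q : Mat F) 2 0 = 0
  · exact hzero q hq q20
  let t : GL3 F := transvectionUnit n02
    (-(((q : Mat F) 2 0)⁻¹ * ((q : Mat F) 2 2 * (s : Mat F) 2 0)) * ((s : Mat F) 2 0)⁻¹)
  have ht : t ∈ R := hB (D.transvectionUnit_mem_par _ (by decide) _)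
  have h1 : q * t * s ∈ R := by
    refine hzero _ (mul_mem (mul_mem hq (hRG ht)) (hRG hs)) ?_
    simp only [Units.val_mul, t, coe_transvectionUnit, Matrix.mul_apply, Fin.sum_univ_three]
    simp [s00, s10, mul_assoc, s20, q20]
  have h2 : q = (q * t * s) * s⁻¹ * t⁻¹ := by group
  rw [h2]
  exact mul_mem (mul_mem h1 (inv_mem hs)) (inv_mem ht)

/-- The subgroups of `G` that contain the upper triangular matrices. -/
theorem eq_par_of_par_flag_le (hB : par G flagShape ≤ R) (hRG : R ≤ G) :
    R = par G flagShape ∨ R = par G lineShape ∨ R = par G planeShape ∨ R = G := by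
  by_cases h20 : ∃ r ∈ R, (r : Mat F) 2 0 ≠ 0
  · obtain ⟨r, hr, h⟩ := h20
    exact Or.inr (Or.inr (Or.inr (le_antisymm hRG (D.le_of_apply_ne_zero hB hRG hr h))))
  push Not at h20
  by_cases h10 : ∃ r ∈ R, (r : Mat F) 1 0 ≠ 0
  · obtain ⟨r, hr, hr10⟩ := h10
    have h21 : ∀ q ∈ R, (q : Mat F) 2 1 = 0 := by
      intro q hq
      have h := h20 (q * r) (mul_mem hq hr)
      rw [Units.val_mul, Matrix.mul_apply, Fin.sum_univ_three, h20 q hq, h20 r hr, zero_mul,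
        mul_zero, zero_add, add_zero] at h
      exact (mul_eq_zero.1 h).resolve_right hr10
    have hle : R ≤ par G planeShape := fun q hq =>
      ⟨hRG hq, blockTriangular_plane_iff.2 ⟨h20 q hq, h21 q hq⟩⟩
    exact Or.inr (Or.inr (Or.inl (le_antisymm hle (D.par_plane_le hB hr (hle hr) hr10))))
  · push Not at h10
    have hle : R ≤ par G lineShape := fun q hq =>
      ⟨hRG hq, blockTriangular_line_iff.2 ⟨h10 q hq, h20 q hq⟩⟩
    by_cases h21 : ∃ r ∈ R, (r : Mat F) 2 1 ≠ 0
    · obtain ⟨r, hr, hr21⟩ := h21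
      exact Or.inr (Or.inl (le_antisymm hle (D.par_line_le hB hr (hle hr) hr21)))
    · push Not at h21
      refine Or.inl (le_antisymm (fun q hq => ⟨hRG hq, ?_⟩) hB)
      exact blockTriangular_flag_iff.2 ⟨(hle hq).2,
        blockTriangular_plane_iff.2 ⟨h20 q hq, h21 q hq⟩⟩

end Determinant

end

/-! ### Levi decompositions and minimal parabolic subgroups -/

section

variable {F : Type} [NormedDivisionRing F]

/-- The block diagonal part of a matrix. -/
def blockDiagPart (b : Fin 3 → Fin 3) (X : Mat F) : Mat F :=
  Matrix.of fun i j => if b i = b j then X i j else 0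

theorem blockDiagPart_apply (b : Fin 3 → Fin 3) (X : Mat F) (i j : Fin 3) :
    blockDiagPart b X i j = if b i = b j then X i j else 0 := rfl

theorem blockDiagPart_one (b : Fin 3 → Fin 3) : blockDiagPart b (1 : Mat F) = 1 := by
  ext i j
  rw [blockDiagPart_apply]
  by_cases h : i = j
  · simp [h]
  · simp [Matrix.one_apply_ne h]

theorem blockDiagPart_mul {b : Fin 3 → Fin 3} {X Y : Mat F} (hX : BlockTriangular X b)
    (hY : BlockTriangular Y b) : blockDiagPart b (X * Y) = blockDiagPart b X * blockDiagPart b Y := by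
  ext i j
  rw [blockDiagPart_apply, Matrix.mul_apply, Matrix.mul_apply]
  split_ifs with hij
  · refine Finset.sum_congr rfl fun k _ => ?_
    rw [blockDiagPart_apply, blockDiagPart_apply]
    rcases lt_trichotomy (b k) (b i) with h | h | h
    · rw [hX h, if_neg h.ne', zero_mul, zero_mul]
    · rw [if_pos h.symm, if_pos (h.trans hij)]
    · rw [hY (hij ▸ h), if_neg h.ne, mul_zero, zero_mul]
  · refine (Finset.sum_eq_zero fun k _ => ?_).symm
    rw [blockDiagPart_apply, blockDiagPart_apply]
    split_ifs with h1 h2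
    · exact absurd (h1.trans h2) hij
    · rw [mul_zero]
    · rw [zero_mul]
    · rw [zero_mul]

theorem blockTriangular_blockDiagPart (b : Fin 3 → Fin 3) (X : Mat F) :
    BlockTriangular (blockDiagPart b X) b := fun i j hij => by
  rw [blockDiagPart_apply, if_neg hij.ne']

end

section

variable {F : Type} [NormedDivisionRing F] [NormedAlgebra ℝ F] [StarRing F] [IsRCH F]
  {G : Subgroup (GL3 F)}

/-- The block diagonal part of an invertible block triangular matrix, as an invertible matrix. -/
def leviPart {b : Fin 3 → Fin 3} {g : GL3 F} (hg : BlockTriangular (g : Mat F) b) : GL3 F where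
  val := blockDiagPart b g
  inv := blockDiagPart b (g⁻¹ : GL3 F)
  val_inv := by
    rw [← blockDiagPart_mul hg (blockTriangular_inv hg), Units.mul_inv, blockDiagPart_one]
  inv_val := by
    rw [← blockDiagPart_mul (blockTriangular_inv hg) hg, Units.inv_mul, blockDiagPart_one]

theorem leviPart_inv_mul_sub_one {b : Fin 3 → Fin 3} {g : GL3 F}
    (hg : BlockTriangular (g : Mat F) b) :
    (((leviPart hg)⁻¹ * g : GL3 F) : Mat F) - 1 ∈ nil F b := by
  have h1 : (((leviPart hg)⁻¹ : GL3 F) : Mat F) = blockDiagPart b (g⁻¹ : GL3 F) := rfl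
  have h2 : BlockTriangular (((leviPart hg)⁻¹ * g : GL3 F) : Mat F) b := by
    rw [Units.val_mul, h1]
    exact (blockTriangular_blockDiagPart _ _).mul hg
  have hidem : ∀ X : Mat F, blockDiagPart b (blockDiagPart b X) = blockDiagPart b X := fun X => by
    ext i j
    simp only [blockDiagPart_apply]
    split_ifs <;> rfl
  have h3 : blockDiagPart b (((leviPart hg)⁻¹ * g : GL3 F) : Mat F) = 1 := by
    rw [Units.val_mul, h1, blockDiagPart_mul (blockTriangular_blockDiagPart _ _) hg, hidem,
      ← blockDiagPart_mul (blockTriangular_inv hg) hg, Units.inv_mul, blockDiagPart_one]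
  intro i j hij
  rw [Matrix.sub_apply, sub_eq_zero]
  rcases hij.eq_or_lt with h | h
  · rw [← h3, blockDiagPart_apply, if_pos h.symm]
  · rw [h2 h, Matrix.one_apply_ne]
    rintro rfl
    exact lt_irrefl _ h

theorem M_le_par (b : Fin 3 → Fin 3) : M G ≤ par G b := by
  rintro k ⟨hk, hk'⟩
  refine ⟨hk.1, fun i j hij => ?_⟩
  -- the entries of `diag(1, 3, -4)` are distinct
  have h := congrFun (congrFun (hk' _ ⟨![1, 3, -4], by
    rw [Fin.sum_univ_three]; change (1 : ℝ) + 3 + -4 = 0; norm_num, rfl⟩) i) j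
  rw [realDiag, Matrix.diagonal_mul, Matrix.mul_diagonal, ← Algebra.commutes, ← sub_eq_zero,
    ← sub_mul, ← map_sub, mul_eq_zero] at h
  refine h.resolve_left fun h0 => ?_
  rw [map_eq_zero_iff _ (algebraMap ℝ F).injective] at h0
  have hne : i ≠ j := by rintro rfl; exact lt_irrefl _ hij
  fin_cases i <;> fin_cases j <;> first | exact hne rfl | norm_num at h0

namespace Determinant

variable (D : Determinant G)
include D

theorem expGroup_𝔞_le_par (b : Fin 3 → Fin 3) : expGroup (𝔞 F) ≤ par G b := by
  refine (Subgroup.closure_le _).2 ?_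
  rintro u ⟨_, ⟨x, hx, rfl⟩, hu⟩
  have h1 : u = expUnit (realDiag F x) := Units.ext hu
  refine ⟨h1 ▸ D.realDiag_expUnit_mem hx, ?_⟩
  rw [hu, exp_realDiag]
  exact Matrix.blockTriangular_diagonal _

theorem expGroup_nil_le_par (b : Fin 3 → Fin 3) :
    expGroup (nil F b : Set (Mat F)) ≤ par G b := by
  intro u hu
  rw [mem_expGroup_nil] at hu
  have h : (u : Mat F) = 1 + ((u : Mat F) - 1) := by abel
  refine ⟨(D.mem_iff u).2 (h ▸ D.δ_one_add_nil hu), ?_⟩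
  rw [h]
  exact Matrix.blockTriangular_one.add (blockTriangular_of_mem_nil hu)

theorem leviPart_mem {b : Fin 3 → Fin 3} {g : GL3 F} (hg : g ∈ par G b) : leviPart hg.2 ∈ G := by
  have h1 : (leviPart hg.2)⁻¹ * g ∈ par G b := by
    refine D.expGroup_nil_le_par b ?_
    rw [mem_expGroup_nil]
    exact leviPart_inv_mul_sub_one hg.2
  have h2 := mul_mem hg.1 (inv_mem h1.1)
  rwa [mul_inv_rev, inv_inv, mul_inv_cancel_left] at h2

/-- The polar decomposition of a diagonal matrix. -/
theorem diagUnit_mem_sup {d : Fin 3 → Fˣ} (hd : diagUnit d ∈ G) :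
    diagUnit d ∈ M G ⊔ expGroup (𝔞 F) := by
  have hpos : ∀ i, 0 < ‖(d i : F)‖ := fun i => norm_pos_iff.2 (d i).ne_zero
  have hprod : ∏ i, ‖(d i : F)‖ = 1 := by
    have h := D.norm_δ_diagUnit d
    rw [(D.mem_iff _).1 hd, norm_one] at h
    exact (pow_eq_one_iff_of_nonneg (Finset.prod_nonneg fun i _ => (hpos i).le) D.k_ne_zero).1
      h.symm
  set x : Fin 3 → ℝ := fun i => Real.log ‖(d i : F)‖ with hx
  have hsum : ∑ i, x i = 0 := by
    rw [hx, ← Real.log_prod (fun i _ => (hpos i).ne'), hprod, Real.log_one]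
  have hx𝔞 : realDiag F x ∈ 𝔞 F := ⟨x, hsum, rfl⟩
  have ha : expUnit (realDiag F x) ∈ expGroup (𝔞 F) := Subgroup.subset_closure ⟨_, hx𝔞, rfl⟩
  have hae : (expUnit (realDiag F x) : Mat F) = realDiag F fun i => ‖(d i : F)‖ := by
    change NormedSpace.exp _ = _
    rw [exp_realDiag]
    congr 1
    funext i
    exact Real.exp_log (hpos i)
  have haG := D.realDiag_expUnit_mem (F := F) hsum
  -- the unit part of `d`
  let r : Fin 3 → Fˣ := fun i =>
    Units.map (algebraMap ℝ F : ℝ →* F) (Units.mk0 ‖(d i : F)‖ (hpos i).ne')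
  have hr : expUnit (realDiag F x) = diagUnit r := Units.ext hae
  have hm : diagUnit d * (diagUnit r)⁻¹ ∈ M G := by
    have hmG : diagUnit d * (diagUnit r)⁻¹ ∈ G := mul_mem hd (inv_mem (hr ▸ haG))
    have hme : (diagUnit d * (diagUnit r)⁻¹ : GL3 F) = diagUnit fun i => d i * (r i)⁻¹ := by
      ext1
      change Matrix.diagonal _ * Matrix.diagonal _ = Matrix.diagonal _
      rw [Matrix.diagonal_mul_diagonal]
      rfl
    refine ⟨⟨hmG, ?_⟩, ?_⟩
    · change star (diagUnit d * (diagUnit r)⁻¹)⁻¹ = diagUnit d * (diagUnit r)⁻¹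
      rw [star_inv, inv_eq_iff_mul_eq_one, hme]
      ext1
      rw [Units.val_mul, Units.coe_star, Matrix.star_eq_conjTranspose]
      change (Matrix.diagonal _).conjTranspose * Matrix.diagonal _ = 1
      rw [Matrix.diagonal_conjTranspose, Matrix.diagonal_mul_diagonal, ← Matrix.diagonal_one]
      congr 1
      funext i
      change star ((d i : F) * ((r i)⁻¹ : Fˣ)) * ((d i : F) * ((r i)⁻¹ : Fˣ)) = 1
      rw [star_mul_self_eq, norm_mul, Units.val_inv_eq_inv_val, norm_inv]
      have : ‖(r i : F)‖ = ‖(d i : F)‖ := by simp [r]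
      rw [this, mul_inv_cancel₀ (hpos i).ne', one_pow, map_one]
    · rintro _ ⟨y, hy, rfl⟩
      rw [hme]
      change Matrix.diagonal _ * Matrix.diagonal _ = Matrix.diagonal _ * Matrix.diagonal _
      rw [Matrix.diagonal_mul_diagonal, Matrix.diagonal_mul_diagonal]
      congr 1
      funext i
      exact (Algebra.commutes _ _).symm
  have h := mul_mem (Subgroup.mem_sup_left (T := expGroup (𝔞 F)) hm)
    (Subgroup.mem_sup_right (S := M G) (hr ▸ ha))
  rwa [inv_mul_cancel_right] at h

/-- The subgroup `M A N` consists of the upper triangular matrices. -/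
theorem stdMinimalParabolic_eq : stdMinimalParabolic G = par G flagShape := by
  have hN : rootSpaceSum G (posSystem 0) = nil F flagShape := by
    refine D.rootSpaceSum_eq_nil fun r => ?_
    obtain ⟨i, j⟩ := r
    fin_cases i <;> fin_cases j <;> simp [posSystem]
  rw [stdMinimalParabolic, hN]
  apply le_antisymm
  · exact sup_le (sup_le (M_le_par _) (D.expGroup_𝔞_le_par _)) (D.expGroup_nil_le_par _)
  · intro g hg
    have hl := D.leviPart_mem hg
    have hu : (leviPart hg.2)⁻¹ * g ∈ expGroup (nil F flagShape : Set (Mat F)) :=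
      mem_expGroup_nil.2 (leviPart_inv_mul_sub_one hg.2)
    have hinj : ∀ i j : Fin 3, flagShape i = flagShape j → i = j := by decide
    have hdiag : ∀ X : Mat F, blockDiagPart flagShape X = Matrix.diagonal fun i => X i i := by
      intro X
      ext i j
      rw [blockDiagPart_apply]
      by_cases h : i = j
      · simp [h]
      · rw [if_neg fun h' => h (hinj i j h'), Matrix.diagonal_apply_ne _ h]
    have hd : ∀ i, (g : Mat F) i i * ((g⁻¹ : GL3 F) : Mat F) i i = 1 ∧
        ((g⁻¹ : GL3 F) : Mat F) i i * (g : Mat F) i i = 1 := by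
      intro i
      have h1 : blockDiagPart flagShape (g : Mat F) *
          blockDiagPart flagShape ((g⁻¹ : GL3 F) : Mat F) = 1 := (leviPart hg.2).val_inv
      have h2 : blockDiagPart flagShape ((g⁻¹ : GL3 F) : Mat F) *
          blockDiagPart flagShape (g : Mat F) = 1 := (leviPart hg.2).inv_val
      rw [hdiag, hdiag, Matrix.diagonal_mul_diagonal, ← Matrix.diagonal_one,
        Matrix.diagonal_eq_diagonal_iff] at h1 h2
      exact ⟨h1 i, h2 i⟩
    have hle : leviPart hg.2 = diagUnit fun i =>
        ⟨(g : Mat F) i i, ((g⁻¹ : GL3 F) : Mat F) i i, (hd i).1, (hd i).2⟩ :=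
      Units.ext (hdiag _)
    have h1 : leviPart hg.2 ∈ M G ⊔ expGroup (𝔞 F) := by
      rw [hle] at hl ⊢
      exact D.diagUnit_mem_sup hl
    have h := mul_mem (Subgroup.mem_sup_left (T := expGroup (nil F flagShape : Set (Mat F))) h1)
      (Subgroup.mem_sup_right (S := M G ⊔ expGroup (𝔞 F)) hu)
    rwa [mul_inv_cancel_left] at h

/-- The parabolic subgroups are the conjugates of four standard ones. -/
theorem isParabolic_iff {P : Subgroup (GL3 F)} :
    IsParabolic G P ↔ ∃ g ∈ G, P = conj g (par G flagShape) ∨ P = conj g (par G lineShape) ∨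
      P = conj g (par G planeShape) ∨ P = G := by
  have hGconj : ∀ g ∈ G, conj g G = G := fun g hg => conj_eq_self hg
  constructor
  · rintro ⟨hPG, B, hBP, g, hg, rfl⟩
    rw [D.stdMinimalParabolic_eq, conj_le_iff] at hBP
    have hle : conj g⁻¹ P ≤ G := by
      have := conj_mono (g := g⁻¹) hPG
      rwa [hGconj _ (inv_mem hg)] at this
    have hP : P = conj g (conj g⁻¹ P) := by rw [conj_conj, mul_inv_cancel, conj_one]
    refine ⟨g, hg, ?_⟩
    rcases D.eq_par_of_par_flag_le hBP hle with h | h | h | h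
    · exact Or.inl (by rw [← h, ← hP])
    · exact Or.inr (Or.inl (by rw [← h, ← hP]))
    · exact Or.inr (Or.inr (Or.inl (by rw [← h, ← hP])))
    · exact Or.inr (Or.inr (Or.inr (by rw [hP, h, hGconj g hg])))
  · rintro ⟨g, hg, h⟩
    have hP : P = conj g (par G flagShape) ∨ P = conj g (par G lineShape) ∨
      P = conj g (par G planeShape) ∨ P = conj g G := by rwa [hGconj g hg]
    obtain ⟨Q, hQ1, hQ2, rfl⟩ : ∃ Q, par G flagShape ≤ Q ∧ Q ≤ G ∧ P = conj g Q := by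
      rcases hP with h | h | h | h
      · exact ⟨_, le_rfl, par_le _, h⟩
      · exact ⟨_, par_flag_le_line, par_le _, h⟩
      · exact ⟨_, par_flag_le_plane, par_le _, h⟩
      · exact ⟨_, par_le _, le_rfl, h⟩
    refine ⟨(conj_mono hQ2).trans (hGconj g hg).le, conj g (par G flagShape), conj_mono hQ1, g, hg,
      by rw [D.stdMinimalParabolic_eq]⟩

end Determinant

end

/-! ### `σ`-parabolic subgroups and the hermitian form -/

section

variable {F : Type} [NormedDivisionRing F]

theorem coe_signature_apply (i j : Fin 3) :
    (signature F : Mat F) i j = if i = j then ![1, -1, -1] i else 0 := Matrix.diagonal_apply ..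

theorem mul_single_mul_apply (X Y : Mat F) (k l i j : Fin 3) (c : F) :
    (X * Matrix.single k l c * Y) i j = X i k * c * Y l j := by
  rw [Matrix.mul_assoc, Matrix.mul_apply, Finset.sum_eq_single k]
  · rw [Matrix.single_mul_apply_same, mul_assoc]
  · intro m _ hm
    rw [Matrix.single_mul_apply_of_ne _ _ _ _ _ hm, mul_zero]
  · simp

theorem exists_mul_add_mul_eq_zero (a c : F) : ∃ x y : F, (x ≠ 0 ∨ y ≠ 0) ∧ a * x + c * y = 0 := by
  by_cases ha : a = 0
  · exact ⟨1, 0, by simp, by simp [ha]⟩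
  · exact ⟨-a⁻¹ * c, 1, by simp, by rw [neg_mul, mul_neg, mul_inv_cancel_left₀ ha]; simp⟩

variable [StarRing F]

/-- The Gram matrix of the columns of `g` for the hermitian form `x† D y`. -/
def gram (g : GL3 F) : GL3 F := star g * signature F * g

theorem star_gram (g : GL3 F) : star (gram g) = gram g := by
  simp only [gram, star_mul, star_star, star_signature, mul_assoc]

theorem gram_mul (g h : GL3 F) : gram (g * h) = star h * gram g * h := by
  simp only [gram, star_mul, mul_assoc]

theorem star_gram_apply (g : GL3 F) (i j : Fin 3) :
    star ((gram g : Mat F) i j) = (gram g : Mat F) j i := by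
  have h := congrArg (fun u : GL3 F => (u : Mat F) j i) (star_gram g)
  rwa [Units.coe_star, Matrix.star_apply] at h

theorem star_gram_inv_apply (g : GL3 F) (i j : Fin 3) :
    star ((((gram g)⁻¹ : GL3 F) : Mat F) i j) = (((gram g)⁻¹ : GL3 F) : Mat F) j i := by
  have h := congrArg (fun u : GL3 F => ((u⁻¹ : GL3 F) : Mat F) j i) (star_gram g)
  simp only [← star_inv] at h
  rwa [Units.coe_star, Matrix.star_apply] at h

theorem star_single (i j : Fin 3) (c : F) :
    star (Matrix.single i j c : Mat F) = Matrix.single j i (star c) :=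
  Matrix.conjTranspose_single _ _ _

end

section

variable {F : Type} [NormedDivisionRing F] [NormedAlgebra ℝ F] [StarRing F] [IsRCH F]
  {G : Subgroup (GL3 F)}

namespace Determinant

variable (D : Determinant G)
include D

theorem map_sigma_par_le (b : Fin 3 → Fin 3) :
    (par G b).map (sigma F) ≤ par G fun i => (b i).rev := by
  rintro _ ⟨x, hx, rfl⟩
  refine ⟨D.sigma_mem hx.1, fun i j hij => ?_⟩
  have h := blockTriangular_inv hx.2 (Fin.rev_lt_rev.1 hij)
  rw [sigma_apply, Units.val_mul, Units.val_mul, coe_signature, Matrix.mul_diagonal,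
    Matrix.diagonal_mul, Units.coe_star, Matrix.star_apply, h, star_zero, mul_zero, zero_mul]

theorem map_sigma_par (b : Fin 3 → Fin 3) :
    (par G b).map (sigma F) = par G fun i => (b i).rev := by
  refine le_antisymm (D.map_sigma_par_le b) fun x hx => ?_
  have h := D.map_sigma_par_le (fun i => (b i).rev) ⟨x, hx, rfl⟩
  simp only [Fin.rev_rev] at h
  exact ⟨_, h, sigma_sigma x⟩

theorem isLevi_par {b : Fin 3 → Fin 3} (hb : ∃ i j, b i ≠ b j) :
    IsLevi (par G b) (par G (fun i => (b i).rev) ⊓ par G b) := by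
  constructor
  · apply le_antisymm
    · refine sup_le inf_le_right fun u hu => D.expGroup_nil_le_par b ?_
      rwa [mem_expGroup_nil, ← D.mem_unipotentRadical_par hb]
    · intro g hg
      have hl : leviPart hg.2 ∈ par G (fun i => (b i).rev) ⊓ par G b := by
        refine ⟨⟨D.leviPart_mem hg, fun i j hij => ?_⟩, D.leviPart_mem hg,
          blockTriangular_blockDiagPart b _⟩
        exact if_neg (Fin.rev_lt_rev.1 hij).ne
      have hu := (D.mem_unipotentRadical_par hb).2 (leviPart_inv_mul_sub_one hg.2)
      have h := mul_mem (Subgroup.mem_sup_left (T := unipotentRadical (par G b)) hl)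
        (Subgroup.mem_sup_right (S := par G (fun i => (b i).rev) ⊓ par G b) hu)
      rwa [mul_inv_cancel_left] at h
  · rw [eq_bot_iff]
    rintro u ⟨⟨hu1, -⟩, hu2⟩
    have hu2 := (D.mem_unipotentRadical_par hb).1 hu2
    rw [Subgroup.mem_bot]
    ext i j
    rw [Units.val_one, ← sub_eq_zero, ← Matrix.sub_apply]
    by_cases hij : b j ≤ b i
    · exact hu2 i j hij
    · rw [Matrix.sub_apply, hu1.2 (Fin.rev_lt_rev.2 (not_le.1 hij)), Matrix.one_apply_ne, sub_zero]
      rintro rfl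
      exact hij le_rfl

/-- The conjugates of the block triangular subgroups by elements of `G^σ` are `σ`-parabolic. -/
theorem isSigmaParabolic_conj_par {b : Fin 3 → Fin 3} (hb : ∃ i j, b i ≠ b j) {h : GL3 F}
    (hσ : sigma F h = h) (hP : IsParabolic G (conj h (par G b))) :
    IsSigmaParabolic G (conj h (par G b)) := by
  have hmap : (conj h (par G b)).map (sigma F) = conj h (par G fun i => (b i).rev) := by
    rw [← D.map_sigma_par b, conj, conj, Subgroup.map_map, Subgroup.map_map]
    congr 1
    ext1 x
    change sigma F (h * x * h⁻¹) = h * sigma F x * h⁻¹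
    rw [map_mul, map_mul, map_inv, hσ]
  refine ⟨hP, ?_⟩
  rw [hmap]
  have hinf : ∀ A B : Subgroup (GL3 F), conj h A ⊓ conj h B = conj h (A ⊓ B) := fun A B =>
    (Subgroup.map_inf _ _ _ (MulAut.conj h).injective).symm
  have hb' : ∃ i j, (b i).rev ≠ (b j).rev := by
    obtain ⟨i, j, hij⟩ := hb
    exact ⟨i, j, fun h => hij (Fin.rev_injective h)⟩
  rw [AreOpposite, hinf]
  refine ⟨(isDifferential_conj h).isLevi_map ?_, (isDifferential_conj h).isLevi_map
    (D.isLevi_par hb)⟩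
  have h1 := D.isLevi_par hb'
  simp only [Fin.rev_rev] at h1
  rwa [inf_comm] at h1

/-- If `g P g⁻¹` is `σ`-parabolic for a block triangular subgroup `P`, then no nontrivial
unipotent element of `P` is mapped into `P` by the conjugate of `σ` by `g`. -/
theorem eq_zero_of_isSigmaParabolic {b : Fin 3 → Fin 3} (hb : ∃ i j, b i ≠ b j) {g : GL3 F}
    (hg : IsSigmaParabolic G (conj g (par G b))) {N : Mat F} (hN : N ∈ nil F b)
    (h : BlockTriangular (((gram g)⁻¹ : GL3 F) * star N * gram g : Mat F) b) : N = 0 := by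
  have hu : oneAddNil hN ∈ unipotentRadical (par G b) := by
    rw [D.mem_unipotentRadical_par hb]
    change 1 + N - 1 ∈ nil F b
    rwa [add_sub_cancel_left]
  set u := oneAddNil hN with hudef
  have huG : u ∈ G := D.oneAddNil_mem hN
  have hv : (gram g)⁻¹ * star u * gram g ∈ par G b := by
    refine ⟨?_, ?_⟩
    · have := D.conj_mem (gram g)⁻¹ (D.star_mem huG)
      rwa [inv_inv] at this
    · rw [Units.val_mul, Units.val_mul, Units.coe_star]
      change BlockTriangular (((gram g)⁻¹ : GL3 F) * star (1 + N) * gram g : Mat F) b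
      rw [star_add, star_one, mul_add, mul_one, add_mul, Units.inv_mul]
      exact Matrix.blockTriangular_one.add h
  have h1 : g * u * g⁻¹ ∈ unipotentRadical (conj g (par G b)) := by
    have := (isDifferential_conj g).unipotentRadical_map (par G b)
    rw [conj, this]
    exact ⟨u, hu, rfl⟩
  have h2 : g * u * g⁻¹ ∈ conj g (par G b) := by
    rw [mem_conj, show g⁻¹ * (g * u * g⁻¹) * g = u by group]
    exact ⟨huG, Matrix.blockTriangular_one.add (blockTriangular_of_mem_nil hN)⟩
  have h3 : g * u * g⁻¹ ∈ (conj g (par G b)).map (sigma F) := by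
    refine ⟨sigma F (g * u * g⁻¹), ?_, sigma_sigma _⟩
    rw [SetLike.mem_coe, mem_conj]
    have h4 : g⁻¹ * sigma F (g * u * g⁻¹) * g = ((gram g)⁻¹ * star u * gram g)⁻¹ := by
      simp only [sigma_apply, gram, mul_inv_rev, star_mul, star_inv, inv_inv, inv_signature]
      group
    rw [h4]
    exact inv_mem hv
  have h5 : g * u * g⁻¹ ∈ (⊥ : Subgroup (GL3 F)) := by
    rw [← hg.2.2.2]
    exact ⟨⟨h3, h2⟩, h1⟩
  rw [Subgroup.mem_bot, conj_eq_one_iff] at h5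
  have h6 : (1 : Mat F) + N = 1 := congrArg Units.val h5
  simpa using h6

theorem gram_apply_ne_zero_of_line {g : GL3 F}
    (hg : IsSigmaParabolic G (conj g (par G lineShape))) : (gram g : Mat F) 0 0 ≠ 0 := by
  intro h0
  have h := D.eq_zero_of_isSigmaParabolic ⟨0, 1, by decide⟩ hg
    (single_mem_nil (i := 0) (j := 1) (by decide) 1) (by
      rw [star_single, blockTriangular_line_iff, mul_single_mul_apply, mul_single_mul_apply, h0]
      simp)
  have := congrFun (congrFun h 0) 1
  simp at this

theorem gram_inv_apply_ne_zero_of_plane {g : GL3 F}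
    (hg : IsSigmaParabolic G (conj g (par G planeShape))) :
    (((gram g)⁻¹ : GL3 F) : Mat F) 2 2 ≠ 0 := by
  intro h0
  have h := D.eq_zero_of_isSigmaParabolic ⟨0, 2, by decide⟩ hg
    (single_mem_nil (i := 0) (j := 2) (by decide) 1) (by
      rw [star_single, blockTriangular_plane_iff, mul_single_mul_apply, mul_single_mul_apply, h0]
      simp)
  have := congrFun (congrFun h 0) 2
  simp at this

theorem gram_apply_ne_zero_of_flag {g : GL3 F}
    (hg : IsSigmaParabolic G (conj g (par G flagShape))) : (gram g : Mat F) 0 0 ≠ 0 := by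
  intro h0
  obtain ⟨x, y, hxy, h1⟩ := exists_mul_add_mul_eq_zero ((((gram g)⁻¹ : GL3 F) : Mat F) 2 1)
    ((((gram g)⁻¹ : GL3 F) : Mat F) 2 2)
  have h := D.eq_zero_of_isSigmaParabolic ⟨0, 1, by decide⟩ hg
    (add_mem (single_mem_nil (i := 0) (j := 1) (by decide) (star x))
      (single_mem_nil (i := 0) (j := 2) (by decide) (star y))) (by
      rw [star_add, star_single, star_single, mul_add, add_mul, blockTriangular_flag_iff,
        blockTriangular_line_iff, blockTriangular_plane_iff]
      simp only [Matrix.add_apply, mul_single_mul_apply, h0, star_star, ← add_mul, h1]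
      simp)
  have h2 := congrFun (congrFun h 0) 1
  have h3 := congrFun (congrFun h 0) 2
  simp at h2 h3
  simp [h2, h3] at hxy

theorem gram_inv_apply_ne_zero_of_flag {g : GL3 F}
    (hg : IsSigmaParabolic G (conj g (par G flagShape))) :
    (((gram g)⁻¹ : GL3 F) : Mat F) 2 2 ≠ 0 := by
  intro h0
  obtain ⟨x, y, hxy, h1⟩ := exists_mul_add_mul_eq_zero ((gram g : Mat F) 0 0)
    ((gram g : Mat F) 0 1)
  have h1' : star x * (gram g : Mat F) 0 0 + star y * (gram g : Mat F) 1 0 = 0 := by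
    have := congrArg star h1
    rwa [star_add, star_mul, star_mul, star_gram_apply, star_gram_apply, star_zero] at this
  have h := D.eq_zero_of_isSigmaParabolic ⟨0, 1, by decide⟩ hg
    (add_mem (single_mem_nil (i := 0) (j := 2) (by decide) x)
      (single_mem_nil (i := 1) (j := 2) (by decide) y)) (by
      rw [star_add, star_single, star_single, mul_add, add_mul, blockTriangular_flag_iff,
        blockTriangular_line_iff, blockTriangular_plane_iff]
      simp only [Matrix.add_apply, mul_single_mul_apply, h0]
      simp only [mul_assoc, ← mul_add, h1']
      simp)
  have h2 := congrFun (congrFun h 0) 2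
  have h3 := congrFun (congrFun h 1) 2
  simp at h2 h3
  simp [h2, h3] at hxy

end Determinant

end

/-! ### The identity component of `G^σ` -/

section

variable {F : Type} [NormedDivisionRing F] [StarRing F]
  {G : Subgroup (GL3 F)}

theorem mem_fixedBy_sigma {g : GL3 F} :
    g ∈ fixedBy G (sigma F) ↔ g ∈ G ∧ gram g = signature F := by
  rw [gram, ← sigma_eq_self_iff]
  rfl

theorem H_le_fixedBy : H G ≤ fixedBy G (sigma F) := by
  rintro _ ⟨x, -, rfl⟩
  exact x.2

theorem mem_H_of_path {γ : ℝ → GL3 F} (hγ : Continuous γ) (h0 : γ 0 = 1)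
    (hmem : ∀ t, γ t ∈ fixedBy G (sigma F)) (t : ℝ) : γ t ∈ H G := by
  let γ' : ℝ → fixedBy G (sigma F) := fun t => ⟨γ t, hmem t⟩
  have hγ' : Continuous γ' := hγ.subtype_mk _
  have h1 : (1 : fixedBy G (sigma F)) ∈ Set.range γ' := ⟨0, Subtype.ext h0⟩
  exact ⟨γ' t, (isPreconnected_range hγ').subset_connectedComponent h1 ⟨t, rfl⟩, rfl⟩

theorem gram_apply (g : GL3 F) (i j : Fin 3) : (gram g : Mat F) i j =
    star ((g : Mat F) 0 i) * (g : Mat F) 0 j - star ((g : Mat F) 1 i) * (g : Mat F) 1 j -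
      star ((g : Mat F) 2 i) * (g : Mat F) 2 j := by
  rw [gram, Units.val_mul, Units.val_mul, Units.coe_star, coe_signature, Matrix.mul_apply,
    Fin.sum_univ_three, Matrix.mul_diagonal, Matrix.mul_diagonal, Matrix.mul_diagonal]
  simp [Matrix.star_apply, sub_eq_add_neg]

end

section

variable {F : Type} [NormedDivisionRing F] [NormedAlgebra ℝ F]

/-- Two coordinates can be rotated such that the second one vanishes. -/
theorem exists_rotation_parameters (b c : F) : ∃ v : Fˣ, ‖(v : F)‖ = 1 ∧ ∃ t : ℝ,
    algebraMap ℝ F (Real.sin t) * (v⁻¹ : Fˣ) * b + algebraMap ℝ F (Real.cos t) * c = 0 := by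
  by_cases hb : b = 0
  · exact ⟨1, by simp, Real.pi / 2, by simp [hb]⟩
  by_cases hc : c = 0
  · exact ⟨1, by simp, 0, by simp [hc]⟩
  have hb' : ‖b‖ ≠ 0 := norm_ne_zero_iff.2 hb
  have hc' : ‖c‖ ≠ 0 := norm_ne_zero_iff.2 hc
  -- the phase for which `v⁻¹ b` is a positive multiple of `c`
  let x : F := algebraMap ℝ F (‖c‖ / ‖b‖) * (b * c⁻¹)
  have hr : ‖c‖ / ‖b‖ ≠ 0 := div_ne_zero hc' hb'
  have hx : x ≠ 0 := mul_ne_zero (by simpa using ⟨hc, hb⟩) (mul_ne_zero hb (inv_ne_zero hc))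
  have hx1 : ‖x‖ = 1 := by
    simp only [x, norm_mul, norm_algebraMap', norm_div, norm_norm, norm_inv]
    field_simp
  refine ⟨Units.mk0 x hx, hx1, -Real.arctan (‖c‖ / ‖b‖), ?_⟩
  have h1 : ((Units.mk0 x hx)⁻¹ : Fˣ) * b = algebraMap ℝ F (‖b‖ / ‖c‖) * c := by
    rw [Units.val_inv_eq_inv_val, Units.val_mk0, inv_mul_eq_iff_eq_mul₀ hx]
    simp only [x]
    rw [mul_assoc, ← mul_assoc (b * c⁻¹), ← Algebra.commutes, mul_assoc, inv_mul_cancel_right₀ hc,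
      ← mul_assoc, ← map_mul]
    have : ‖c‖ / ‖b‖ * (‖b‖ / ‖c‖) = 1 := by field_simp
    rw [this, map_one, one_mul]
  rw [mul_assoc, h1, ← mul_assoc, ← map_mul, ← add_mul, ← map_add]
  have h2 : Real.sin (-Real.arctan (‖c‖ / ‖b‖)) * (‖b‖ / ‖c‖) +
      Real.cos (-Real.arctan (‖c‖ / ‖b‖)) = 0 := by
    have h3 := Real.tan_arctan (‖c‖ / ‖b‖)
    rw [Real.tan_eq_sin_div_cos, div_eq_iff (Real.cos_arctan_pos _).ne'] at h3
    rw [Real.sin_neg, Real.cos_neg, h3]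
    field_simp
    ring
  rw [h2, map_zero, zero_mul]

/-- A timelike vector can be boosted such that the second coordinate vanishes. -/
theorem exists_boost_parameters {a b : F} (hab : ‖b‖ < ‖a‖) : ∃ v : Fˣ, ‖(v : F)‖ = 1 ∧ ∃ t : ℝ,
    v * algebraMap ℝ F (Real.sinh t) * a + algebraMap ℝ F (Real.cosh t) * b = 0 := by
  by_cases hb : b = 0
  · exact ⟨1, by simp, 0, by simp [hb]⟩
  have hb' : 0 < ‖b‖ := norm_pos_iff.2 hb
  have ha' : 0 < ‖a‖ := hb'.trans hab
  have ha : a ≠ 0 := norm_pos_iff.1 ha'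
  -- the phase for which `v a` is a negative multiple of `b`
  let x : F := algebraMap ℝ F (-(‖a‖ / ‖b‖)) * (b * a⁻¹)
  have hx : x ≠ 0 := mul_ne_zero (by simpa using ⟨ha, hb⟩) (mul_ne_zero hb (inv_ne_zero ha))
  have hx1 : ‖x‖ = 1 := by
    simp only [x, norm_mul, norm_algebraMap', norm_neg, norm_div, norm_norm, norm_inv]
    field_simp
  set s := Real.sqrt (‖a‖ ^ 2 - ‖b‖ ^ 2) with hs
  have hs2 : s ^ 2 = ‖a‖ ^ 2 - ‖b‖ ^ 2 := Real.sq_sqrt (by nlinarith)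
  have hspos : 0 < s := Real.sqrt_pos.2 (by nlinarith)
  refine ⟨Units.mk0 x hx, hx1, Real.arsinh (‖b‖ / s), ?_⟩
  have hcosh : Real.cosh (Real.arsinh (‖b‖ / s)) = ‖a‖ / s := by
    rw [Real.cosh_arsinh]
    rw [Real.sqrt_eq_iff_mul_self_eq (by positivity) (by positivity)]
    field_simp
    linarith
  rw [Real.sinh_arsinh, hcosh, Units.val_mk0, ← Algebra.commutes, mul_assoc]
  have h1 : x * a = algebraMap ℝ F (-(‖a‖ / ‖b‖)) * b := by
    simp only [x]
    rw [mul_assoc, inv_mul_cancel_right₀ ha]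
  rw [h1, ← mul_assoc, ← map_mul, ← add_mul, ← map_add]
  have h2 : ‖b‖ / s * -(‖a‖ / ‖b‖) + ‖a‖ / s = 0 := by field_simp; ring
  rw [h2, map_zero, zero_mul]

end

section

variable {F : Type} [NormedDivisionRing F] [NormedAlgebra ℝ F] [StarRing F] [IsRCH F]
  {G : Subgroup (GL3 F)}

/-- A one-parameter group of real matrices as a family of invertible matrices over `F`. -/
def oneParamUnit (F : Type) [NormedDivisionRing F] [NormedAlgebra ℝ F]
    (A : ℝ → Matrix (Fin 3) (Fin 3) ℝ) (hadd : ∀ s t, A (s + t) = A s * A t)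
    (h0 : A 0 = 1) (t : ℝ) : GL3 F where
  val := (A t).map (algebraMap ℝ F)
  inv := (A (-t)).map (algebraMap ℝ F)
  val_inv := by
    rw [← RingHom.mapMatrix_apply, ← RingHom.mapMatrix_apply, ← map_mul, ← hadd, add_neg_cancel,
      h0, map_one]
  inv_val := by
    rw [← RingHom.mapMatrix_apply, ← RingHom.mapMatrix_apply, ← map_mul, ← hadd, neg_add_cancel,
      h0, map_one]

theorem gram_diagUnit {d : Fin 3 → Fˣ} (hd : ∀ i, ‖(d i : F)‖ = 1) :
    gram (diagUnit d) = signature F := by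
  ext1
  rw [gram, Units.val_mul, Units.val_mul, Units.coe_star, coe_signature,
    Matrix.star_eq_conjTranspose]
  change (Matrix.diagonal _).conjTranspose * _ * Matrix.diagonal _ = _
  rw [Matrix.diagonal_conjTranspose, Matrix.diagonal_mul_diagonal, Matrix.diagonal_mul_diagonal]
  congr 1
  funext i
  have h := star_mul_self_eq (d i : F)
  rw [hd, one_pow, map_one] at h
  fin_cases i <;> simpa using h

namespace Determinant

variable (D : Determinant G)
include D

/-- The conjugates by unitary diagonal matrices of a real one-parameter group that preserves the
hermitian form belong to `H`. That they have determinant one follows from the fact that the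
one-parameter group is conjugate to its inverse. -/
theorem conj_oneParamUnit_mem_H {A : ℝ → Matrix (Fin 3) (Fin 3) ℝ} (hA : Continuous A)
    (hadd : ∀ s t, A (s + t) = A s * A t) (h0 : A 0 = 1)
    (hneg : ∀ t, A (-t) = Matrix.diagonal ![1, -1, 1] * A t * Matrix.diagonal ![1, -1, 1])
    (hD : ∀ t, (A t).transpose * Matrix.diagonal ![1, -1, -1] * A t = Matrix.diagonal ![1, -1, -1])
    {d : Fin 3 → Fˣ} (hd : ∀ i, ‖(d i : F)‖ = 1) (t : ℝ) :
    diagUnit d * oneParamUnit F A hadd h0 t * (diagUnit d)⁻¹ ∈ H G := by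
  have hAF : Continuous fun t => (A t).map (algebraMap ℝ F) :=
    hA.matrix_map (algebraMapCLM ℝ F).continuous
  have hcont : Continuous (oneParamUnit F A hadd h0) := by
    rw [Units.continuous_iff]
    exact ⟨hAF, hAF.comp continuous_neg⟩
  have hsq : ∀ t, oneParamUnit F A hadd h0 t = oneParamUnit F A hadd h0 (t / 2) *
      oneParamUnit F A hadd h0 (t / 2) := fun t => by
    ext1
    change (A t).map (algebraMap ℝ F) =
      (A (t / 2)).map (algebraMap ℝ F) * (A (t / 2)).map (algebraMap ℝ F)
    rw [← RingHom.mapMatrix_apply, ← RingHom.mapMatrix_apply, ← map_mul, ← hadd, add_halves]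
  have hinv : ∀ t, D.δ (oneParamUnit F A hadd h0 t : Mat F) *
      D.δ (oneParamUnit F A hadd h0 t : Mat F) = 1 := by
    intro t
    let E : GL3 F := diagUnit ![1, -1, 1]
    have hE : (E : Mat F) = (Matrix.diagonal ![1, -1, 1] : Matrix _ _ ℝ).map (algebraMap ℝ F) := by
      rw [Matrix.diagonal_map (map_zero _)]
      change Matrix.diagonal _ = _
      congr 1
      funext i
      fin_cases i <;> simp
    have hE' : (E⁻¹ : GL3 F) = E := by
      refine inv_eq_of_mul_eq_one_right (Units.ext ?_)
      rw [Units.val_mul, hE, ← RingHom.mapMatrix_apply, ← map_mul, Matrix.diagonal_mul_diagonal,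
        Units.val_one, ← map_one (algebraMap ℝ F).mapMatrix, ← Matrix.diagonal_one]
      congr 2
      funext i
      fin_cases i <;> simp
    have h1 : (((oneParamUnit F A hadd h0 t)⁻¹ : GL3 F) : Mat F) =
        E * oneParamUnit F A hadd h0 t * (E⁻¹ : GL3 F) := by
      rw [hE', hE]
      change (A (-t)).map (algebraMap ℝ F) = _ * (A t).map (algebraMap ℝ F) * _
      simp only [← RingHom.mapMatrix_apply, ← map_mul]
      rw [hneg]
    have h2 := congrArg D.δ h1
    rw [D.δ_conj] at h2
    nth_rewrite 1 [← h2]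
    rw [← map_mul, Units.inv_mul, map_one]
  have hG : ∀ t, oneParamUnit F A hadd h0 t ∈ G := fun t => by
    rw [D.mem_iff, hsq, Units.val_mul, map_mul, hinv]
  have hσ : ∀ t, gram (oneParamUnit F A hadd h0 t) = signature F := fun t => by
    ext1
    rw [gram, Units.val_mul, Units.val_mul, Units.coe_star, coe_signature]
    have h1 : (Matrix.diagonal ![1, -1, -1] : Mat F) =
        (Matrix.diagonal ![1, -1, -1] : Matrix _ _ ℝ).map (algebraMap ℝ F) := by
      rw [Matrix.diagonal_map (map_zero _)]
      congr 1
      funext i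
      fin_cases i <;> simp
    have h2 : star (oneParamUnit F A hadd h0 t : Mat F) =
        (A t).transpose.map (algebraMap ℝ F) := by
      ext i j
      exact star_algebraMap_real _
    rw [h1, h2]
    change _ * _ * (A t).map (algebraMap ℝ F) = _
    simp only [← RingHom.mapMatrix_apply, ← map_mul]
    rw [hD]
  refine mem_H_of_path (γ := fun t => diagUnit d * oneParamUnit F A hadd h0 t * (diagUnit d)⁻¹)
    ((continuous_const.mul hcont).mul continuous_const) ?_ (fun t => ?_) t
  · have : oneParamUnit F A hadd h0 0 = 1 := by
      ext1
      change (A 0).map (algebraMap ℝ F) = 1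
      rw [h0, ← RingHom.mapMatrix_apply, map_one]
    rw [this, mul_one, mul_inv_cancel]
  · refine ⟨D.conj_mem _ (hG t), ?_⟩
    have h1 : sigma F (diagUnit d) = diagUnit d := sigma_eq_self_iff.2 (gram_diagUnit hd)
    have h2 := sigma_eq_self_iff.2 (hσ t)
    change sigma F _ = _
    rw [map_mul, map_mul, map_inv, h1, h2]
    rfl

/-- The rotations in the plane of the last two coordinates, with a phase `v`. -/
theorem exists_rotation_mem_H (v : Fˣ) (hv : ‖(v : F)‖ = 1) (t : ℝ) :
    ∃ k ∈ H G, (k : Mat F) = !![1, 0, 0;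
      0, algebraMap ℝ F (Real.cos t), -(v * algebraMap ℝ F (Real.sin t));
      0, algebraMap ℝ F (Real.sin t) * (v⁻¹ : Fˣ), algebraMap ℝ F (Real.cos t)] := by
  let A : ℝ → Matrix (Fin 3) (Fin 3) ℝ := fun t =>
    !![1, 0, 0; 0, Real.cos t, -Real.sin t; 0, Real.sin t, Real.cos t]
  have hA : Continuous A := by
    refine continuous_matrix fun i j => ?_
    fin_cases i <;> fin_cases j <;> simp [A] <;> fun_prop
  have hadd : ∀ s t, A (s + t) = A s * A t := fun s t => by
    ext i j
    fin_cases i <;> fin_cases j <;>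
      simp [A, Matrix.mul_apply, Fin.sum_univ_three, Real.cos_add, Real.sin_add] <;> ring
  have h0 : A 0 = 1 := by
    ext i j
    fin_cases i <;> fin_cases j <;> simp [A]
  have hneg : ∀ t, A (-t) = Matrix.diagonal ![1, -1, 1] * A t * Matrix.diagonal ![1, -1, 1] := by
    intro t
    ext i j
    rw [Matrix.mul_diagonal, Matrix.diagonal_mul]
    fin_cases i <;> fin_cases j <;> simp [A]
  have hD : ∀ t, (A t).transpose * Matrix.diagonal ![1, -1, -1] * A t =
      Matrix.diagonal ![1, -1, -1] := by
    intro t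
    ext i j
    have h := Real.sin_sq_add_cos_sq t
    fin_cases i <;> fin_cases j <;>
      simp [A, Matrix.mul_apply, Fin.sum_univ_three, Matrix.diagonal] <;> linarith
  have h := D.conj_oneParamUnit_mem_H hA hadd h0 hneg hD (d := ![1, v, 1])
    (fun i => by fin_cases i <;> simp [hv]) t
  refine ⟨_, h, ?_⟩
  ext i j
  change (Matrix.diagonal _ * (A t).map (algebraMap ℝ F) * Matrix.diagonal _ : Mat F) i j = _
  rw [Matrix.mul_diagonal, Matrix.diagonal_mul]
  fin_cases i <;> fin_cases j <;> simp [A]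
  rw [← Algebra.commutes, mul_assoc, mul_inv_cancel₀ v.ne_zero, mul_one]

/-- The hyperbolic rotations in the plane of the first two coordinates, with a phase `v`. -/
theorem exists_boost_mem_H (v : Fˣ) (hv : ‖(v : F)‖ = 1) (t : ℝ) :
    ∃ k ∈ H G, (k : Mat F) = !![
      algebraMap ℝ F (Real.cosh t), algebraMap ℝ F (Real.sinh t) * (v⁻¹ : Fˣ), 0;
      v * algebraMap ℝ F (Real.sinh t), algebraMap ℝ F (Real.cosh t), 0;
      0, 0, 1] := by
  let A : ℝ → Matrix (Fin 3) (Fin 3) ℝ := fun t =>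
    !![Real.cosh t, Real.sinh t, 0; Real.sinh t, Real.cosh t, 0; 0, 0, 1]
  have hA : Continuous A := by
    refine continuous_matrix fun i j => ?_
    fin_cases i <;> fin_cases j <;> simp [A] <;> fun_prop
  have hadd : ∀ s t, A (s + t) = A s * A t := fun s t => by
    ext i j
    fin_cases i <;> fin_cases j <;>
      simp [A, Matrix.mul_apply, Fin.sum_univ_three, Real.cosh_add, Real.sinh_add] <;> ring
  have h0 : A 0 = 1 := by
    ext i j
    fin_cases i <;> fin_cases j <;> simp [A]
  have hneg : ∀ t, A (-t) = Matrix.diagonal ![1, -1, 1] * A t * Matrix.diagonal ![1, -1, 1] := by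
    intro t
    ext i j
    rw [Matrix.mul_diagonal, Matrix.diagonal_mul]
    fin_cases i <;> fin_cases j <;> simp [A]
  have hD : ∀ t, (A t).transpose * Matrix.diagonal ![1, -1, -1] * A t =
      Matrix.diagonal ![1, -1, -1] := by
    intro t
    ext i j
    have h := Real.cosh_sq t
    fin_cases i <;> fin_cases j <;>
      simp [A, Matrix.mul_apply, Fin.sum_univ_three, Matrix.diagonal] <;> linarith
  have h := D.conj_oneParamUnit_mem_H hA hadd h0 hneg hD (d := ![1, v, 1])
    (fun i => by fin_cases i <;> simp [hv]) t
  refine ⟨_, h, ?_⟩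
  ext i j
  change (Matrix.diagonal _ * (A t).map (algebraMap ℝ F) * Matrix.diagonal _ : Mat F) i j = _
  rw [Matrix.mul_diagonal, Matrix.diagonal_mul]
  fin_cases i <;> fin_cases j <;> simp [A]
  rw [← Algebra.commutes, mul_assoc, mul_inv_cancel₀ v.ne_zero, mul_one]

end Determinant

theorem gram_apply_self (g : GL3 F) (i : Fin 3) : (gram g : Mat F) i i = algebraMap ℝ F
    (‖(g : Mat F) 0 i‖ ^ 2 - ‖(g : Mat F) 1 i‖ ^ 2 - ‖(g : Mat F) 2 i‖ ^ 2) := by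
  rw [gram_apply, star_mul_self_eq, star_mul_self_eq, star_mul_self_eq, map_sub, map_sub]

namespace Determinant

variable (D : Determinant G)
include D

/-- Every element of `G^σ` is the product of an element of the identity component and a diagonal
matrix. -/
theorem exists_mem_H_mul_diagonal {h : GL3 F} (hh : h ∈ fixedBy G (sigma F)) :
    ∃ k ∈ H G, ∃ d : Fin 3 → F, ((k * h : GL3 F) : Mat F) = Matrix.diagonal d := by
  -- a rotation clears the lower left entry
  obtain ⟨k1, hk1, h20⟩ : ∃ k ∈ H G, ((k * h : GL3 F) : Mat F) 2 0 = 0 := by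
    obtain ⟨v, hv, t, hvt⟩ := exists_rotation_parameters ((h : Mat F) 1 0) ((h : Mat F) 2 0)
    obtain ⟨k, hk, hke⟩ := D.exists_rotation_mem_H v hv t
    refine ⟨k, hk, ?_⟩
    rw [Units.val_mul, hke, Matrix.mul_apply, Fin.sum_univ_three]
    simpa using hvt
  set h1 := k1 * h with h1def
  have hh1 : h1 ∈ fixedBy G (sigma F) := mul_mem (H_le_fixedBy hk1) hh
  -- a boost clears the rest of the first column
  obtain ⟨k2, hk2, h10, h20'⟩ : ∃ k ∈ H G, ((k * h1 : GL3 F) : Mat F) 1 0 = 0 ∧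
      ((k * h1 : GL3 F) : Mat F) 2 0 = 0 := by
    have hlt : ‖(h1 : Mat F) 1 0‖ < ‖(h1 : Mat F) 0 0‖ := by
      have h2 := gram_apply_self h1 0
      rw [(mem_fixedBy_sigma.1 hh1).2, coe_signature_apply, h20, if_pos rfl] at h2
      have h3 : (1 : ℝ) = ‖(h1 : Mat F) 0 0‖ ^ 2 - ‖(h1 : Mat F) 1 0‖ ^ 2 := by
        apply (algebraMap ℝ F).injective
        rw [map_one]
        simpa using h2
      nlinarith [norm_nonneg ((h1 : Mat F) 1 0), norm_nonneg ((h1 : Mat F) 0 0)]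
    obtain ⟨v, hv, t, hvt⟩ := exists_boost_parameters hlt
    obtain ⟨k, hk, hke⟩ := D.exists_boost_mem_H v hv t
    refine ⟨k, hk, ?_, ?_⟩
    · rw [Units.val_mul, hke, Matrix.mul_apply, Fin.sum_univ_three]
      simpa using hvt
    · rw [Units.val_mul, hke, Matrix.mul_apply, Fin.sum_univ_three]
      simp [h20]
  set h2 := k2 * h1 with h2def
  have hh2 : h2 ∈ fixedBy G (sigma F) := mul_mem (H_le_fixedBy hk2) hh1
  -- another rotation clears the entry below the diagonal in the second column
  obtain ⟨k3, hk3, g10, g20, g21⟩ : ∃ k ∈ H G, ((k * h2 : GL3 F) : Mat F) 1 0 = 0 ∧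
      ((k * h2 : GL3 F) : Mat F) 2 0 = 0 ∧ ((k * h2 : GL3 F) : Mat F) 2 1 = 0 := by
    obtain ⟨v, hv, t, hvt⟩ := exists_rotation_parameters ((h2 : Mat F) 1 1) ((h2 : Mat F) 2 1)
    obtain ⟨k, hk, hke⟩ := D.exists_rotation_mem_H v hv t
    refine ⟨k, hk, ?_, ?_, ?_⟩
    · rw [Units.val_mul, hke, Matrix.mul_apply, Fin.sum_univ_three]
      simp [h10, h20']
    · rw [Units.val_mul, hke, Matrix.mul_apply, Fin.sum_univ_three]
      simp [h10, h20']
    · rw [Units.val_mul, hke, Matrix.mul_apply, Fin.sum_univ_three]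
      simpa using hvt
  set h3 := k3 * h2 with h3def
  have hh3 : h3 ∈ fixedBy G (sigma F) := mul_mem (H_le_fixedBy hk3) hh2
  -- an upper triangular matrix that preserves the form is diagonal
  have hgram : ∀ i j, (gram h3 : Mat F) i j = if i = j then ![1, -1, -1] i else 0 := fun i j => by
    rw [(mem_fixedBy_sigma.1 hh3).2, coe_signature_apply]
  have g00 : (h3 : Mat F) 0 0 ≠ 0 := by
    intro g00
    have := hgram 0 0
    rw [gram_apply, g00, g10, g20] at this
    simp at this
  have g01 : (h3 : Mat F) 0 1 = 0 := by
    have := hgram 0 1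
    rw [gram_apply, g10, g20] at this
    simpa [g00] using this
  have g02 : (h3 : Mat F) 0 2 = 0 := by
    have := hgram 0 2
    rw [gram_apply, g10, g20] at this
    simpa [g00] using this
  have g11 : (h3 : Mat F) 1 1 ≠ 0 := by
    intro g11
    have := hgram 1 1
    rw [gram_apply, g01, g11, g21] at this
    simp at this
  have g12 : (h3 : Mat F) 1 2 = 0 := by
    have := hgram 1 2
    rw [gram_apply, g01, g21] at this
    simpa [g11] using this
  refine ⟨k3 * (k2 * k1), mul_mem hk3 (mul_mem hk2 hk1), fun i => (h3 : Mat F) i i, ?_⟩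
  have h4 : k3 * (k2 * k1) * h = h3 := by rw [h3def, h2def, h1def]; group
  rw [h4]
  ext i j
  by_cases hij : i = j
  · simp [hij]
  · rw [Matrix.diagonal_apply_ne _ hij]
    fin_cases i <;> fin_cases j <;>
      first | exact absurd rfl hij | assumption

end Determinant

end

/-! ### Orthogonalization of flags -/

section

variable {F : Type} [NormedDivisionRing F]

/-- Representatives in `SL(3, F)` of three Weyl group elements. The element `weyl F i` maps the
line spanned by the `i`-th basis vector to the line spanned by the first one, which is the positive
line of the hermitian form. -/
def weyl (F : Type) [NormedDivisionRing F] (i : Fin 3) : GL3 F where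
  val := ![1, !![0, -1, 0; 1, 0, 0; 0, 0, 1], !![0, 0, 1; 1, 0, 0; 0, 1, 0]] i
  inv := ![1, !![0, 1, 0; -1, 0, 0; 0, 0, 1], !![0, 1, 0; 0, 0, 1; 1, 0, 0]] i
  val_inv := by
    ext j k
    fin_cases i <;> fin_cases j <;> fin_cases k <;> simp [Matrix.mul_apply, Fin.sum_univ_three]
  inv_val := by
    ext j k
    fin_cases i <;> fin_cases j <;> fin_cases k <;> simp [Matrix.mul_apply, Fin.sum_univ_three]

theorem coe_weyl (i : Fin 3) : (weyl F i : Mat F) =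
    ![1, !![0, -1, 0; 1, 0, 0; 0, 0, 1], !![0, 0, 1; 1, 0, 0; 0, 1, 0]] i := rfl

theorem coe_weyl_inv (i : Fin 3) : (((weyl F i)⁻¹ : GL3 F) : Mat F) =
    ![1, !![0, 1, 0; -1, 0, 0; 0, 0, 1], !![0, 1, 0; 0, 0, 1; 1, 0, 0]] i := rfl

theorem weyl_one_eq : weyl F 1 = transvectionUnit (i := 0) (j := 1) (by decide) (-1) *
    transvectionUnit (i := 1) (j := 0) (by decide) 1 *
    transvectionUnit (i := 0) (j := 1) (by decide) (-1) := by
  ext j k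
  simp only [Units.val_mul, coe_transvectionUnit, coe_weyl]
  fin_cases j <;> fin_cases k <;>
    simp [Matrix.mul_apply, Fin.sum_univ_three, Matrix.one_apply, Matrix.single_apply]

theorem weyl_two_eq : weyl F 2 = weyl F 1 * (transvectionUnit (i := 1) (j := 2) (by decide) (-1) *
    transvectionUnit (i := 2) (j := 1) (by decide) 1 *
    transvectionUnit (i := 1) (j := 2) (by decide) (-1)) := by
  ext j k
  simp only [Units.val_mul, coe_transvectionUnit, coe_weyl]
  fin_cases j <;> fin_cases k <;>
    simp [Matrix.mul_apply, Fin.sum_univ_three, Matrix.one_apply, Matrix.single_apply]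

/-- Conjugation by Weyl group elements preserves the diagonal matrices. -/
theorem weyl_inv_mul_diagonal_mul (i : Fin 3) (d : Fin 3 → F) :
    ∃ e : Fin 3 → F, (((weyl F i)⁻¹ : GL3 F) : Mat F) * Matrix.diagonal d * weyl F i =
      Matrix.diagonal e := by
  refine ⟨![d, ![d 1, d 0, d 2], ![d 1, d 2, d 0]] i, ?_⟩
  rw [coe_weyl, coe_weyl_inv]
  ext j k
  rw [Matrix.mul_apply, Fin.sum_univ_three, Matrix.mul_diagonal, Matrix.mul_diagonal,
    Matrix.mul_diagonal, Matrix.diagonal_apply]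
  fin_cases i <;> fin_cases j <;> fin_cases k <;> simp

variable [StarRing F]

theorem gram_weyl (i : Fin 3) : (gram (weyl F i) : Mat F) =
    Matrix.diagonal fun j => if j = i then 1 else -1 := by
  ext j k
  rw [gram_apply, coe_weyl]
  fin_cases i <;> fin_cases j <;> fin_cases k <;> simp [Matrix.diagonal]

theorem gram_one : gram (1 : GL3 F) = signature F := by simp [gram]

/-- The Gram matrix after adding a multiple of the `i`-th column to the `j`-th column. -/
theorem gram_mul_transvectionUnit_apply (g : GL3 F) {i j : Fin 3} (hij : i ≠ j) (c : F)
    (k l : Fin 3) : (gram (g * transvectionUnit hij c) : Mat F) k l =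
      (gram g : Mat F) k l + (if l = j then (gram g : Mat F) k i * c else 0) +
        (if k = j then star c * ((gram g : Mat F) i l +
          if l = j then (gram g : Mat F) i i * c else 0) else 0) := by
  have h1 : ∀ X : Mat F, ∀ a b : Fin 3, (X * (1 + Matrix.single i j c)) a b =
      X a b + if b = j then X a i * c else 0 := fun X a b => by
    rw [mul_add, mul_one, Matrix.add_apply]
    congr 1
    split_ifs with h
    · rw [h, Matrix.mul_single_apply_same]
    · rw [Matrix.mul_single_apply_of_ne _ _ _ _ _ h]
  have h2 : ∀ X : Mat F, ∀ a b : Fin 3, (star (1 + Matrix.single i j c) * X) a b =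
      X a b + if a = j then star c * X i b else 0 := fun X a b => by
    rw [star_add, star_one, star_single, add_mul, one_mul, Matrix.add_apply]
    congr 1
    split_ifs with h
    · rw [h, Matrix.single_mul_apply_same]
    · rw [Matrix.single_mul_apply_of_ne _ _ _ _ _ h]
  rw [gram_mul, Units.val_mul, Units.val_mul, Units.coe_star, coe_transvectionUnit, mul_assoc, h2,
    h1, h1]

theorem gram_inv_mul_transvectionUnit_apply (g : GL3 F) {i j : Fin 3} (hij : i ≠ j) (c : F)
    {k : Fin 3} (hk : k ≠ i) : (((gram (g * transvectionUnit hij c))⁻¹ : GL3 F) : Mat F) k k =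
      (((gram g)⁻¹ : GL3 F) : Mat F) k k := by
  have h1 : (((transvectionUnit hij c)⁻¹ : GL3 F) : Mat F) = 1 - Matrix.single i j c := rfl
  rw [gram_mul, mul_inv_rev, mul_inv_rev, ← star_inv, Units.val_mul, Units.val_mul, Units.coe_star,
    h1, star_sub, star_one, star_single, sub_mul, one_mul, Matrix.sub_apply,
    Matrix.single_mul_apply_of_ne _ _ _ _ _ hk, sub_zero, mul_sub, mul_one, Matrix.sub_apply,
    Matrix.mul_single_apply_of_ne _ _ _ _ _ hk, sub_zero]

end

section

variable {F : Type} [NormedDivisionRing F] [NormedAlgebra ℝ F] [StarRing F]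
  {G : Subgroup (GL3 F)}

theorem Determinant.weyl_mem (D : Determinant G) (i : Fin 3) : weyl F i ∈ G := by
  have h1 : weyl F 1 ∈ G := by
    rw [weyl_one_eq]
    exact mul_mem (mul_mem (D.transvectionUnit_mem _ _) (D.transvectionUnit_mem _ _))
      (D.transvectionUnit_mem _ _)
  fin_cases i
  · change weyl F 0 ∈ G
    have : weyl F 0 = 1 := Units.ext rfl
    rw [this]
    exact one_mem G
  · exact h1
  · change weyl F 2 ∈ G
    rw [weyl_two_eq]
    exact mul_mem h1 (mul_mem (mul_mem (D.transvectionUnit_mem _ _) (D.transvectionUnit_mem _ _))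
      (D.transvectionUnit_mem _ _))

end

section

variable {F : Type} [NormedDivisionRing F] [NormedAlgebra ℝ F] [StarRing F] [IsRCH F]
  {G : Subgroup (GL3 F)}

/-- The hermitian form has no positive definite plane. -/
theorem not_positive_of_gram_apply_eq_zero {g : GL3 F} {i j : Fin 3} {r s : ℝ}
    (hij : (gram g : Mat F) i j = 0) (hr : (gram g : Mat F) i i = algebraMap ℝ F r)
    (hs : (gram g : Mat F) j j = algebraMap ℝ F s) (hr0 : 0 < r) : ¬ 0 < s := by
  intro hs0
  have hji : (gram g : Mat F) j i = 0 := by rw [← star_gram_apply, hij, star_zero]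
  -- a vector of the plane with vanishing first coordinate
  obtain ⟨x, y, hxy, h0⟩ := exists_mul_add_mul_eq_zero ((g : Mat F) 0 i) ((g : Mat F) 0 j)
  set p := (g : Mat F) 1 i * x + (g : Mat F) 1 j * y with hp
  set q := (g : Mat F) 2 i * x + (g : Mat F) 2 j * y with hq
  have h1 : star x * (gram g : Mat F) i i * x + star x * (gram g : Mat F) i j * y +
      star y * (gram g : Mat F) j i * x + star y * (gram g : Mat F) j j * y =
      star ((g : Mat F) 0 i * x + (g : Mat F) 0 j * y) *
        ((g : Mat F) 0 i * x + (g : Mat F) 0 j * y) - star p * p - star q * q := by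
    simp only [gram_apply, hp, hq, star_add, star_mul]
    noncomm_ring
  rw [h0, hij, hji, hr, hs, ← Algebra.commutes, ← Algebra.commutes] at h1
  simp only [mul_assoc, star_mul_self_eq, mul_zero, zero_mul, add_zero, star_zero, zero_sub] at h1
  have h2 : r * ‖x‖ ^ 2 + s * ‖y‖ ^ 2 = -‖p‖ ^ 2 - ‖q‖ ^ 2 := by
    apply (algebraMap ℝ F).injective
    simpa using h1
  rcases hxy with h | h
  · have := norm_pos_iff.2 h
    have : 0 < r * ‖x‖ ^ 2 := by positivity
    nlinarith [sq_nonneg ‖y‖, sq_nonneg ‖p‖, sq_nonneg ‖q‖]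
  · have := norm_pos_iff.2 h
    have : 0 < s * ‖y‖ ^ 2 := by positivity
    nlinarith [sq_nonneg ‖x‖, sq_nonneg ‖p‖, sq_nonneg ‖q‖]

/-- The hermitian form is not negative semidefinite. -/
theorem exists_positive_of_gram_eq_diagonal {g : GL3 F} {r : Fin 3 → ℝ}
    (h : (gram g : Mat F) = Matrix.diagonal fun i => algebraMap ℝ F (r i)) : ∃ i, 0 < r i := by
  by_contra! hr
  have h1 := congrArg (fun u : GL3 F => (u : Mat F) 0 0) (gram_mul g g⁻¹)
  simp only [mul_inv_cancel, gram_one] at h1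
  rw [Units.val_mul, Units.val_mul, Units.coe_star, h, coe_signature_apply, if_pos rfl,
    Matrix.mul_apply, Fin.sum_univ_three] at h1
  simp only [Matrix.mul_diagonal, Matrix.star_apply] at h1
  rw [← Algebra.commutes (r 0), ← Algebra.commutes (r 1), ← Algebra.commutes (r 2)] at h1
  simp only [mul_assoc, star_mul_self_eq, ← map_mul, ← map_add] at h1
  have h2 : (1 : ℝ) = r 0 * ‖((g⁻¹ : GL3 F) : Mat F) 0 0‖ ^ 2 +
      r 1 * ‖((g⁻¹ : GL3 F) : Mat F) 1 0‖ ^ 2 + r 2 * ‖((g⁻¹ : GL3 F) : Mat F) 2 0‖ ^ 2 := by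
    apply (algebraMap ℝ F).injective
    rw [← h1]
    simp
  have h3 := fun i => mul_nonneg (neg_nonneg.2 (hr i)) (sq_nonneg ‖((g⁻¹ : GL3 F) : Mat F) i 0‖)
  linarith [h3 0, h3 1, h3 2]

namespace Determinant

variable (D : Determinant G)
include D

/-- Gram–Schmidt orthogonalization for a flag that is not degenerate. -/
theorem exists_gram_mul_eq_diagonal {g : GL3 F} (h0 : (gram g : Mat F) 0 0 ≠ 0)
    (h2 : (((gram g)⁻¹ : GL3 F) : Mat F) 2 2 ≠ 0) :
    ∃ n ∈ par G flagShape, ∃ r : Fin 3 → ℝ,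
      (gram (g * n) : Mat F) = Matrix.diagonal fun i => algebraMap ℝ F (r i) := by
  have hn : ∀ {i j : Fin 3} (hij : i ≠ j) (hlt : i ≤ j) (c : F),
      transvectionUnit hij c ∈ par G flagShape := fun {i j} hij hlt c =>
    D.transvectionUnit_mem_par hij (by revert i j; decide) c
  set g1 := g * transvectionUnit (i := 0) (j := 1) (by decide)
    (-((gram g : Mat F) 0 0)⁻¹ * (gram g : Mat F) 0 1) with hg1
  have a00 : (gram g1 : Mat F) 0 0 = (gram g : Mat F) 0 0 := by
    simp [hg1, gram_mul_transvectionUnit_apply]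
  have a01 : (gram g1 : Mat F) 0 1 = 0 := by
    simp [hg1, gram_mul_transvectionUnit_apply, mul_inv_cancel_left₀ h0]
  have a22 : (((gram g1)⁻¹ : GL3 F) : Mat F) 2 2 ≠ 0 := by
    rwa [hg1, gram_inv_mul_transvectionUnit_apply _ _ _ (by decide)]
  set g2 := g1 * transvectionUnit (i := 0) (j := 2) (by decide)
    (-((gram g1 : Mat F) 0 0)⁻¹ * (gram g1 : Mat F) 0 2) with hg2
  have b01 : (gram g2 : Mat F) 0 1 = 0 := by
    simp [hg2, gram_mul_transvectionUnit_apply, a01]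
  have b02 : (gram g2 : Mat F) 0 2 = 0 := by
    rw [← a00] at h0
    simp [hg2, gram_mul_transvectionUnit_apply, mul_inv_cancel_left₀ h0]
  have b22 : (((gram g2)⁻¹ : GL3 F) : Mat F) 2 2 ≠ 0 := by
    rwa [hg2, gram_inv_mul_transvectionUnit_apply _ _ _ (by decide)]
  have b10 : (gram g2 : Mat F) 1 0 = 0 := by rw [← star_gram_apply, b01, star_zero]
  have b11 : (gram g2 : Mat F) 1 1 ≠ 0 := by
    intro b11
    have h3 := congrFun (congrFun (gram g2).mul_inv 1) 2
    rw [Matrix.mul_apply, Fin.sum_univ_three, b10, b11, zero_mul, zero_mul, zero_add, zero_add,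
      Matrix.one_apply_ne (by decide), mul_eq_zero, or_iff_left b22] at h3
    have h4 := congrFun (congrFun (gram g2).mul_inv 1) 1
    rw [Matrix.mul_apply, Fin.sum_univ_three, b10, b11, h3] at h4
    simp at h4
  set g3 := g2 * transvectionUnit (i := 1) (j := 2) (by decide)
    (-((gram g2 : Mat F) 1 1)⁻¹ * (gram g2 : Mat F) 1 2) with hg3
  have c01 : (gram g3 : Mat F) 0 1 = 0 := by
    simp [hg3, gram_mul_transvectionUnit_apply, b01]
  have c02 : (gram g3 : Mat F) 0 2 = 0 := by
    simp [hg3, gram_mul_transvectionUnit_apply, b01, b02]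
  have c12 : (gram g3 : Mat F) 1 2 = 0 := by
    simp [hg3, gram_mul_transvectionUnit_apply, mul_inv_cancel_left₀ b11]
  refine ⟨_, mul_mem (mul_mem (hn (i := 0) (j := 1) (by decide) (by decide)
      (-((gram g : Mat F) 0 0)⁻¹ * (gram g : Mat F) 0 1))
    (hn (i := 0) (j := 2) (by decide) (by decide)
      (-((gram g1 : Mat F) 0 0)⁻¹ * (gram g1 : Mat F) 0 2)))
    (hn (i := 1) (j := 2) (by decide) (by decide)
      (-((gram g2 : Mat F) 1 1)⁻¹ * (gram g2 : Mat F) 1 2)), fun i => ‖(g3 : Mat F) 0 i‖ ^ 2 -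
      ‖(g3 : Mat F) 1 i‖ ^ 2 - ‖(g3 : Mat F) 2 i‖ ^ 2, ?_⟩
  rw [← mul_assoc, ← mul_assoc, ← hg1, ← hg2, ← hg3]
  have c10 : (gram g3 : Mat F) 1 0 = 0 := by rw [← star_gram_apply, c01, star_zero]
  have c20 : (gram g3 : Mat F) 2 0 = 0 := by rw [← star_gram_apply, c02, star_zero]
  have c21 : (gram g3 : Mat F) 2 1 = 0 := by rw [← star_gram_apply, c12, star_zero]
  ext i j
  by_cases hij : i = j
  · rw [hij, gram_apply_self, Matrix.diagonal_apply_eq]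
  · rw [Matrix.diagonal_apply_ne _ hij]
    fin_cases i <;> fin_cases j <;>
      first | exact absurd rfl hij | simp [c01, c02, c12, c10, c20, c21]

/-- Every nondegenerate flag belongs to the `H`-orbit of one of the three coordinate flags that are
given by the Weyl group elements. -/
theorem exists_eq_mul_weyl_mul {g : GL3 F} (hg : g ∈ G) (h0 : (gram g : Mat F) 0 0 ≠ 0)
    (h2 : (((gram g)⁻¹ : GL3 F) : Mat F) 2 2 ≠ 0) :
    ∃ i, ∃ h ∈ H G, ∃ b ∈ par G flagShape, g = h * weyl F i * b := by
  obtain ⟨n, hn, r, hr⟩ := D.exists_gram_mul_eq_diagonal h0 h2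
  obtain ⟨i, hi⟩ := exists_positive_of_gram_eq_diagonal hr
  have hneg : ∀ j, j ≠ i → r j < 0 := by
    intro j hj
    have h3 : (gram (g * n) : Mat F) i j = 0 := by rw [hr, Matrix.diagonal_apply_ne _ hj.symm]
    have h4 : ∀ k, (gram (g * n) : Mat F) k k = algebraMap ℝ F (r k) := fun k => by
      rw [hr, Matrix.diagonal_apply_eq]
    refine lt_of_le_of_ne (not_lt.1 (not_positive_of_gram_apply_eq_zero h3 (h4 i) (h4 j) hi))
      fun hrj => ?_
    have h5 := congrFun (congrFun (gram (g * n)).mul_inv j) j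
    rw [hr, Matrix.diagonal_mul, hrj, map_zero, zero_mul, Matrix.one_apply_eq] at h5
    exact zero_ne_one h5
  -- the positive diagonal matrix that normalizes the orthogonal basis
  have hr0 : ∀ j, r j ≠ 0 := fun j => by
    by_cases hj : j = i
    · rw [hj]; exact hi.ne'
    · exact (hneg j hj).ne
  let ρ : Fin 3 → ℝ := fun j => (Real.sqrt |r j|)⁻¹
  have hρ : ∀ j, 0 < ρ j := fun j => inv_pos.2 (Real.sqrt_pos.2 (abs_pos.2 (hr0 j)))
  have hρr : ∀ j, ρ j * r j * ρ j = if j = i then 1 else -1 := by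
    intro j
    have h3 : ρ j * ρ j = |r j|⁻¹ := by
      simp only [ρ]
      rw [← mul_inv, Real.mul_self_sqrt (abs_nonneg _)]
    rw [mul_right_comm, h3]
    split_ifs with hj
    · rw [hj, abs_of_pos hi, inv_mul_cancel₀ hi.ne']
    · rw [abs_of_neg (hneg j hj), inv_neg, neg_mul, inv_mul_cancel₀ (hr0 j)]
  let a : GL3 F := diagUnit fun j => Units.map (algebraMap ℝ F : ℝ →* F) (Units.mk0 (ρ j) (hρ j).ne')
  have ha : (a : Mat F) = realDiag F ρ := rfl
  have hgram : gram (g * n * a * (weyl F i)⁻¹) = signature F := by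
    have h3 : gram (g * n * a) = gram (weyl F i) := by
      ext1
      rw [gram_mul, Units.val_mul, Units.val_mul, Units.coe_star, ha, hr, gram_weyl, realDiag,
        Matrix.star_eq_conjTranspose, Matrix.diagonal_conjTranspose, Matrix.diagonal_mul_diagonal,
        Matrix.diagonal_mul_diagonal]
      congr 1
      funext j
      change star (algebraMap ℝ F (ρ j)) * _ * _ = _
      rw [star_algebraMap_real, ← map_mul, ← map_mul, hρr]
      split_ifs <;> simp
    rw [gram_mul, h3, ← gram_mul, mul_inv_cancel, gram_one]
  have hmem : g * n * a * (weyl F i)⁻¹ ∈ G := by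
    have h3 : D.δ (g * n * a * (weyl F i)⁻¹ : GL3 F) = (((∏ i, ρ i) ^ D.k : ℝ) : ℂ) := by
      rw [Units.val_mul, Units.val_mul, Units.val_mul, map_mul, map_mul, map_mul,
        (D.mem_iff _).1 hg, (D.mem_iff _).1 hn.1, (D.mem_iff _).1 (inv_mem (D.weyl_mem i)), ha,
        D.map_realDiag, one_mul, one_mul, mul_one]
    have h4 := congrArg (fun u : GL3 F => ‖D.δ (u : Mat F)‖) hgram
    have h5 : ‖D.δ (signature F : Mat F)‖ ≠ 0 := by
      rw [norm_ne_zero_iff]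
      intro h5
      have h6 := congrArg (fun u : GL3 F => D.δ (u : Mat F)) (signature_mul_self F)
      simp only [Units.val_mul, map_mul, h5, Units.val_one, map_one, mul_zero] at h6
      exact zero_ne_one h6
    have hpos : 0 < (∏ i, ρ i) ^ D.k := pow_pos (Finset.prod_pos fun j _ => hρ j) _
    rw [gram, Units.val_mul, Units.val_mul, Units.coe_star, map_mul, map_mul, D.map_star, h3,
      norm_mul, norm_mul, norm_star, Complex.norm_real, Real.norm_eq_abs, abs_of_pos hpos,
      mul_right_comm, mul_eq_right₀ h5] at h4
    rw [D.mem_iff, h3]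
    norm_cast
    nlinarith
  obtain ⟨k, hk, d, hd⟩ := D.exists_mem_H_mul_diagonal (mem_fixedBy_sigma.2 ⟨hmem, hgram⟩)
  set m := k * (g * n * a * (weyl F i)⁻¹) with hm
  have hmG : m ∈ G := mul_mem (H_le_fixedBy hk).1 hmem
  have hb : BlockTriangular (((weyl F i)⁻¹ * m * weyl F i * a⁻¹ * n⁻¹ : GL3 F) : Mat F)
      flagShape := by
    obtain ⟨e, he⟩ := weyl_inv_mul_diagonal_mul i d
    rw [Units.val_mul, Units.val_mul, Units.val_mul, Units.val_mul, hd, he]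
    exact ((Matrix.blockTriangular_diagonal _).mul (blockTriangular_inv
      (Matrix.blockTriangular_diagonal _))).mul (blockTriangular_inv hn.2)
  have hgeq : g = k⁻¹ * weyl F i * ((weyl F i)⁻¹ * m * weyl F i * a⁻¹ * n⁻¹) := by
    rw [hm]
    group
  refine ⟨i, k⁻¹, inv_mem hk, _, ⟨?_, hb⟩, hgeq⟩
  rw [hgeq] at hg
  exact (Subgroup.mul_mem_cancel_left G (mul_mem (inv_mem (H_le_fixedBy hk).1) (D.weyl_mem i))).1 hg

end Determinant

end

/-! ### Coordinate parabolic subgroups -/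

/-- The shapes of the minimal parabolic subgroups `P_i`. -/
def minShape : Fin 3 → Fin 3 → Fin 3 := ![![0, 1, 2], ![1, 0, 2], ![2, 0, 1]]

/-- The shapes of the maximal parabolic subgroups `Q_i`. -/
def maxShape : Fin 4 → Fin 3 → Fin 3 := ![![0, 0, 1], ![1, 0, 0], ![0, 1, 1], ![1, 0, 1]]

/-- The permutation of the coordinate axes by `weyl F i`. -/
def weylPerm : Fin 3 → Fin 3 → Fin 3 := ![![0, 1, 2], ![1, 0, 2], ![1, 2, 0]]

section

variable {F : Type} [NormedDivisionRing F]

/-- The signs of the nonzero entries of `weyl F i`. -/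
def weylSign (F : Type) [NormedDivisionRing F] : Fin 3 → Fin 3 → F := ![1, ![1, -1, 1], 1]

theorem weylSign_ne_zero (i k : Fin 3) : weylSign F i k ≠ 0 := by
  fin_cases i <;> fin_cases k <;> simp [weylSign]

theorem weyl_apply (i j k : Fin 3) :
    (weyl F i : Mat F) j k = if weylPerm i k = j then weylSign F i k else 0 := by
  rw [coe_weyl]
  fin_cases i <;> fin_cases j <;> fin_cases k <;> simp [weylPerm, weylSign]

theorem weyl_inv_apply (i j k : Fin 3) :
    (((weyl F i)⁻¹ : GL3 F) : Mat F) j k = if weylPerm i j = k then weylSign F i j else 0 := by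
  rw [coe_weyl_inv]
  fin_cases i <;> fin_cases j <;> fin_cases k <;> simp [weylPerm, weylSign]

theorem weyl_mul_single_mul_inv (i k l : Fin 3) (c : F) :
    (weyl F i : Mat F) * Matrix.single k l c * ((weyl F i)⁻¹ : GL3 F) =
      Matrix.single (weylPerm i k) (weylPerm i l) (weylSign F i k * c * weylSign F i l) := by
  ext a b
  rw [mul_single_mul_apply, weyl_apply, weyl_inv_apply, Matrix.single_apply]
  split_ifs <;> simp_all

/-- A nonzero hermitian form in two variables takes a nonzero value at some vector `(1, c)`. -/
theorem exists_mul_add_star_ne_zero [CharZero F] [StarRing F] {x a b : F}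
    (h : x ≠ 0 ∨ a ≠ 0 ∨ b ≠ 0) : ∃ c : F, x + b * c + star (b * c) + star c * a * c ≠ 0 := by
  by_contra! hc
  have h0 := hc 0
  have h1 := hc 1
  have h2 := hc (-1)
  simp only [mul_zero, star_zero, zero_mul, add_zero] at h0
  simp only [h0, star_one, star_neg, mul_one, one_mul, mul_neg, neg_mul, neg_neg, zero_add]
    at h1 h2 hc
  have ha : a = 0 := by
    have h3 : (2 : F) * a = (b + star b + a) + (-b + -star b + a) := by noncomm_ring
    rw [h1, h2, add_zero] at h3
    exact (mul_eq_zero.1 h3).resolve_left two_ne_zero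
  by_cases hb : b = 0
  · simp [h0, ha, hb] at h
  · have h3 := hc b⁻¹
    rw [mul_inv_cancel₀ hb, ha, star_one, mul_zero, zero_mul, add_zero, one_add_one_eq_two] at h3
    exact two_ne_zero h3

theorem gram_inv_mul_transvectionUnit_apply_self [StarRing F] (g : GL3 F) {i j : Fin 3}
    (hij : i ≠ j) (c : F) : (((gram (g * transvectionUnit hij c))⁻¹ : GL3 F) : Mat F) i i =
      (((gram g)⁻¹ : GL3 F) : Mat F) i i - (((gram g)⁻¹ : GL3 F) : Mat F) i j * star c -
        c * ((((gram g)⁻¹ : GL3 F) : Mat F) j i -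
          (((gram g)⁻¹ : GL3 F) : Mat F) j j * star c) := by
  have h1 : (((transvectionUnit hij c)⁻¹ : GL3 F) : Mat F) = 1 - Matrix.single i j c := rfl
  rw [gram_mul, mul_inv_rev, mul_inv_rev, ← star_inv, Units.val_mul, Units.val_mul, Units.coe_star,
    h1, star_sub, star_one, star_single, sub_mul, one_mul, Matrix.sub_apply,
    Matrix.single_mul_apply_same, mul_sub, mul_one, Matrix.sub_apply, Matrix.sub_apply,
    Matrix.mul_single_apply_same, Matrix.mul_single_apply_same]

end

section

variable {F : Type} [NormedDivisionRing F] [NormedAlgebra ℝ F] [StarRing F] [IsRCH F]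
  {G : Subgroup (GL3 F)}

namespace Determinant

variable (D : Determinant G)
include D

/-- Conjugation by `weyl F i` permutes the coordinate parabolic subgroups. -/
theorem conj_weyl_par {i : Fin 3} {b b' : Fin 3 → Fin 3} (h : ∀ k, b' (weylPerm i k) = b k) :
    conj (weyl F i) (par G b) = par G b' := by
  have h1 : ∀ {j k}, (weyl F i : Mat F) j k ≠ 0 → b' j = b k := fun {j k} hjk => by
    rw [weyl_apply, ite_ne_right_iff] at hjk
    rw [← h, hjk.1]
  have h2 : ∀ {j k}, (((weyl F i)⁻¹ : GL3 F) : Mat F) j k ≠ 0 → b j = b' k := fun {j k} hjk => by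
    rw [weyl_inv_apply, ite_ne_right_iff] at hjk
    rw [← h, hjk.1]
  have key : ∀ {v v' : GL3 F} {c c' : Fin 3 → Fin 3}, (∀ {j k}, (v : Mat F) j k ≠ 0 → c' j = c k) →
      (∀ {j k}, (v' : Mat F) j k ≠ 0 → c j = c' k) → ∀ {y : GL3 F},
      BlockTriangular (y : Mat F) c → BlockTriangular ((v * y * v' : GL3 F) : Mat F) c' := by
    intro v v' c c' hv hv' y hy j k hjk
    rw [Units.val_mul, Units.val_mul, Matrix.mul_apply]
    refine Finset.sum_eq_zero fun m _ => ?_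
    by_cases hm : (v' : Mat F) m k = 0
    · rw [hm, mul_zero]
    rw [Matrix.mul_apply, Finset.sum_eq_zero, zero_mul]
    intro l _
    by_cases hl : (v : Mat F) j l = 0
    · rw [hl, zero_mul]
    rw [hy (by rwa [hv' hm, ← hv hl]), mul_zero]
  ext x
  rw [mem_conj]
  constructor
  · rintro ⟨hx, hb⟩
    have hx' := D.conj_mem (weyl F i) hx
    have hb' := key h1 h2 hb
    have he : weyl F i * ((weyl F i)⁻¹ * x * weyl F i) * (weyl F i)⁻¹ = x := by group
    rw [he] at hx' hb'
    exact ⟨hx', hb'⟩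
  · rintro ⟨hx, hb⟩
    have hx' := D.conj_mem (weyl F i)⁻¹ hx
    rw [inv_inv] at hx'
    exact ⟨hx', key h2 h1 hb⟩

theorem conj_weyl_flag (i : Fin 3) :
    conj (weyl F i) (par G flagShape) = par G (minShape i) :=
  D.conj_weyl_par (by revert i; decide)

theorem conj_weyl_plane (i : Fin 3) :
    conj (weyl F i) (par G planeShape) = par G (maxShape (![0, 0, 1] i)) :=
  D.conj_weyl_par (by revert i; decide)

theorem conj_weyl_line (i : Fin 3) :
    conj (weyl F i) (par G lineShape) = par G (maxShape (![2, 3, 3] i)) :=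
  D.conj_weyl_par (by revert i; decide)

/-- A nondegenerate line can be completed to a nondegenerate flag. -/
theorem exists_mem_line {g : GL3 F} (h0 : (gram g : Mat F) 0 0 ≠ 0) :
    ∃ q ∈ par G lineShape, (gram (g * q) : Mat F) 0 0 ≠ 0 ∧
      (((gram (g * q))⁻¹ : GL3 F) : Mat F) 2 2 ≠ 0 := by
  set V := (((gram g)⁻¹ : GL3 F) : Mat F) with hV
  have h : V 2 2 ≠ 0 ∨ V 1 1 ≠ 0 ∨ V 2 1 ≠ 0 := by
    by_contra! hc
    obtain ⟨h22, h11, h21⟩ := hc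
    have h12 : V 1 2 = 0 := by rw [hV, ← star_gram_inv_apply, ← hV, h21, star_zero]
    have h1 := congrFun (congrFun (gram g).inv_mul 1) 0
    have h2 := congrFun (congrFun (gram g).inv_mul 1) 1
    rw [← hV, Matrix.mul_apply, Fin.sum_univ_three, h11, h12] at h1 h2
    simp only [zero_mul, add_zero, Matrix.one_apply_eq] at h1 h2
    rw [Matrix.one_apply_ne (by decide), mul_eq_zero, or_iff_left h0] at h1
    rw [h1, zero_mul] at h2
    exact zero_ne_one h2
  obtain ⟨c, hc⟩ := exists_mul_add_star_ne_zero h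
  refine ⟨_, D.transvectionUnit_mem_par (i := 2) (j := 1) (by decide) (by decide) (-star c), ?_, ?_⟩
  · simpa [gram_mul_transvectionUnit_apply] using h0
  · rw [gram_inv_mul_transvectionUnit_apply_self, ← hV]
    convert hc using 1
    rw [star_mul, hV, star_gram_inv_apply, ← hV, star_neg, star_star]
    noncomm_ring

/-- A nondegenerate plane can be completed to a nondegenerate flag. -/
theorem exists_mem_plane {g : GL3 F} (h2 : (((gram g)⁻¹ : GL3 F) : Mat F) 2 2 ≠ 0) :
    ∃ q ∈ par G planeShape, (gram (g * q) : Mat F) 0 0 ≠ 0 ∧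
      (((gram (g * q))⁻¹ : GL3 F) : Mat F) 2 2 ≠ 0 := by
  have h : (gram g : Mat F) 0 0 ≠ 0 ∨ (gram g : Mat F) 1 1 ≠ 0 ∨ (gram g : Mat F) 0 1 ≠ 0 := by
    by_contra! hc
    obtain ⟨h00, h11, h01⟩ := hc
    have h1 := congrFun (congrFun (gram g).mul_inv 0) 2
    have h3 := congrFun (congrFun (gram g).mul_inv 0) 0
    rw [Matrix.mul_apply, Fin.sum_univ_three, h00, h01] at h1 h3
    simp only [zero_mul, zero_add, Matrix.one_apply_eq] at h1 h3
    rw [Matrix.one_apply_ne (by decide), mul_eq_zero, or_iff_left h2] at h1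
    rw [h1, zero_mul] at h3
    exact zero_ne_one h3
  obtain ⟨c, hc⟩ := exists_mul_add_star_ne_zero h
  refine ⟨_, D.transvectionUnit_mem_par (i := 1) (j := 0) (by decide) (by decide) c, ?_, ?_⟩
  · rw [gram_mul_transvectionUnit_apply, if_pos rfl, if_pos rfl, if_pos rfl]
    convert hc using 1
    rw [star_mul, star_gram_apply]
    noncomm_ring
  · rwa [gram_inv_mul_transvectionUnit_apply _ _ _ (by decide)]

/-- A nondegenerate flag can be moved by `H` to a coordinate flag. -/
theorem exists_conj_eq_conj_weyl {g : GL3 F} (hg : g ∈ G) (h0 : (gram g : Mat F) 0 0 ≠ 0)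
    (h2 : (((gram g)⁻¹ : GL3 F) : Mat F) 2 2 ≠ 0) {b : Fin 3 → Fin 3}
    (hb : par G flagShape ≤ par G b) :
    ∃ i, ∃ h ∈ H G, conj g (par G b) = conj h (conj (weyl F i) (par G b)) := by
  obtain ⟨i, h, hh, q, hq, rfl⟩ := D.exists_eq_mul_weyl_mul hg h0 h2
  exact ⟨i, h, hh, by rw [conj_conj, ← conj_conj (h * weyl F i) q, conj_eq_self (hb hq)]⟩

theorem exists_conj_flag_eq {g : GL3 F} (hg : g ∈ G)
    (hσ : IsSigmaParabolic G (conj g (par G flagShape))) :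
    ∃ i, ∃ h ∈ H G, conj g (par G flagShape) = conj h (conj (weyl F i) (par G flagShape)) :=
  D.exists_conj_eq_conj_weyl hg (D.gram_apply_ne_zero_of_flag hσ)
    (D.gram_inv_apply_ne_zero_of_flag hσ) le_rfl

theorem exists_conj_line_eq {g : GL3 F} (hg : g ∈ G)
    (hσ : IsSigmaParabolic G (conj g (par G lineShape))) :
    ∃ i, ∃ h ∈ H G, conj g (par G lineShape) = conj h (conj (weyl F i) (par G lineShape)) := by
  obtain ⟨q, hq, h0, h2⟩ := D.exists_mem_line (D.gram_apply_ne_zero_of_line hσ)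
  have h := D.exists_conj_eq_conj_weyl (mul_mem hg hq.1) h0 h2 par_flag_le_line
  rwa [← conj_conj, conj_eq_self hq] at h

theorem exists_conj_plane_eq {g : GL3 F} (hg : g ∈ G)
    (hσ : IsSigmaParabolic G (conj g (par G planeShape))) :
    ∃ i, ∃ h ∈ H G, conj g (par G planeShape) = conj h (conj (weyl F i) (par G planeShape)) := by
  obtain ⟨q, hq, h0, h2⟩ := D.exists_mem_plane (D.gram_inv_apply_ne_zero_of_plane hσ)
  have h := D.exists_conj_eq_conj_weyl (mul_mem hg hq.1) h0 h2 par_flag_le_plane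
  rwa [← conj_conj, conj_eq_self hq] at h

/-- Every `σ`-parabolic subgroup contains an `H`-conjugate of one of the `P_i`. -/
theorem exists_conj_minShape_le {R : Subgroup (GL3 F)} (hR : IsSigmaParabolic G R) :
    ∃ i, ∃ h ∈ H G, conj h (par G (minShape i)) ≤ R := by
  obtain ⟨g, hg, rfl | rfl | rfl | rfl⟩ := D.isParabolic_iff.1 hR.1
  · obtain ⟨i, h, hh, he⟩ := D.exists_conj_flag_eq hg hR
    exact ⟨i, h, hh, by rw [he, D.conj_weyl_flag]⟩
  · obtain ⟨i, h, hh, he⟩ := D.exists_conj_line_eq hg hR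
    exact ⟨i, h, hh, by rw [he, ← D.conj_weyl_flag]; exact conj_mono (conj_mono par_flag_le_line)⟩
  · obtain ⟨i, h, hh, he⟩ := D.exists_conj_plane_eq hg hR
    exact ⟨i, h, hh, by rw [he, ← D.conj_weyl_flag]; exact conj_mono (conj_mono par_flag_le_plane)⟩
  · exact ⟨0, 1, one_mem _, by rw [conj_one]; exact par_le _⟩

/-- Every proper `σ`-parabolic subgroup is contained in an `H`-conjugate of one of the `Q_i`. -/
theorem exists_le_conj_maxShape {R : Subgroup (GL3 F)} (hR : IsSigmaParabolic G R) (hRG : R ≠ G) :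
    ∃ i, ∃ h ∈ H G, R ≤ conj h (par G (maxShape i)) := by
  obtain ⟨g, hg, rfl | rfl | rfl | rfl⟩ := D.isParabolic_iff.1 hR.1
  · obtain ⟨i, h, hh, he⟩ := D.exists_conj_flag_eq hg hR
    exact ⟨_, h, hh, by rw [he, ← D.conj_weyl_line i]; exact conj_mono (conj_mono par_flag_le_line)⟩
  · obtain ⟨i, h, hh, he⟩ := D.exists_conj_line_eq hg hR
    exact ⟨_, h, hh, by rw [he, ← D.conj_weyl_line i]⟩
  · obtain ⟨i, h, hh, he⟩ := D.exists_conj_plane_eq hg hR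
    exact ⟨_, h, hh, by rw [he, ← D.conj_weyl_plane i]⟩
  · exact absurd rfl hRG

end Determinant

end

/-! ### Inclusions between parabolic subgroups -/

theorem posSystem_eq (i : Fin 3) :
    posSystem i = {r | r.1 ≠ r.2 ∧ minShape i r.1 ≤ minShape i r.2} := by
  ext ⟨k, l⟩
  fin_cases i <;> fin_cases k <;> fin_cases l <;> simp [posSystem, minShape]

section

variable {F : Type} [NormedDivisionRing F]

theorem row_ne_zero (u : GL3 F) (i : Fin 3) : ∃ m, (u : Mat F) i m ≠ 0 := by
  by_contra! h
  have h1 := congrFun (congrFun u.mul_inv i) i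
  rw [Matrix.mul_apply, Fin.sum_univ_three, h, h, h, Matrix.one_apply_eq] at h1
  simp at h1

theorem conj_eq_of_mem {G : Subgroup (GL3 F)} {g : GL3 F} (hg : g ∈ G) {P : Subgroup (GL3 F)} :
    conj g P = G ↔ P = G := by
  constructor
  · intro h
    have h1 := congrArg (conj g⁻¹) h
    rwa [conj_conj, inv_mul_cancel, conj_one, conj_eq_self (inv_mem hg)] at h1
  · rintro rfl
    exact conj_eq_self hg

end

section

variable {F : Type} [NormedDivisionRing F] [NormedAlgebra ℝ F] [StarRing F] [IsRCH F]
  {G : Subgroup (GL3 F)}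

theorem blockTriangular_of_inv {u : GL3 F} {b : Fin 3 → Fin 3}
    (h : BlockTriangular ((u⁻¹ : GL3 F) : Mat F) b) : BlockTriangular (u : Mat F) b := by
  have := blockTriangular_inv h
  rwa [inv_inv] at this

theorem blockTriangular_line_of_forall {u : GL3 F} (h : ∀ j k : Fin 3, j ≠ 0 → k ≠ 0 →
    (u : Mat F) k 0 = 0 ∨ ((u⁻¹ : GL3 F) : Mat F) j 0 = 0) :
    BlockTriangular (u : Mat F) lineShape := by
  by_cases h1 : ∃ k : Fin 3, k ≠ 0 ∧ (u : Mat F) k 0 ≠ 0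
  · obtain ⟨k, hk, hk0⟩ := h1
    exact blockTriangular_of_inv (blockTriangular_line_iff.2
      ⟨(h 1 k (by decide) hk).resolve_left hk0, (h 2 k (by decide) hk).resolve_left hk0⟩)
  · push Not at h1
    exact blockTriangular_line_iff.2 ⟨h1 1 (by decide), h1 2 (by decide)⟩

theorem blockTriangular_plane_of_forall {u : GL3 F} (h : ∀ j k : Fin 3, j ≠ 2 → k ≠ 2 →
    (u : Mat F) 2 j = 0 ∨ ((u⁻¹ : GL3 F) : Mat F) 2 k = 0) :
    BlockTriangular (u : Mat F) planeShape := by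
  by_cases h1 : ∃ j : Fin 3, j ≠ 2 ∧ (u : Mat F) 2 j ≠ 0
  · obtain ⟨j, hj, hj0⟩ := h1
    exact blockTriangular_of_inv (blockTriangular_plane_iff.2
      ⟨(h j 0 hj (by decide)).resolve_left hj0, (h j 1 hj (by decide)).resolve_left hj0⟩)
  · push Not at h1
    exact blockTriangular_plane_iff.2 ⟨h1 0 (by decide), h1 1 (by decide)⟩

/-- A matrix is upper triangular if conjugation by it maps nonzero elements of all the positive
root spaces to upper triangular matrices. -/
theorem blockTriangular_flag_of_forall {u : GL3 F} (h : ∀ k l : Fin 3, k < l → ∃ c : F, c ≠ 0 ∧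
    BlockTriangular ((u : Mat F) * Matrix.single k l c * (u⁻¹ : GL3 F) : Mat F) flagShape) :
    BlockTriangular (u : Mat F) flagShape := by
  have hlt : ∀ {i j : Fin 3}, i < j → flagShape i < flagShape j := fun {i j} => by
    revert i j; decide
  refine blockTriangular_flag_iff.2
    ⟨blockTriangular_line_of_forall fun j k hj hk => ?_,
      blockTriangular_plane_of_forall fun j k hj hk => ?_⟩
  · obtain ⟨c, hc, hb⟩ := h 0 j (Fin.pos_of_ne_zero hj)
    have h1 := hb (hlt (Fin.pos_of_ne_zero hk))
    rw [mul_single_mul_apply, mul_eq_zero, mul_eq_zero, or_iff_left hc] at h1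
    exact h1
  · obtain ⟨c, hc, hb⟩ := h j 2 (Fin.lt_last_iff_ne_last.2 hj)
    have h1 := hb (hlt (Fin.lt_last_iff_ne_last.2 hk : k < 2))
    rw [mul_single_mul_apply, mul_eq_zero, mul_eq_zero, or_iff_left hc] at h1
    exact h1

/-- A maximal parabolic subgroup is the normalizer of its nilradical. -/
theorem mem_par_iff_forall_nil {b : Fin 3 → Fin 3} (hb : ∀ i j m, b j < b i → b m ≤ b i)
    {x : GL3 F} (hx : x ∈ G) :
    x ∈ par G b ↔ ∀ X ∈ nil F b, (x : Mat F) * X * (x⁻¹ : GL3 F) ∈ nil F b := by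
  constructor
  · intro h X hX
    exact mul_mem_nil_right (mul_mem_nil_left h.2 hX) (blockTriangular_inv h.2)
  · refine fun h => ⟨hx, fun i j hji => ?_⟩
    have h1 := h _ (single_mem_nil hji 1)
    by_contra hne
    obtain ⟨m, hm⟩ := row_ne_zero x⁻¹ i
    have h2 := h1 i m (hb i j m hji)
    rw [mul_single_mul_apply, mul_one, mul_eq_zero] at h2
    exact h2.elim hne hm

theorem mem_lie_conj {g : GL3 F} {P : Subgroup (GL3 F)} {X : Mat F} (h : X ∈ lie (conj g P)) :
    ((g⁻¹ : GL3 F) : Mat F) * X * g ∈ lie P := by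
  rw [conj] at h
  have := (isDifferential_conj g).lie_map P
  rw [show lie (P.map (MulAut.conj g).toMonoidHom) = _ from this] at h
  obtain ⟨Y, hY, rfl⟩ := h
  change ((g⁻¹ : GL3 F) : Mat F) * (g * Y * (g⁻¹ : GL3 F)) * g ∈ lie P
  simpa [mul_assoc] using hY

namespace Determinant

variable (D : Determinant G)
include D

theorem blockTriangular_of_conj_par_le {u : GL3 F} {b b' : Fin 3 → Fin 3}
    (h : conj u (par G b) ≤ par G b') {i j : Fin 3} (hij : i ≠ j) (hb : b i ≤ b j) :
    BlockTriangular ((u : Mat F) * Matrix.single i j 1 * ((u⁻¹ : GL3 F) : Mat F)) b' := by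
  have h1 := (h ⟨_, D.transvectionUnit_mem_par hij hb 1, rfl⟩).2
  change BlockTriangular ((u : Mat F) * (1 + Matrix.single i j 1) * ((u⁻¹ : GL3 F) : Mat F)) b' at h1
  rw [mul_add, add_mul, mul_one, Units.mul_inv] at h1
  intro k l hkl
  have h2 := h1 hkl
  rwa [Matrix.add_apply, Matrix.blockTriangular_one hkl, zero_add] at h2

/-- The stabilizer of a line is its own normalizer. -/
theorem blockTriangular_of_conj_line_le {u : GL3 F}
    (h : conj u (par G lineShape) ≤ par G lineShape) : BlockTriangular (u : Mat F) lineShape := by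
  refine blockTriangular_line_of_forall fun j k hj hk => ?_
  have h1 := D.blockTriangular_of_conj_par_le h (i := 0) (j := j) hj.symm (by revert j; decide)
  have h2 := h1 (i := k) (j := 0) (by revert k; decide)
  rwa [mul_single_mul_apply, mul_one, mul_eq_zero] at h2

/-- The stabilizer of a plane is its own normalizer. -/
theorem blockTriangular_of_conj_plane_le {u : GL3 F}
    (h : conj u (par G planeShape) ≤ par G planeShape) :
    BlockTriangular (u : Mat F) planeShape := by
  refine blockTriangular_plane_of_forall fun j k hj hk => ?_
  have h1 := D.blockTriangular_of_conj_par_le h (i := j) (j := 2) hj (by revert j; decide)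
  have h2 := h1 (i := 2) (j := k) (by revert k; decide)
  rwa [mul_single_mul_apply, mul_one, mul_eq_zero] at h2

/-- The stabilizer of a flag is its own normalizer. -/
theorem blockTriangular_of_conj_flag_le {u : GL3 F}
    (h : conj u (par G flagShape) ≤ par G flagShape) :
    BlockTriangular (u : Mat F) flagShape :=
  blockTriangular_flag_of_forall fun k l hkl => ⟨1, one_ne_zero,
    D.blockTriangular_of_conj_par_le h hkl.ne (by revert k l; decide)⟩

/-- The stabilizer of a line does not stabilize any plane. -/
theorem not_conj_line_le_plane (u : GL3 F) : ¬ conj u (par G lineShape) ≤ par G planeShape := by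
  intro h
  have key : ∀ i j l : Fin 3, i ≠ j → lineShape i ≤ lineShape j → l ≠ 2 →
      (u : Mat F) 2 i = 0 ∨ ((u⁻¹ : GL3 F) : Mat F) j l = 0 := by
    intro i j l hij hb hl
    have h0 := D.blockTriangular_of_conj_par_le h hij hb
    have h1 := h0 (i := 2) (j := l) (by revert l; decide)
    rwa [mul_single_mul_apply, mul_one, mul_eq_zero] at h1
  have hplane : (u : Mat F) 2 0 = 0 ∧ (u : Mat F) 2 1 = 0 ↔
      ((u⁻¹ : GL3 F) : Mat F) 2 0 = 0 ∧ ((u⁻¹ : GL3 F) : Mat F) 2 1 = 0 := by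
    rw [← blockTriangular_plane_iff, ← blockTriangular_plane_iff]
    exact ⟨blockTriangular_inv, blockTriangular_of_inv⟩
  have hrow : ¬ ((u : Mat F) 2 0 = 0 ∧ (u : Mat F) 2 1 = 0 ∧ (u : Mat F) 2 2 = 0) := by
    rintro ⟨h0, h1, h2⟩
    obtain ⟨m, hm⟩ := row_ne_zero u 2
    fin_cases m <;> contradiction
  have hv2 : ((u⁻¹ : GL3 F) : Mat F) 2 0 = 0 ∧ ((u⁻¹ : GL3 F) : Mat F) 2 1 = 0 := by
    by_contra hc
    have h01 : (u : Mat F) 2 0 = 0 ∧ (u : Mat F) 2 1 = 0 := by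
      have a0 := key 0 2 0 (by decide) (by decide) (by decide)
      have a1 := key 0 2 1 (by decide) (by decide) (by decide)
      have b0 := key 1 2 0 (by decide) (by decide) (by decide)
      have b1 := key 1 2 1 (by decide) (by decide) (by decide)
      tauto
    exact hc (hplane.1 h01)
  obtain ⟨h20, h21⟩ := hplane.2 hv2
  have h22 : (u : Mat F) 2 2 ≠ 0 := fun h22 => hrow ⟨h20, h21, h22⟩
  have a0 := (key 2 1 0 (by decide) (by decide) (by decide)).resolve_left h22
  have a1 := (key 2 1 1 (by decide) (by decide) (by decide)).resolve_left h22
  have h3 := congrFun (congrFun u.inv_mul 1) 1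
  rw [Matrix.mul_apply, Fin.sum_univ_three, a0, a1, h21] at h3
  simp at h3

/-- The stabilizer of the standard plane does not stabilize the standard line. -/
theorem not_plane_le_line : ¬ par G planeShape ≤ par G lineShape := by
  intro h
  have h1 := D.blockTriangular_of_conj_par_le (u := 1) (b := planeShape) (b' := lineShape)
    (by rwa [conj_one]) (i := 1) (j := 0) (by decide) (by decide)
  replace h1 := h1 (i := 1) (j := 0) (by decide)
  simp at h1

theorem not_line_le_plane : ¬ par G lineShape ≤ par G planeShape := by
  have := D.not_conj_line_le_plane 1
  rwa [conj_one] at this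

theorem par_line_ne : par G lineShape ≠ G := fun h =>
  D.not_plane_le_line ((par_le _).trans_eq h.symm)

theorem par_plane_ne : par G planeShape ≠ G := fun h =>
  D.not_line_le_plane ((par_le _).trans_eq h.symm)

theorem isMaximalParabolic_iff {P : Subgroup (GL3 F)} : IsMaximalParabolic G P ↔
    ∃ g ∈ G, P = conj g (par G lineShape) ∨ P = conj g (par G planeShape) := by
  constructor
  · rintro ⟨⟨hP, hPG⟩, hmax⟩
    obtain ⟨g, hg, h | h | h | h⟩ := D.isParabolic_iff.1 hP
    · have h1 := hmax ⟨D.isParabolic_iff.2 ⟨g, hg, Or.inr (Or.inl rfl)⟩,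
        fun h1 => D.par_line_ne ((conj_eq_of_mem hg).1 h1)⟩
        (h.trans_le (conj_mono par_flag_le_line))
      exact ⟨g, hg, Or.inl (le_antisymm (h.trans_le (conj_mono par_flag_le_line)) h1)⟩
    · exact ⟨g, hg, Or.inl h⟩
    · exact ⟨g, hg, Or.inr h⟩
    · exact absurd h hPG
  · rintro ⟨g, hg, h⟩
    obtain ⟨R, hflag, hne, hR, rfl⟩ : ∃ R, par G flagShape ≤ R ∧ R ≠ G ∧
        (R = par G lineShape ∨ R = par G planeShape) ∧ P = conj g R := by
      rcases h with h | h
      · exact ⟨_, par_flag_le_line, D.par_line_ne, Or.inl rfl, h⟩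
      · exact ⟨_, par_flag_le_plane, D.par_plane_ne, Or.inr rfl, h⟩
    refine ⟨⟨D.isParabolic_iff.2 ⟨g, hg, ?_⟩, fun h1 => hne ((conj_eq_of_mem hg).1 h1)⟩, ?_⟩
    · rcases hR with rfl | rfl
      · exact Or.inr (Or.inl rfl)
      · exact Or.inr (Or.inr (Or.inl rfl))
    · rintro Q ⟨hQ, hQG⟩ hle
      rw [conj_le_iff] at hle
      have hQ1 : conj g⁻¹ Q ≤ G := by
        rw [conj_le_iff, inv_inv, conj_eq_self hg]
        exact hQ.1
      have hQR : conj g⁻¹ Q = R := by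
        clear h
        rcases D.eq_par_of_par_flag_le (hflag.trans hle) hQ1 with h | h | h | h
        · rw [h] at hle ⊢
          exact le_antisymm hflag hle
        · rcases hR with rfl | rfl
          · exact h
          · exact absurd (hle.trans_eq h) D.not_plane_le_line
        · rcases hR with rfl | rfl
          · exact absurd (hle.trans_eq h) D.not_line_le_plane
          · exact h
        · exact absurd ((conj_eq_of_mem (inv_mem hg)).1 h) hQG
      rw [← hQR, conj_conj, mul_inv_cancel, conj_one]

/-- A parabolic subgroup that is contained in a minimal one is equal to it. -/
theorem eq_conj_flag_of_le {g : GL3 F} (hg : g ∈ G) {R : Subgroup (GL3 F)} (hR : IsParabolic G R)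
    (hle : R ≤ conj g (par G flagShape)) : R = conj g (par G flagShape) := by
  obtain ⟨-, _, hB, g', hg', rfl⟩ := hR
  refine le_antisymm hle (le_trans (le_of_eq ?_) hB)
  rw [D.stdMinimalParabolic_eq] at hB ⊢
  have h1 : conj (g⁻¹ * g') (par G flagShape) ≤ par G flagShape := by
    rw [← conj_conj, conj_le_iff, inv_inv]
    exact hB.trans hle
  have h2 : g⁻¹ * g' ∈ par G flagShape :=
    ⟨mul_mem (inv_mem hg) hg', D.blockTriangular_of_conj_flag_le h1⟩
  calc conj g (par G flagShape) = conj g (conj (g⁻¹ * g') (par G flagShape)) := by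
        rw [conj_eq_self h2]
    _ = conj g' (par G flagShape) := by rw [conj_conj, mul_inv_cancel_left]

/-! ### The standard parabolic subgroups -/

/-- The groups `P_i` are block triangular. A minimal parabolic subgroup is determined by its roots
because even a single nonzero element of each of the root spaces determines the flag. -/
theorem isStdP_iff (i : Fin 3) (R : Subgroup (GL3 F)) :
    IsStdP G i R ↔ R = par G (minShape i) := by
  constructor
  · rintro ⟨⟨g, hg, rfl⟩, -, hroots⟩
    rw [D.stdMinimalParabolic_eq] at hroots ⊢
    have hmem : g⁻¹ * weyl F i ∈ par G flagShape := by
      refine ⟨mul_mem (inv_mem hg) (D.weyl_mem i), blockTriangular_flag_of_forall fun k l hkl => ?_⟩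
      have hr : (weylPerm i k, weylPerm i l) ∈ roots G (conj g (par G flagShape)) := by
        rw [hroots, posSystem_eq]
        clear hroots
        revert i k l
        decide
      obtain ⟨hne, hr⟩ := hr
      obtain ⟨X, ⟨hX1, hX2⟩, hX0⟩ := (Submodule.ne_bot_iff _).1 hr
      obtain ⟨c, rfl⟩ := (D.mem_rootSpace hne).1 hX2
      have hs : ∀ k, weylSign F i k * weylSign F i k = 1 := fun k => by
        fin_cases i <;> fin_cases k <;> simp [weylSign]
      refine ⟨weylSign F i k * c * weylSign F i l, ?_, ?_⟩
      · refine mul_ne_zero (mul_ne_zero (weylSign_ne_zero i k) ?_) (weylSign_ne_zero i l)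
        rintro rfl
        exact hX0 (Matrix.single_zero _ _)
      · have h1 := weyl_mul_single_mul_inv i k l (weylSign F i k * c * weylSign F i l)
        have h2 : weylSign F i k * (weylSign F i k * c * weylSign F i l) * weylSign F i l = c := by
          rw [← mul_assoc, ← mul_assoc, hs, one_mul, mul_assoc, hs, mul_one]
        rw [h2] at h1
        have h3 := (D.lie_par_le _ (mem_lie_conj hX1)).1
        rw [mul_inv_rev, inv_inv, Units.val_mul, Units.val_mul]
        rw [← h1] at h3
        simpa only [mul_assoc] using h3
    rw [← D.conj_weyl_flag i]
    calc conj g (par G flagShape) = conj g (conj (g⁻¹ * weyl F i) (par G flagShape)) := by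
          rw [conj_eq_self hmem]
      _ = _ := by rw [conj_conj, mul_inv_cancel_left]
  · rintro rfl
    refine ⟨⟨weyl F i, D.weyl_mem i, ?_⟩, D.𝔞_subset_lie_par _, ?_⟩
    · rw [D.stdMinimalParabolic_eq, D.conj_weyl_flag]
    · rw [D.roots_par, posSystem_eq]

theorem rootSpaceSum_nilRoots (i : Fin 4) : rootSpaceSum G (nilRoots i) = nil F (maxShape i) := by
  refine D.rootSpaceSum_eq_nil fun ⟨k, l⟩ => ?_
  fin_cases i <;> fin_cases k <;> fin_cases l <;> simp [nilRoots, maxShape]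

theorem nilradical_lie_conj_par {b : Fin 3 → Fin 3} (hb : ∃ i j, b i ≠ b j) (g : GL3 F) :
    nilradical (lie (conj g (par G b))) =
      (nil F b).map (adEquiv g : Mat F →ₗ[ℝ] Mat F) := by
  rw [← D.nilradical_lie_par hb]
  exact (isDifferential_conj g).nilradical_lie_map _

theorem conj_par_eq_of_nil {b b' : Fin 3 → Fin 3} (hb : ∀ i j m, b j < b i → b m ≤ b i)
    (hb' : ∀ i j m, b' j < b' i → b' m ≤ b' i) {g : GL3 F}
    (h : (nil F b).map (adEquiv g : Mat F →ₗ[ℝ] Mat F) = nil F b') :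
    conj g (par G b) = par G b' := by
  have h1 : ∀ X ∈ nil F b, (g : Mat F) * X * (g⁻¹ : GL3 F) ∈ nil F b' := fun X hX => by
    rw [← h]
    exact ⟨X, hX, rfl⟩
  have h2 : ∀ X ∈ nil F b', ((g⁻¹ : GL3 F) : Mat F) * X * g ∈ nil F b := fun X hX => by
    rw [← h] at hX
    obtain ⟨Y, hY, rfl⟩ := hX
    change ((g⁻¹ : GL3 F) : Mat F) * (g * Y * (g⁻¹ : GL3 F)) * g ∈ nil F b
    simpa [mul_assoc] using hY
  ext x
  rw [mem_conj]
  constructor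
  · intro hx
    have hxG : x ∈ G := by
      have := D.conj_mem g hx.1
      rwa [show g * (g⁻¹ * x * g) * g⁻¹ = x by group] at this
    refine (mem_par_iff_forall_nil hb' hxG).2 fun X hX => ?_
    have h3 := h1 _ ((mem_par_iff_forall_nil hb hx.1).1 hx _ (h2 X hX))
    simpa [mul_assoc] using h3
  · intro hx
    have hyG : g⁻¹ * x * g ∈ G := by
      have := D.conj_mem g⁻¹ hx.1
      rwa [inv_inv] at this
    refine (mem_par_iff_forall_nil hb hyG).2 fun X hX => ?_
    have h3 := h2 _ ((mem_par_iff_forall_nil hb' hx.1).1 hx _ (h1 X hX))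
    simpa [mul_assoc] using h3

/-- The groups `Q_i` are block triangular. -/
theorem isStdQ_iff (i : Fin 4) (R : Subgroup (GL3 F)) :
    IsStdQ G i R ↔ R = par G (maxShape i) := by
  constructor
  · rintro ⟨hR, -, hnil⟩
    rw [D.rootSpaceSum_nilRoots] at hnil
    have hmax : ∀ k j m, maxShape i j < maxShape i k → maxShape i m ≤ maxShape i k := by
      clear hnil
      revert i
      decide
    obtain ⟨g, -, rfl | rfl⟩ := D.isMaximalParabolic_iff.1 hR
    · rw [D.nilradical_lie_conj_par ⟨0, 1, by decide⟩] at hnil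
      exact D.conj_par_eq_of_nil (by decide) hmax hnil
    · rw [D.nilradical_lie_conj_par ⟨0, 2, by decide⟩] at hnil
      exact D.conj_par_eq_of_nil (by decide) hmax hnil
  · rintro rfl
    refine ⟨D.isMaximalParabolic_iff.2 ?_, D.𝔞_subset_lie_par _, ?_⟩
    · fin_cases i
      · exact ⟨weyl F 0, D.weyl_mem 0, Or.inr (D.conj_weyl_plane 0).symm⟩
      · exact ⟨weyl F 2, D.weyl_mem 2, Or.inr (D.conj_weyl_plane 2).symm⟩
      · exact ⟨weyl F 0, D.weyl_mem 0, Or.inl (D.conj_weyl_line 0).symm⟩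
      · exact ⟨weyl F 1, D.weyl_mem 1, Or.inl (D.conj_weyl_line 1).symm⟩
    · rw [D.rootSpaceSum_nilRoots, D.nilradical_lie_par (by revert i; decide)]

end Determinant

end

/-! ### The orbits of `H` -/

section

variable {F : Type} [NormedDivisionRing F] [StarRing F] {G : Subgroup (GL3 F)}

theorem gram_weyl_inv (i : Fin 3) : (gram (weyl F i))⁻¹ = gram (weyl F i) := by
  refine inv_eq_of_mul_eq_one_right (Units.ext ?_)
  rw [Units.val_mul, gram_weyl, Matrix.diagonal_mul_diagonal, Units.val_one, ← Matrix.diagonal_one]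
  congr 1
  funext j
  split_ifs <;> simp

/-- An element of `H` that maps one coordinate parabolic subgroup to another, expressed in terms of
the same standard parabolic subgroup. -/
theorem exists_conj_eq_and_gram_eq {R R' : Subgroup (GL3 F)} {i j : Fin 3} {h : GL3 F} (hh : h ∈ H G)
    (he : conj (weyl F j) R' = conj h (conj (weyl F i) R)) :
    ∃ u : GL3 F, conj u R = R' ∧ gram (weyl F j * u) = gram (weyl F i) := by
  refine ⟨(weyl F j)⁻¹ * (h * weyl F i), ?_, ?_⟩
  · rw [← conj_conj, ← conj_conj, ← he, conj_conj, inv_mul_cancel, conj_one]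
  · rw [mul_inv_cancel_left, gram_mul, (mem_fixedBy_sigma.1 (H_le_fixedBy hh)).2, gram]

end

section

variable {F : Type} [NormedDivisionRing F] [NormedAlgebra ℝ F] [StarRing F] [IsRCH F]
  {G : Subgroup (GL3 F)}

/-- The sign of the hermitian form on the stabilized line is an invariant. -/
theorem eq_zero_iff_of_gram_eq {i j : Fin 3} {u : GL3 F}
    (hu : BlockTriangular (u : Mat F) lineShape) (h : gram (weyl F j * u) = gram (weyl F i)) :
    i = 0 ↔ j = 0 := by
  obtain ⟨h10, h20⟩ := blockTriangular_line_iff.1 hu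
  have h1 := congrArg (fun v : GL3 F => (v : Mat F) 0 0) h
  simp only [gram_mul, Units.val_mul, Units.coe_star, gram_weyl] at h1
  rw [Matrix.mul_apply, Fin.sum_univ_three, h10, h20, mul_zero, mul_zero, add_zero, add_zero,
    Matrix.mul_diagonal, Matrix.diagonal_apply_eq, Matrix.star_apply] at h1
  have hn : ((0 : Fin 3) = j → (0 : Fin 3) = i) ∧ ((0 : Fin 3) = i → (0 : Fin 3) = j) := by
    split_ifs at h1 with hj hi hi
    · exact ⟨fun _ => hi, fun _ => hj⟩
    · rw [mul_one, star_mul_self_eq] at h1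
      have h2 : ‖(u : Mat F) 0 0‖ ^ 2 = -1 := (algebraMap ℝ F).injective (by simpa using h1)
      nlinarith [sq_nonneg ‖(u : Mat F) 0 0‖]
    · rw [mul_neg, mul_one, neg_mul, star_mul_self_eq] at h1
      have h2 : -‖(u : Mat F) 0 0‖ ^ 2 = 1 := (algebraMap ℝ F).injective (by simpa using h1)
      nlinarith [sq_nonneg ‖(u : Mat F) 0 0‖]
    · exact ⟨fun h => absurd h hj, fun h => absurd h hi⟩
  exact ⟨fun h => (hn.2 h.symm).symm, fun h => (hn.1 h.symm).symm⟩

/-- The sign of the dual hermitian form on the stabilized plane is an invariant. -/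
theorem eq_two_iff_of_gram_eq {i j : Fin 3} {u : GL3 F}
    (hu : BlockTriangular (u : Mat F) planeShape) (h : gram (weyl F j * u) = gram (weyl F i)) :
    i = 2 ↔ j = 2 := by
  set v := u⁻¹ with hv
  have hu' : BlockTriangular (v : Mat F) planeShape := blockTriangular_inv hu
  obtain ⟨h20, h21⟩ := blockTriangular_plane_iff.1 hu'
  have h1 := congrArg (fun x : GL3 F => ((x⁻¹ : GL3 F) : Mat F) 2 2) h
  simp only [gram_mul, mul_inv_rev, ← star_inv, gram_weyl_inv] at h1
  rw [← hv, ← mul_assoc, Units.val_mul, Units.val_mul, Units.coe_star, gram_weyl, gram_weyl,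
    Matrix.mul_apply, Fin.sum_univ_three, Matrix.star_apply, Matrix.star_apply, h20, h21,
    star_zero, mul_zero, mul_zero, zero_add, zero_add,
    Matrix.mul_diagonal, Matrix.diagonal_apply_eq, Matrix.star_apply] at h1
  have hn : ((2 : Fin 3) = j → (2 : Fin 3) = i) ∧ ((2 : Fin 3) = i → (2 : Fin 3) = j) := by
    split_ifs at h1 with hj hi hi
    · exact ⟨fun _ => hi, fun _ => hj⟩
    · rw [mul_one, mul_star_self_eq] at h1
      have h2 : ‖(v : Mat F) 2 2‖ ^ 2 = -1 := (algebraMap ℝ F).injective (by simpa using h1)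
      nlinarith [sq_nonneg ‖(v : Mat F) 2 2‖]
    · rw [mul_neg, mul_one, neg_mul, mul_star_self_eq] at h1
      have h2 : -‖(v : Mat F) 2 2‖ ^ 2 = 1 := (algebraMap ℝ F).injective (by simpa using h1)
      nlinarith [sq_nonneg ‖(v : Mat F) 2 2‖]
    · exact ⟨fun h => absurd h hj, fun h => absurd h hi⟩
  exact ⟨fun h => (hn.2 h.symm).symm, fun h => (hn.1 h.symm).symm⟩

namespace Determinant

variable (D : Determinant G)
include D

theorem isMaximalParabolic_maxShape (i : Fin 4) : IsMaximalParabolic G (par G (maxShape i)) :=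
  ((D.isStdQ_iff i _).2 rfl).1

theorem isSigmaParabolic_minShape (i : Fin 3) {h : GL3 F} (hh : h ∈ H G) :
    IsSigmaParabolic G (conj h (par G (minShape i))) := by
  have hf := H_le_fixedBy hh
  refine D.isSigmaParabolic_conj_par (by revert i; decide) hf.2 ?_
  rw [← D.conj_weyl_flag, conj_conj]
  exact D.isParabolic_iff.2 ⟨_, mul_mem hf.1 (D.weyl_mem i), Or.inl rfl⟩

theorem isMaximalParabolic_conj {g : GL3 F} (hg : g ∈ G) {P : Subgroup (GL3 F)}
    (hP : IsMaximalParabolic G P) : IsMaximalParabolic G (conj g P) := by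
  obtain ⟨g', hg', h⟩ := D.isMaximalParabolic_iff.1 hP
  refine D.isMaximalParabolic_iff.2 ⟨g * g', mul_mem hg hg', ?_⟩
  rw [← conj_conj, ← conj_conj]
  exact h.imp (congrArg _) (congrArg _)

theorem isSigmaParabolic_maxShape (i : Fin 4) {h : GL3 F} (hh : h ∈ H G) :
    IsSigmaParabolic G (conj h (par G (maxShape i))) := by
  have hf := H_le_fixedBy hh
  exact D.isSigmaParabolic_conj_par (by revert i; decide) hf.2
    (D.isMaximalParabolic_conj hf.1 (D.isMaximalParabolic_maxShape i)).1.1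

theorem mem_minimalSigmaParabolics_iff (R : Subgroup (GL3 F)) :
    R ∈ minimalSigmaParabolics G ↔ ∃ i, ∃ h ∈ H G, R = conj h (par G (minShape i)) := by
  constructor
  · rintro ⟨hR, hmin⟩
    obtain ⟨i, h, hh, hle⟩ := D.exists_conj_minShape_le hR
    exact ⟨i, h, hh, le_antisymm (hmin (D.isSigmaParabolic_minShape i hh) hle) hle⟩
  · rintro ⟨i, h, hh, rfl⟩
    refine ⟨D.isSigmaParabolic_minShape i hh, fun Q hQ hle => ?_⟩
    rw [← D.conj_weyl_flag, conj_conj] at hle ⊢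
    exact (D.eq_conj_flag_of_le (mul_mem (H_le_fixedBy hh).1 (D.weyl_mem i)) hQ.1 hle).ge

theorem mem_maximalSigmaParabolics_iff (R : Subgroup (GL3 F)) :
    R ∈ maximalSigmaParabolics G ↔ ∃ i, ∃ h ∈ H G, R = conj h (par G (maxShape i)) := by
  have hmaximal : ∀ i, ∀ h ∈ H G, IsMaximalParabolic G (conj h (par G (maxShape i))) :=
    fun i h hh => D.isMaximalParabolic_conj (H_le_fixedBy hh).1 (D.isMaximalParabolic_maxShape i)
  constructor
  · rintro ⟨⟨hR, hRG⟩, hmax⟩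
    obtain ⟨i, h, hh, hle⟩ := D.exists_le_conj_maxShape hR hRG
    exact ⟨i, h, hh, le_antisymm hle
      (hmax ⟨D.isSigmaParabolic_maxShape i hh, (hmaximal i h hh).1.2⟩ hle)⟩
  · rintro ⟨i, h, hh, rfl⟩
    exact ⟨⟨D.isSigmaParabolic_maxShape i hh, (hmaximal i h hh).1.2⟩,
      fun Q hQ hle => (hmaximal i h hh).2 ⟨hQ.1.1, hQ.2⟩ hle⟩

theorem eq_of_par_minShape_eq_conj {i j : Fin 3} {h : GL3 F} (hh : h ∈ H G)
    (he : par G (minShape j) = conj h (par G (minShape i))) : i = j := by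
  rw [← D.conj_weyl_flag, ← D.conj_weyl_flag] at he
  obtain ⟨u, hu, hgram⟩ := exists_conj_eq_and_gram_eq hh he
  obtain ⟨hl, hp⟩ := blockTriangular_flag_iff.1 (D.blockTriangular_of_conj_flag_le hu.le)
  have h0 := eq_zero_iff_of_gram_eq hl hgram
  have h2 := eq_two_iff_of_gram_eq hp hgram
  clear he hgram
  revert i j
  decide

theorem eq_of_par_maxShape_eq_conj {i j : Fin 4} {h : GL3 F} (hh : h ∈ H G)
    (he : par G (maxShape j) = conj h (par G (maxShape i))) : i = j := by
  -- `Q_1` and `Q_2` are stabilizers of planes, `Q_3` and `Q_4` are stabilizers of lines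
  have hcases : ∀ i : Fin 4, (∃ k : Fin 3, (i = if k = 2 then 1 else 0) ∧
      par G (maxShape i) = conj (weyl F k) (par G planeShape)) ∨
      (∃ k : Fin 3, (i = if k = 0 then 2 else 3) ∧
        par G (maxShape i) = conj (weyl F k) (par G lineShape)) := by
    intro i
    fin_cases i
    · exact Or.inl ⟨0, rfl, (D.conj_weyl_plane 0).symm⟩
    · exact Or.inl ⟨2, rfl, (D.conj_weyl_plane 2).symm⟩
    · exact Or.inr ⟨0, rfl, (D.conj_weyl_line 0).symm⟩
    · exact Or.inr ⟨1, rfl, (D.conj_weyl_line 1).symm⟩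
  obtain ⟨k, hk, hi⟩ | ⟨k, hk, hi⟩ := hcases i <;>
    obtain ⟨l, hl, hj⟩ | ⟨l, hl, hj⟩ := hcases j <;>
    rw [hi, hj] at he <;>
    obtain ⟨u, hu, hgram⟩ := exists_conj_eq_and_gram_eq hh he
  · have h2 := eq_two_iff_of_gram_eq (D.blockTriangular_of_conj_plane_le hu.le) hgram
    rw [hk, hl]
    simp only [h2]
  · refine absurd ?_ (D.not_conj_line_le_plane u⁻¹)
    rw [← hu, conj_conj, inv_mul_cancel, conj_one]
  · exact absurd hu.le (D.not_conj_line_le_plane u)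
  · have h0 := eq_zero_iff_of_gram_eq (D.blockTriangular_of_conj_line_le hu.le) hgram
    rw [hk, hl]
    simp only [h0]

end Determinant

end

end

end SL3

/-- There are unique subgroups `P_i` and `Q_i` with their defining properties. The `H`-conjugates
of `P_1, P_2, P_3` are exactly the minimal `σ`-parabolic subgroups of `G = SL(3, F)`, and the `P_i`
are pairwise not `H`-conjugate. The `H`-conjugates of `Q_1, …, Q_4` are exactly the maximal
`σ`-parabolic subgroups of `G`, and the `Q_i` are pairwise not `H`-conjugate. -/
theorem proposition1p6 {F : Type} [NormedDivisionRing F] [NormedAlgebra ℝ F] [StarRing F]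
    (G : Subgroup (SL3.GL3 F)) (hG : SL3.IsSL3 F G) :
    (∃ P : Fin 3 → Subgroup (SL3.GL3 F),
      (∀ i R, SL3.IsStdP G i R ↔ R = P i) ∧
      (∀ R, R ∈ SL3.minimalSigmaParabolics G ↔ ∃ i, ∃ h ∈ SL3.H G, R = SL3.conj h (P i)) ∧
      (∀ i j, (∃ h ∈ SL3.H G, P j = SL3.conj h (P i)) → i = j)) ∧
    (∃ Q : Fin 4 → Subgroup (SL3.GL3 F),
      (∀ i R, SL3.IsStdQ G i R ↔ R = Q i) ∧
      (∀ R, R ∈ SL3.maximalSigmaParabolics G ↔ ∃ i, ∃ h ∈ SL3.H G, R = SL3.conj h (Q i)) ∧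
      (∀ i j, (∃ h ∈ SL3.H G, Q j = SL3.conj h (Q i)) → i = j)) := by
  obtain ⟨hF, ⟨D⟩⟩ := hG.exists_determinant
  exact ⟨⟨fun i => SL3.par G (SL3.minShape i), D.isStdP_iff, D.mem_minimalSigmaParabolics_iff,
      fun i j ⟨h, hh, he⟩ => D.eq_of_par_minShape_eq_conj hh he⟩,
    ⟨fun i => SL3.par G (SL3.maxShape i), D.isStdQ_iff, D.mem_maximalSigmaParabolics_iff,
      fun i j ⟨h, hh, he⟩ => D.eq_of_par_maxShape_eq_conj hh he⟩⟩
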